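/- Let $\Omega\subset\mathbb R^2$ be a compact strictly convex billiard table with the origin in its interior, $h_\Omega(\psi)=\max_{(x,y)\in\Omega}(x\cos\psi+y\sin\psi)$ its support function, $\gamma_\Omega(\psi)$ the boundary point with outer unit normal $(\cos\psi,\sin\psi)$, and $k_\Omega=1/(h_\Omega+h_\Omega'')$ its curvature. A closed convex curve in the interior of $\Omega$ is a 4-rationally integrable caustic (a 4-caustic) if every billiard orbit with one segment tangent to it has all its segments tangent to it, and all these orbits, up to reversal, are $(1,4)$-periodic, i.e. close up after 4 bounces and one turn around the boundary. A 4-loop is an orbit segment which starts at a boundary point, goes counterclockwise around the table exactly once and is back at its starting point after 4 bounces (at any angle). If exactly one 4-loop starts at each point $\gamma_\Omega(\psi)$, its initial angle $d_\Omega(\psi)\in(0,\pi)$ with the positive tangent is called the 4-loop angle function of $\Omega$. Let $\kappa_0>0$, $\kappa_1$ and $M$ be real numbers. There are $\varepsilon_1>0$ and $C>0$, depending only on $\kappa_0,\kappa_1,M$, such that the following holds for every $m\ge 40$. Let $\Omega_0$ be a table that is centrally symmetric about the origin, with $h_0=h_{\Omega_0}\in C^m$, $\|h_0\|_{C^m}<M$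 and $\kappa_0<k_{\Omega_0}<\kappa_1$. Then there is $R_0>0$ (depending only on $\Omega_0$ and $m$) such that, for every table $\Omega_\varepsilon$ with $h_\varepsilon=h_{\Omega_\varepsilon}\in C^m$, $\|h_\varepsilon\|_{C^m}<2M$ and $\varepsilon:=\|h_\varepsilon-h_0\|_{C^5}<\varepsilon_1$ that admits a 4-caustic, the 4-loop angle function $d_\varepsilon=d_{\Omega_\varepsilon}$ is well defined and, writing $O_n(\varepsilon)$ for a function of $\psi\in\mathbb R$ of class $C^n$ with $C^n$ norm at most $C\varepsilon$: (i) $d_\varepsilon(\psi+\pi)=d_\varepsilon(\psi)+O_3(\varepsilon)$. From each $\gamma_{\Omega_\varepsilon}(\psi)$ there starts exactly one $(1,4)$-periodic orbit, with initial angle $d_\varepsilon(\psi)$, and its four vertices, as functions of $\psi$, are $O_2(\varepsilon)$-close to the vertices of a parallelogram. (ii) The tangent lines to $\partial\Omega_\varepsilon$ at consecutive vertices of this orbit meet in four points which, as functions of $\psi$, are $O_2(\varepsilon)$-close to the vertices of a rectangle. (iii) $d_\varepsilon(\psi+\tfrac{\pi}{2})=\tfrac{\pi}{2}-d_\varepsilon(\psi)+O_2(\varepsilon)$.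 (iv) $h_\varepsilon(\psi)^2+h_\varepsilon(\psi+\tfrac{\pi}{2})^2=R_0^2+O_3(\varepsilon)$, $\ h_\varepsilon(\psi)=R_0\sin d_\varepsilon(\psi)+O_2(\varepsilon)$ and $h_\varepsilon(\psi+\tfrac{\pi}{2})=R_0\cos d_\varepsilon(\psi)+O_2(\varepsilon)$. -/

import Mathlib

open Real Set

noncomputable section

/-- The Euclidean plane. -/
abbrev Plane : Type := EuclideanSpace ℝ (Fin 2)

/-- The closed region of a billiard table: compact, strictly convex, the origin inside. -/
structure IsTable (Ω : Set Plane) : Prop where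
  isCompact : IsCompact Ω
  strictConvex : StrictConvex ℝ Ω
  origin_mem : (0 : Plane) ∈ interior Ω

/-- The support function `h_Ω(ψ) = sup {x cos ψ + y sin ψ : (x, y) ∈ Ω}`. -/
def supportFn (Ω : Set Plane) (ψ : ℝ) : ℝ :=
  sSup ((fun x : Plane => x 0 * cos ψ + x 1 * sin ψ) '' Ω)

/-- The boundary point `γ_Ω(ψ)` whose outer unit normal is `(cos ψ, sin ψ)`. -/
def bdryPoint (Ω : Set Plane) (ψ : ℝ) : Plane :=
  !₂[supportFn Ω ψ * cos ψ - deriv (supportFn Ω) ψ * sin ψ,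
     supportFn Ω ψ * sin ψ + deriv (supportFn Ω) ψ * cos ψ]

/-- The positive (counterclockwise) unit tangent at `γ_Ω(ψ)`. -/
def unitTangent (ψ : ℝ) : Plane := !₂[-sin ψ, cos ψ]

/-- The tangent line to `∂Ω` at `γ_Ω(ψ)`. -/
def tangentLine (Ω : Set Plane) (ψ : ℝ) : Set Plane :=
  {x | ∃ s : ℝ, x = bdryPoint Ω ψ + s • unitTangent ψ}

/-- The curvature `k_Ω = 1 / (h_Ω + h_Ω'')` of `∂Ω`, in the parameter `ψ`. -/
def curvature (Ω : Set Plane) (ψ : ℝ) : ℝ :=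
  (supportFn Ω ψ + iteratedDeriv 2 (supportFn Ω) ψ)⁻¹

/-- The `C^n` norm: the largest supremum of a derivative of order at most `n`
(used for periodic functions of class `C^n` only). -/
def cNorm (n : ℕ) (f : ℝ → ℝ) : ℝ :=
  ⨆ k : Fin (n + 1), ⨆ x : ℝ, |iteratedDeriv (k : ℕ) f x|

/-- `f` is of class `C^n` with `C^n` norm at most `B`. -/
def CBound {F : Type*} [NormedAddCommGroup F] [NormedSpace ℝ F]
    (n : ℕ) (B : ℝ) (f : ℝ → F) : Prop :=
  ContDiff ℝ n f ∧ ∀ k : ℕ, k ≤ n → ∀ x : ℝ, ‖iteratedDeriv k f x‖ ≤ B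

/-- The graph of the billiard map, lifted to the universal cover of the phase space. A state
`(ψ, θ)` is the point `γ_Ω(ψ)` with an inward direction at angle `θ` from the positive tangent.
The chord from `γ_Ω(ψ)` to `γ_Ω(ψ')` leaves at angle `θ` and arrives at angle `θ'`, which is the
angle at which it is reflected. -/
def BilliardStep (Ω : Set Plane) (a b : ℝ × ℝ) : Prop :=
  a.1 < b.1 ∧ b.1 < a.1 + 2 * π ∧
  a.2 = InnerProductGeometry.angle (unitTangent a.1) (bdryPoint Ω b.1 - bdryPoint Ω a.1) ∧
  b.2 = InnerProductGeometry.angle (unitTangent b.1) (bdryPoint Ω b.1 - bdryPoint Ω a.1)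

/-- A (lifted, bi-infinite) billiard orbit. -/
def IsOrbit (Ω : Set Plane) (z : ℤ → ℝ × ℝ) : Prop :=
  ∀ k : ℤ, BilliardStep Ω (z k) (z (k + 1))

/-- A lifted orbit is `(p, q)`-periodic: it closes up after `q` bounces, having gone `p` times
around the boundary. -/
def IsPeriodicOrbit (p q : ℕ) (z : ℤ → ℝ × ℝ) : Prop :=
  ∀ k : ℤ, z (k + q) = ((z k).1 + 2 * π * p, (z k).2)

/-- The segment from `x` to `y` touches the convex curve `∂K`. -/
def SegmentTangent (K : Set Plane) (x y : Plane) : Prop :=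
  (segment ℝ x y ∩ frontier K).Nonempty ∧ Disjoint (segment ℝ x y) (interior K)

/-- The `k`-th segment of the orbit `z` is tangent to `∂K`. -/
def OrbitTangentAt (Ω K : Set Plane) (z : ℤ → ℝ × ℝ) (k : ℤ) : Prop :=
  SegmentTangent K (bdryPoint Ω (z k).1) (bdryPoint Ω (z (k + 1)).1)

/-- The closed convex curve `∂K` inside the table is a caustic: an orbit with one segment
tangent to it has all its segments tangent to it. -/
structure IsCaustic (Ω K : Set Plane) : Prop where
  isCompact : IsCompact K
  convex : Convex ℝ K
  interior_nonempty : (interior K).Nonempty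
  subset_interior : K ⊆ interior Ω
  tangent : ∀ z, IsOrbit Ω z → ∀ j, OrbitTangentAt Ω K z j → ∀ k, OrbitTangentAt Ω K z k

/-- The caustic `∂K` is `q`-rationally integrable: all its tangential orbits are
`(1, q)`-periodic. The lift always advances counterclockwise, so that a `(1, q)`-periodic orbit
run through clockwise reads as a `(q - 1, q)`-periodic one. -/
def IsRationalCaustic (q : ℕ) (Ω K : Set Plane) : Prop :=
  IsCaustic Ω K ∧ ∀ z, IsOrbit Ω z → (∀ k, OrbitTangentAt Ω K z k) →
    IsPeriodicOrbit 1 q z ∨ IsPeriodicOrbit (q - 1) q z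

/-- The orbit starting at `γ_Ω(ψ)` with angle `θ` is a `q`-loop: after `q` bounces it is back at
its starting point (at any angle), having gone around the boundary exactly once. -/
def IsLoop (Ω : Set Plane) (q : ℕ) (ψ θ : ℝ) : Prop :=
  ∃ z : ℕ → ℝ × ℝ, z 0 = (ψ, θ) ∧ (∀ k < q, BilliardStep Ω (z k) (z (k + 1))) ∧
    (z q).1 = ψ + 2 * π

/-- `d` is the `q`-loop angle function: from each `γ_Ω(ψ)` there starts exactly one `q`-loop, and
`d ψ ∈ (0, π)` is its initial angle. -/
def IsLoopAngle (Ω : Set Plane) (q : ℕ) (d : ℝ → ℝ) : Prop :=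
  ∀ ψ, d ψ ∈ Ioo 0 π ∧ ∀ θ, IsLoop Ω q ψ θ ↔ θ = d ψ

/-- `P 0, P 1, P 2, P 3` are the consecutive vertices of a (nondegenerate) parallelogram. -/
def IsParallelogram (P : Fin 4 → Plane) : Prop :=
  P 0 + P 2 = P 1 + P 3 ∧ AffineIndependent ℝ ![P 0, P 1, P 2]

/-- `P 0, P 1, P 2, P 3` are the consecutive vertices of a (nondegenerate) rectangle. -/
def IsRectangle (P : Fin 4 → Plane) : Prop :=
  IsParallelogram P ∧ inner ℝ (P 1 - P 0) (P 3 - P 0) = 0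

end

/-! The counterclockwise tangent chords of a 4-caustic, one from each boundary point, form an
invariant curve of the billiard map, the graph of a function `d`, made up of (1,4)-periodic orbits
(`IsRationalCaustic.exists_invariantCurve`). The billiard map is a twist map: an orbit that starts
above the graph stays above it and gets strictly ahead, one that starts below falls strictly behind.
Hence the graph carries all 4-loops, and `d` is the loop angle function
(`IsInvariantCurve.isLoopAngle`).

Let `X k` and `Y k` be the normal angles of the vertices and of the chords of the orbit from ψ, and
`δ k` the reflection angles. Each `X (k + 1)` is the mean of `Y k` and `Y (k + 1)`, and the orbit
solves a second-order difference equation in the `Y k`, with `chordForm` as its generating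
expression. Difference quotients of the `Y k` solve a cyclic linear system. Monotonicity makes its
solution positive and the identity `Y 0 + Y 3 = 2ψ + 2π` normalizes it, so the derivatives of the `Y
k` are explicit rational expressions in the coefficients (`hasDerivAt_Y_aux`). Bootstrapping bounds
their higher derivatives (`uniformO_Y`).

On a symmetric table the half turn maps orbits to orbits. On the nearby table the orbit advanced by
two bounces and turned back by π solves the orbit equations up to O(ε). An exact orbit touching it
from above stays close to it by the twist inequality (`exists_orbit_close`), and since ψ ↦ `X 2 ψ` -
π is then an increasing approximate involution, it is close to the identity (`uniformO_symm_zero`).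
The linearized system carries this over to derivatives (`uniformO_symm_succ`).

From `δ (k + 2)` ≈ `δ k` and the angle sum π follow `X 1` ≈ ψ + π/2 and d(ψ + π/2) ≈ π/2 - d(ψ).
With q = h(· + π/2), the first two chord equations become h cos d ≈ q sin d and h' sin d + q' cos d
≈ 0 (`uniformO_chords`). Together they make the derivative of h² + q² small. So h² + q² is almost a
constant R², and the first relation gives h ≈ R sin d and q ≈ R cos d. Nearly opposite vertices give
the parallelogram, nearly perpendicular tangent lines the rectangle.

Uniformity is handled by a filter: all estimates are O-statements on the type of all data with fixed
curvature bound `r` and derivative bound `B`, as the symmetry defect tends to zero. Their constants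
therefore depend on `r` and `B` only. -/

open Filter Topology

/-! ### Calculus of uniform C^n bounds. -/

theorem CBound.succ_iff {n : ℕ} {B : ℝ} {f : ℝ → ℝ} :
    CBound (n + 1) B f ↔ (∀ x, |f x| ≤ B) ∧ Differentiable ℝ f ∧ CBound n B (deriv f) := by
  unfold CBound
  constructor
  · rintro ⟨h1, h2⟩
    have h1' : ContDiff ℝ ((n : WithTop ℕ∞) + 1) f := by exact_mod_cast h1
    rw [contDiff_succ_iff_deriv] at h1'
    refine ⟨fun x => by simpa using h2 0 (by omega) x, h1'.1, h1'.2.2, fun k hk x => ?_⟩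
    have := h2 (k + 1) (by omega) x
    rwa [iteratedDeriv_succ'] at this
  · rintro ⟨h0, hd, h1, h2⟩
    refine ⟨?_, fun k hk x => ?_⟩
    · have : ContDiff ℝ ((n : WithTop ℕ∞) + 1) f := by
        rw [contDiff_succ_iff_deriv]
        exact ⟨hd, by simp, h1⟩
      exact_mod_cast this
    · rcases k with _ | k
      · simpa using h0 x
      · rw [iteratedDeriv_succ']
        exact h2 k (by omega) x

theorem CBound.zero_iff {B : ℝ} {f : ℝ → ℝ} :
    CBound 0 B f ↔ Continuous f ∧ ∀ x, |f x| ≤ B := by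
  unfold CBound
  constructor
  · rintro ⟨h1, h2⟩
    exact ⟨h1.continuous, fun x => by simpa using h2 0 le_rfl x⟩
  · rintro ⟨h1, h2⟩
    refine ⟨contDiff_zero.2 h1, fun k hk x => ?_⟩
    obtain rfl : k = 0 := by omega
    simpa using h2 x

theorem CBound.abs_le {n : ℕ} {B : ℝ} {f : ℝ → ℝ} (h : CBound n B f) (x : ℝ) : |f x| ≤ B := by
  simpa using h.2 0 (Nat.zero_le n) x

theorem CBound.mono {F : Type*} [NormedAddCommGroup F] [NormedSpace ℝ F] {n k : ℕ} {B B' : ℝ}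
    {f : ℝ → F} (h : CBound n B f) (hk : k ≤ n)
    (hB : B ≤ B') : CBound k B' f :=
  ⟨h.1.of_le (by exact_mod_cast hk), fun j hj x => (h.2 j (hj.trans hk) x).trans hB⟩

/-- A family of functions is `O_n(e)`: eventually of class `C^n` with `C^n` norm at most a
constant times `e`. -/
def UniformO {ι : Type*} (l : Filter ι) (n : ℕ) (e : ι → ℝ) (F : ι → ℝ → ℝ) : Prop :=
  ∃ C, 0 ≤ C ∧ ∀ᶠ i in l, CBound n (C * e i) (F i)

/-- A family of functions that is eventually bounded below by one positive constant. -/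
def UniformPos {ι : Type*} (l : Filter ι) (F : ι → ℝ → ℝ) : Prop :=
  ∃ c, 0 < c ∧ ∀ᶠ i in l, ∀ x, c ≤ F i x

theorem continuous_of_sub_id {f : ℝ → ℝ} (h : Continuous fun x => f x - x) : Continuous f := by
  have := h.add continuous_id
  rwa [show (fun x => f x - x) + id = f from funext fun x => by simp] at this

theorem hasDerivAt_of_sub_id {f : ℝ → ℝ} {a x : ℝ} (h : HasDerivAt (fun x => f x - x) a x) :
    HasDerivAt f (a + 1) x := by
  have := h.add (hasDerivAt_id x)
  rwa [show (fun x => f x - x) + id = f from funext fun x => by simp] at this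

namespace UniformO

variable {ι : Type*} {l : Filter ι} {n k : ℕ} {e : ι → ℝ} {F G : ι → ℝ → ℝ}

theorem of_le (h : UniformO l n e F) (hk : k ≤ n) : UniformO l k e F := by
  obtain ⟨C, hC, h⟩ := h
  exact ⟨C, hC, h.mono fun i hi => hi.mono hk le_rfl⟩

theorem congr (h : UniformO l n e F) (hFG : ∀ᶠ i in l, ∀ x, F i x = G i x) : UniformO l n e G := by
  obtain ⟨C, hC, h⟩ := h
  refine ⟨C, hC, ?_⟩
  filter_upwards [h, hFG] with i hi hfg
  rwa [← show F i = G i from funext hfg]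

theorem congr' (h : UniformO l n e F) (hFG : ∀ i x, F i x = G i x) : UniformO l n e G :=
  h.congr (Eventually.of_forall hFG)

theorem zero_of (hF : ∀ᶠ i in l, Continuous (F i)) {C : ℝ} (hC : 0 ≤ C)
    (hB : ∀ᶠ i in l, ∀ x, |F i x| ≤ C * e i) : UniformO l 0 e F := by
  refine ⟨C, hC, ?_⟩
  filter_upwards [hF, hB] with i h1 h2
  exact CBound.zero_iff.2 ⟨h1, h2⟩

theorem differentiable (h : UniformO l (n + 1) e F) : ∀ᶠ i in l, Differentiable ℝ (F i) := by
  obtain ⟨C, hC, h⟩ := h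
  filter_upwards [h] with i hi using (CBound.succ_iff.1 hi).2.1

theorem continuous (h : UniformO l n e F) : ∀ᶠ i in l, Continuous (F i) := by
  obtain ⟨C, hC, h⟩ := h
  filter_upwards [h] with i hi using hi.1.continuous

theorem deriv (h : UniformO l (n + 1) e F) : UniformO l n e (fun i => _root_.deriv (F i)) := by
  obtain ⟨C, hC, h⟩ := h
  refine ⟨C, hC, ?_⟩
  filter_upwards [h] with i hi using (CBound.succ_iff.1 hi).2.2

theorem bound (h : UniformO l n e F) : ∃ C, 0 ≤ C ∧ ∀ᶠ i in l, ∀ x, |F i x| ≤ C * e i := by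
  obtain ⟨C, hC, h⟩ := h
  refine ⟨C, hC, ?_⟩
  filter_upwards [h] with i hi x using hi.abs_le x

theorem succ_of_hasDerivAt (he : 0 ≤ e) (h0 : UniformO l 0 e F)
    (hd : ∀ᶠ i in l, ∀ x, HasDerivAt (F i) (G i x) x) (hG : UniformO l n e G) :
    UniformO l (n + 1) e F := by
  obtain ⟨C, hC, h⟩ := h0
  obtain ⟨C', hC', h'⟩ := hG
  refine ⟨max C C', le_max_of_le_left hC, ?_⟩
  filter_upwards [h, h', hd] with i h1 h2 h3
  rw [CBound.succ_iff]
  refine ⟨fun x => (h1.abs_le x).trans ?_, fun x => (h3 x).differentiableAt, ?_⟩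
  · exact mul_le_mul_of_nonneg_right (le_max_left _ _) (he i)
  · rw [show _root_.deriv (F i) = G i from funext fun x => (h3 x).deriv]
    exact h2.mono le_rfl (mul_le_mul_of_nonneg_right (le_max_right _ _) (he i))

theorem add (hF : UniformO l n e F) (hG : UniformO l n e G) :
    UniformO l n e (fun i x => F i x + G i x) := by
  obtain ⟨C, hC, h⟩ := hF
  obtain ⟨C', hC', h'⟩ := hG
  refine ⟨C + C', by positivity, ?_⟩
  filter_upwards [h, h'] with i h1 h2
  refine ⟨h1.1.add h2.1, fun k hk x => ?_⟩
  have hk' : (k : WithTop ℕ∞) ≤ n := by exact_mod_cast hk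
  rw [show (fun x => F i x + G i x) = F i + G i from rfl,
    iteratedDeriv_add ((h1.1.of_le hk').contDiffAt) ((h2.1.of_le hk').contDiffAt)]
  refine (norm_add_le _ _).trans ?_
  rw [add_mul]
  exact add_le_add (h1.2 k hk x) (h2.2 k hk x)

theorem const_mul (a : ℝ) (hF : UniformO l n e F) : UniformO l n e (fun i x => a * F i x) := by
  obtain ⟨C, hC, h⟩ := hF
  refine ⟨|a| * C, by positivity, ?_⟩
  filter_upwards [h] with i h1
  refine ⟨contDiff_const.mul h1.1, fun k hk x => ?_⟩
  have hk' : (k : WithTop ℕ∞) ≤ n := by exact_mod_cast hk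
  rw [iteratedDeriv_const_mul_field, norm_mul, mul_assoc]
  exact mul_le_mul_of_nonneg_left (h1.2 k hk x) (abs_nonneg a)

theorem neg (hF : UniformO l n e F) : UniformO l n e (fun i x => -F i x) :=
  (hF.const_mul (-1)).congr' fun i x => by ring

theorem sub (hF : UniformO l n e F) (hG : UniformO l n e G) :
    UniformO l n e (fun i x => F i x - G i x) :=
  (hF.add hG.neg).congr' fun i x => by ring

theorem const {a : ι → ℝ} {C : ℝ} (he : 0 ≤ e) (h : ∀ᶠ i in l, |a i| ≤ C * e i) :
    UniformO l n e (fun i _ => a i) := by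
  refine ⟨max C 0, le_max_right _ _, ?_⟩
  filter_upwards [h] with i hi
  refine ⟨contDiff_const, fun k hk x => ?_⟩
  have : C * e i ≤ max C 0 * e i := mul_le_mul_of_nonneg_right (le_max_left _ _) (he i)
  rw [iteratedDeriv_const]
  split_ifs
  · exact hi.trans this
  · rw [norm_zero]
    exact mul_nonneg (le_max_right _ _) (he i)

theorem const_one (a : ℝ) : UniformO l n 1 (fun (_ : ι) _ => a) :=
  const (C := |a|) zero_le_one (by simp)

theorem mul {e' : ι → ℝ} (he : 0 ≤ e) (he' : 0 ≤ e') (hF : UniformO l n e F)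
    (hG : UniformO l n e' G) : UniformO l n (e * e') (fun i x => F i x * G i x) := by
  induction n generalizing F G with
  | zero =>
    obtain ⟨C, hC, h⟩ := hF
    obtain ⟨C', hC', h'⟩ := hG
    refine zero_of (C := C * C') ?_ (by positivity) ?_
    · filter_upwards [h, h'] with i h1 h2 using h1.1.continuous.mul h2.1.continuous
    · filter_upwards [h, h'] with i h1 h2 x
      rw [abs_mul, Pi.mul_apply, mul_mul_mul_comm]
      exact mul_le_mul (h1.abs_le x) (h2.abs_le x) (abs_nonneg _) (mul_nonneg hC (he i))
  | succ n ih =>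
    refine succ_of_hasDerivAt (mul_nonneg he he')
      ((ih (hF.of_le n.le_succ) (hG.of_le n.le_succ)).of_le n.zero_le) ?_
      ((ih hF.deriv (hG.of_le n.le_succ)).add (ih (hF.of_le n.le_succ) hG.deriv))
    filter_upwards [hF.differentiable, hG.differentiable] with i h1 h2 x
    exact (h1 x).hasDerivAt.mul (h2 x).hasDerivAt

theorem mul_one' (he : 0 ≤ e) (hF : UniformO l n e F) (hG : UniformO l n 1 G) :
    UniformO l n e (fun i x => F i x * G i x) := by
  simpa using mul he zero_le_one hF hG

theorem one_mul' (he : 0 ≤ e) (hF : UniformO l n 1 F) (hG : UniformO l n e G) :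
    UniformO l n e (fun i x => F i x * G i x) := by
  simpa using mul zero_le_one he hF hG

theorem mul11 (hF : UniformO l n 1 F) (hG : UniformO l n 1 G) :
    UniformO l n 1 (fun i x => F i x * G i x) := mul_one' zero_le_one hF hG

theorem inv (hF : UniformO l n 1 F) (hp : UniformPos l F) :
    UniformO l n 1 (fun i x => (F i x)⁻¹) := by
  obtain ⟨c, hc, hp⟩ := hp
  induction n with
  | zero =>
    refine zero_of (C := c⁻¹) ?_ (by positivity) ?_
    · filter_upwards [hF.continuous, hp] with i h1 h2
      exact h1.inv₀ fun x => (hc.trans_le (h2 x)).ne'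
    · filter_upwards [hp] with i h2 x
      have := hc.trans_le (h2 x)
      rw [abs_of_pos (inv_pos.2 this), Pi.one_apply, mul_one]
      exact inv_anti₀ hc (h2 x)
  | succ n ih =>
    have := ih (hF.of_le n.le_succ)
    refine succ_of_hasDerivAt zero_le_one (this.of_le n.zero_le) ?_
      (hF.deriv.neg.mul11 (this.mul11 this))
    filter_upwards [hF.differentiable, hp] with i h1 h2 x
    have hx := (hc.trans_le (h2 x)).ne'
    refine ((h1 x).hasDerivAt.inv hx).congr_deriv ?_
    rw [← mul_inv, ← sq, div_eq_mul_inv]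

theorem div (he : 0 ≤ e) (hF : UniformO l n e F) (hG : UniformO l n 1 G) (hp : UniformPos l G) :
    UniformO l n e (fun i x => F i x / G i x) :=
  (mul_one' he hF (hG.inv hp)).congr' fun i x => by rw [div_eq_mul_inv]

/-- The inner maps are lifts of circle maps, hence unbounded: only the difference from the identity
can be controlled. -/
theorem comp {X : ι → ℝ → ℝ} (he : 0 ≤ e) (hF : UniformO l n e F)
    (hX : UniformO l n 1 (fun i x => X i x - x)) : UniformO l n e (fun i x => F i (X i x)) := by
  have hcont : ∀ᶠ i in l, Continuous (X i) := by
    filter_upwards [hX.continuous] with i hi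
    exact continuous_of_sub_id hi
  induction n generalizing F with
  | zero =>
    obtain ⟨C, hC, h⟩ := hF
    refine zero_of ?_ hC ?_
    · filter_upwards [h, hcont] with i h1 h2 using h1.1.continuous.comp h2
    · filter_upwards [h] with i h1 x using h1.abs_le _
  | succ n ih =>
    have h0 := ih (hF.of_le n.le_succ) (hX.of_le n.le_succ)
    refine succ_of_hasDerivAt he (h0.of_le n.zero_le) ?_
      (mul_one' he (ih hF.deriv (hX.of_le n.le_succ)) (hX.deriv.add (const_one 1)))
    filter_upwards [hF.differentiable, hX.differentiable] with i h1 h2 x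
    have h3 : HasDerivAt (X i) (_root_.deriv (fun x => X i x - x) x + 1) x :=
      hasDerivAt_of_sub_id (h2 x).hasDerivAt
    exact HasDerivAt.comp x (h1 _).hasDerivAt h3

/-- The mean value inequality, applied to each derivative; this costs one derivative of `F`. -/
theorem comp_sub {X Y : ι → ℝ → ℝ} (he : 0 ≤ e) (hF : UniformO l (n + 1) 1 F)
    (hX : UniformO l n 1 (fun i x => X i x - x)) (hY : UniformO l n 1 (fun i x => Y i x - x))
    (hXY : UniformO l n e (fun i x => X i x - Y i x)) :
    UniformO l n e (fun i x => F i (X i x) - F i (Y i x)) := by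
  have hXc : ∀ᶠ i in l, Continuous (X i) := by
    filter_upwards [hX.continuous] with i hi
    exact continuous_of_sub_id hi
  have hYc : ∀ᶠ i in l, Continuous (Y i) := by
    filter_upwards [hY.continuous] with i hi
    exact continuous_of_sub_id hi
  induction n generalizing F with
  | zero =>
    obtain ⟨C, hC, h⟩ := hF
    obtain ⟨C', hC', h'⟩ := hXY.bound
    refine zero_of (C := C * C') ?_ (by positivity) ?_
    · filter_upwards [h, hXc, hYc] with i h1 h2 h3
      exact (h1.1.continuous.comp h2).sub (h1.1.continuous.comp h3)
    · filter_upwards [h, h'] with i h1 h2 x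
      obtain ⟨-, hd, hb⟩ := CBound.succ_iff.1 h1
      have := Convex.norm_image_sub_le_of_norm_deriv_le (s := univ) (f := F i) (C := C)
        (fun y _ => hd y) (fun y _ => by simpa using hb.abs_le y) convex_univ (mem_univ (Y i x))
        (mem_univ (X i x))
      rw [Real.norm_eq_abs, Real.norm_eq_abs] at this
      refine this.trans ?_
      rw [mul_assoc]
      exact mul_le_mul_of_nonneg_left (h2 x) hC
  | succ n ih =>
    have hX' := hX.of_le n.le_succ
    have hY' := hY.of_le n.le_succ
    have h0 := ih (hF.of_le (n + 1).le_succ) hX' hY' (hXY.of_le n.le_succ)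
    have h1 := ih hF.deriv hX' hY' (hXY.of_le n.le_succ)
    refine succ_of_hasDerivAt he (h0.of_le n.zero_le) ?_
      ((mul_one' he h1 (hX.deriv.add (const_one 1))).add
        (one_mul' he (comp zero_le_one (hF.deriv.of_le n.le_succ) hY') hXY.deriv))
    filter_upwards [hF.differentiable, hX.differentiable, hY.differentiable] with i h1 h2 h3 x
    have h4 : HasDerivAt (X i) (_root_.deriv (fun x => X i x - x) x + 1) x :=
      hasDerivAt_of_sub_id (h2 x).hasDerivAt
    have h5 : HasDerivAt (Y i) (_root_.deriv (fun x => Y i x - x) x + 1) x :=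
      hasDerivAt_of_sub_id (h3 x).hasDerivAt
    have h6 := (h4.sub h5).deriv
    change _root_.deriv (fun x => X i x - Y i x) x = _ at h6
    refine ((HasDerivAt.comp x (h1 _).hasDerivAt h4).sub
      (HasDerivAt.comp x (h1 _).hasDerivAt h5)).congr_deriv ?_
    rw [h6]
    ring

end UniformO

theorem CBound.sin_cos (n : ℕ) : CBound n 1 sin ∧ CBound n 1 cos ∧ CBound n 1 (fun x => -sin x) := by
  induction n with
  | zero =>
    refine ⟨CBound.zero_iff.2 ⟨continuous_sin, abs_sin_le_one⟩,
      CBound.zero_iff.2 ⟨continuous_cos, abs_cos_le_one⟩,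
      CBound.zero_iff.2 ⟨continuous_sin.neg, fun x => by simpa using abs_sin_le_one x⟩⟩
  | succ n ih =>
    obtain ⟨h1, h2, h3⟩ := ih
    refine ⟨CBound.succ_iff.2 ⟨abs_sin_le_one, differentiable_sin, by simpa using h2⟩,
      CBound.succ_iff.2 ⟨abs_cos_le_one, differentiable_cos, ?_⟩,
      CBound.succ_iff.2 ⟨fun x => by simpa using abs_sin_le_one x, differentiable_sin.neg, ?_⟩⟩
    · rwa [show deriv cos = fun x => -sin x from funext fun x => Real.deriv_cos]
    · rw [show deriv (fun x => -sin x) = fun x => -cos x from funext fun x => by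
        rw [deriv.fun_neg, Real.deriv_sin]]
      refine ⟨h2.1.neg, fun k hk x => ?_⟩
      have := h2.2 k hk x
      rwa [show (fun x => -cos x) = -cos from rfl, iteratedDeriv_neg, norm_neg]

namespace UniformO

variable {ι : Type*} {l : Filter ι} {n : ℕ} {e : ι → ℝ} {F G X Y : ι → ℝ → ℝ}

theorem sin_const : UniformO l n 1 (fun _ : ι => sin) :=
  ⟨1, zero_le_one, Eventually.of_forall fun i => by simpa using (CBound.sin_cos n).1⟩

theorem cos_const : UniformO l n 1 (fun _ : ι => cos) :=
  ⟨1, zero_le_one, Eventually.of_forall fun i => by simpa using (CBound.sin_cos n).2.1⟩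

/-- The composition with a bounded inner function. -/
theorem comp_bdd (hF : UniformO l n 1 F) (hX : UniformO l n 1 X) :
    UniformO l n 1 (fun i x => F i (X i x)) := by
  have hcont := hX.continuous
  induction n generalizing F with
  | zero =>
    obtain ⟨C, hC, h⟩ := hF
    refine zero_of ?_ hC ?_
    · filter_upwards [h, hcont] with i h1 h2 using h1.1.continuous.comp h2
    · filter_upwards [h] with i h1 x using h1.abs_le _
  | succ n ih =>
    have h0 := ih (hF.of_le n.le_succ) (hX.of_le n.le_succ)
    refine succ_of_hasDerivAt zero_le_one (h0.of_le n.zero_le) ?_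
      (mul11 (ih hF.deriv (hX.of_le n.le_succ)) hX.deriv)
    filter_upwards [hF.differentiable, hX.differentiable] with i h1 h2 x
    exact HasDerivAt.comp x (h1 _).hasDerivAt (h2 x).hasDerivAt

theorem comp_bdd_sub (he : 0 ≤ e) (hF : UniformO l (n + 1) 1 F)
    (hX : UniformO l n 1 X) (hY : UniformO l n 1 Y)
    (hXY : UniformO l n e (fun i x => X i x - Y i x)) :
    UniformO l n e (fun i x => F i (X i x) - F i (Y i x)) := by
  have hXc := hX.continuous
  have hYc := hY.continuous
  induction n generalizing F with
  | zero =>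
    obtain ⟨C, hC, h⟩ := hF
    obtain ⟨C', hC', h'⟩ := hXY.bound
    refine zero_of (C := C * C') ?_ (by positivity) ?_
    · filter_upwards [h, hXc, hYc] with i h1 h2 h3
      exact (h1.1.continuous.comp h2).sub (h1.1.continuous.comp h3)
    · filter_upwards [h, h'] with i h1 h2 x
      obtain ⟨-, hd, hb⟩ := CBound.succ_iff.1 h1
      have := Convex.norm_image_sub_le_of_norm_deriv_le (s := univ) (f := F i) (C := C)
        (fun y _ => hd y) (fun y _ => by simpa using hb.abs_le y) convex_univ (mem_univ (Y i x))
        (mem_univ (X i x))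
      rw [Real.norm_eq_abs, Real.norm_eq_abs] at this
      refine this.trans ?_
      rw [mul_assoc]
      exact mul_le_mul_of_nonneg_left (h2 x) hC
  | succ n ih =>
    have hX' := hX.of_le n.le_succ
    have hY' := hY.of_le n.le_succ
    have h0 := ih (hF.of_le (n + 1).le_succ) hX' hY' (hXY.of_le n.le_succ)
    have h1 := ih hF.deriv hX' hY' (hXY.of_le n.le_succ)
    refine succ_of_hasDerivAt he (h0.of_le n.zero_le) ?_
      ((mul_one' he h1 hX.deriv).add
        (one_mul' he (comp_bdd (hF.deriv.of_le n.le_succ) hY') hXY.deriv))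
    filter_upwards [hF.differentiable, hX.differentiable, hY.differentiable] with i h1 h2 h3 x
    have h6 := ((h2 x).hasDerivAt.sub (h3 x).hasDerivAt).deriv
    change _root_.deriv (fun x => X i x - Y i x) x = _ at h6
    refine ((HasDerivAt.comp x (h1 _).hasDerivAt (h2 x).hasDerivAt).sub
      (HasDerivAt.comp x (h1 _).hasDerivAt (h3 x).hasDerivAt)).congr_deriv ?_
    rw [h6]
    ring

theorem mul_sub_mul {F' G' : ι → ℝ → ℝ} (he : 0 ≤ e) (hF : UniformO l n 1 F)
    (hG' : UniformO l n 1 G') (hFF' : UniformO l n e (fun i x => F i x - F' i x))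
    (hGG' : UniformO l n e (fun i x => G i x - G' i x)) :
    UniformO l n e (fun i x => F i x * G i x - F' i x * G' i x) :=
  ((one_mul' he hF hGG').add (mul_one' he hFF' hG')).congr' fun i x => by ring

end UniformO

namespace UniformPos

variable {ι : Type*} {l : Filter ι} {n : ℕ} {e : ι → ℝ} {F G : ι → ℝ → ℝ}

theorem mul (hF : UniformPos l F) (hG : UniformPos l G) :
    UniformPos l (fun i x => F i x * G i x) := by
  obtain ⟨c, hc, h⟩ := hF
  obtain ⟨c', hc', h'⟩ := hG
  refine ⟨c * c', by positivity, ?_⟩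
  filter_upwards [h, h'] with i h1 h2 x
  exact mul_le_mul (h1 x) (h2 x) hc'.le (hc.le.trans (h1 x))

theorem add (hF : UniformPos l F) (hG : UniformPos l G) :
    UniformPos l (fun i x => F i x + G i x) := by
  obtain ⟨c, hc, h⟩ := hF
  obtain ⟨c', hc', h'⟩ := hG
  refine ⟨c + c', by positivity, ?_⟩
  filter_upwards [h, h'] with i h1 h2 x
  exact add_le_add (h1 x) (h2 x)

theorem mono (hF : UniformPos l F) (h : ∀ᶠ i in l, ∀ x, F i x ≤ G i x) : UniformPos l G := by
  obtain ⟨c, hc, h'⟩ := hF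
  refine ⟨c, hc, ?_⟩
  filter_upwards [h, h'] with i h1 h2 x
  exact (h2 x).trans (h1 x)

theorem of_sub (hF : UniformPos l F) (he : Tendsto e l (𝓝 0))
    (hFG : UniformO l n e (fun i x => F i x - G i x)) : UniformPos l G := by
  obtain ⟨c, hc, h⟩ := hF
  obtain ⟨C, hC, h'⟩ := hFG.bound
  have h3 : Tendsto (fun i => C * e i) l (𝓝 0) := by simpa using he.const_mul C
  refine ⟨c / 2, by positivity, ?_⟩
  filter_upwards [h, h', h3.eventually_lt_const (half_pos hc)] with i h1 h2 h3 x
  have := (abs_le.1 (h2 x)).2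
  linarith [h1 x]

theorem comp (hF : UniformPos l F) (X : ι → ℝ → ℝ) : UniformPos l (fun i x => F i (X i x)) := by
  obtain ⟨c, hc, h⟩ := hF
  exact ⟨c, hc, h.mono fun i hi x => hi _⟩

end UniformPos

/-! ### Support functions and chords. -/

/-- For the convex curve with support function `h`: the value of the linear form
`⟨·, (cos φ, sin φ)⟩` at the point with normal angle `x`. -/
noncomputable def supportAt (h : ℝ → ℝ) (x φ : ℝ) : ℝ := h x * cos (φ - x) + deriv h x * sin (φ - x)

/-- A `C²` support function with positive radius of curvature. -/
structure IsSmoothSupport (h : ℝ → ℝ) : Prop where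
  contDiff : ContDiff ℝ 2 h
  periodic : Function.Periodic h (2 * π)
  pos : ∀ x, 0 < h x + deriv (deriv h) x

/-- The chord from the point with normal angle `a` to the point with normal angle `b`, where
`φ` is the angle of its right-hand normal. -/
structure IsChord (h : ℝ → ℝ) (a φ b : ℝ) : Prop where
  left : φ ∈ Ioo a (a + π)
  right : φ ∈ Ioo (b - π) b
  eq : supportAt h a φ = supportAt h b φ

theorem supportAt_self (h : ℝ → ℝ) (x : ℝ) : supportAt h x x = h x := by simp [supportAt]

/-- The values of a fixed point in three directions are linearly dependent. This transfers an
inequality at a point from one direction to another. -/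
theorem supportAt_identity (h : ℝ → ℝ) (x p q r : ℝ) :
    supportAt h x p * sin (q - r) + supportAt h x q * sin (r - p) +
      supportAt h x r * sin (p - q) = 0 := by
  simp only [supportAt, sin_sub, cos_sub]
  ring

theorem deriv_periodic {h : ℝ → ℝ} {c : ℝ} (hp : Function.Periodic h c) :
    Function.Periodic (deriv h) c := fun x => by
  rw [← deriv_comp_add_const, show (fun x => h (x + c)) = h from funext hp]

theorem supportAt_add_pi (h : ℝ → ℝ) (x φ : ℝ) : supportAt h x (φ + π) = -supportAt h x φ := by
  simp only [supportAt, show φ + π - x = φ - x + π by ring, sin_add_pi, cos_add_pi]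
  ring

namespace IsSmoothSupport

variable {h : ℝ → ℝ} (hh : IsSmoothSupport h)
include hh

theorem hasDerivAt (x : ℝ) : HasDerivAt h (deriv h x) x :=
  ((hh.contDiff.differentiable (by norm_num)) x).hasDerivAt

theorem hasDerivAt_deriv (x : ℝ) : HasDerivAt (deriv h) (deriv (deriv h) x) x := by
  have : ContDiff ℝ (1 + 1) h := by simpa [one_add_one_eq_two] using hh.contDiff
  have h1 : ContDiff ℝ 1 (deriv h) := (contDiff_succ_iff_deriv.1 this).2.2
  exact ((h1.differentiable one_ne_zero) x).hasDerivAt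

/-- The boundary point moves along its unit tangent with speed the radius of curvature, so the sign
of the sine decides the monotonicity. Every convexity argument below rests on this formula. -/
theorem hasDerivAt_supportAt (φ x : ℝ) :
    HasDerivAt (fun x => supportAt h x φ) ((h x + deriv (deriv h) x) * sin (φ - x)) x := by
  have h1 : HasDerivAt (fun x => φ - x) (-1) x := by simpa using (hasDerivAt_id x).const_sub φ
  refine (((hh.hasDerivAt x).mul h1.cos).add ((hh.hasDerivAt_deriv x).mul h1.sin)).congr_deriv ?_
  ring

theorem supportAt_add_two_pi (x φ : ℝ) : supportAt h (x + 2 * π) φ = supportAt h x φ := by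
  simp only [supportAt, hh.periodic x, deriv_periodic hh.periodic x,
    show φ - (x + 2 * π) = φ - x - 2 * π by ring, sin_sub_two_pi, cos_sub_two_pi]

theorem continuous_supportAt (φ : ℝ) : Continuous fun x => supportAt h x φ :=
  continuous_iff_continuousAt.2 fun x => (hh.hasDerivAt_supportAt φ x).continuousAt

theorem strictMonoOn (φ : ℝ) : StrictMonoOn (fun x => supportAt h x φ) (Icc (φ - π) φ) := by
  refine strictMonoOn_of_deriv_pos (convex_Icc _ _) (hh.continuous_supportAt φ).continuousOn
    fun x hx => ?_
  rw [interior_Icc] at hx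
  rw [(hh.hasDerivAt_supportAt φ x).deriv]
  exact mul_pos (hh.pos x) (sin_pos_of_pos_of_lt_pi (by linarith [hx.2]) (by linarith [hx.1]))

theorem strictAntiOn (φ : ℝ) : StrictAntiOn (fun x => supportAt h x φ) (Icc φ (φ + π)) := by
  refine strictAntiOn_of_deriv_neg (convex_Icc _ _) (hh.continuous_supportAt φ).continuousOn
    fun x hx => ?_
  rw [interior_Icc] at hx
  rw [(hh.hasDerivAt_supportAt φ x).deriv]
  exact mul_neg_of_pos_of_neg (hh.pos x)
    (sin_neg_of_neg_of_neg_pi_lt (by linarith [hx.1]) (by linarith [hx.2]))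

theorem supportAt_lt {a b : ℝ} (h1 : a < b) (h2 : b < a + 2 * π) : supportAt h a b < h b := by
  rw [← supportAt_self h b]
  rcases le_total (b - π) a with h3 | h3
  · exact hh.strictMonoOn b ⟨h3, h1.le⟩ ⟨by linarith [pi_pos], le_rfl⟩ h1
  · rw [← hh.supportAt_add_two_pi a b]
    exact hh.strictAntiOn b ⟨le_rfl, by linarith [pi_pos]⟩ ⟨h2.le, by linarith⟩ h2

theorem supportAt_lt' {a b : ℝ} (h1 : a < b) (h2 : b < a + 2 * π) : supportAt h b a < h a := by
  rw [← hh.periodic a]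
  have := hh.supportAt_lt h2 (by linarith)
  rwa [show a + 2 * π = a + π + π by ring, supportAt_add_pi, supportAt_add_pi, neg_neg,
    show a + π + π = a + 2 * π by ring] at this

/-- On the increasing arc from `φ - π` to `φ` the value at `a` is strictly between the two extremes.
The decreasing arc from `φ` to `φ + π` runs through the same range and takes this value again. -/
theorem exists_right {a φ : ℝ} (h1 : φ ∈ Ioo a (a + π)) : ∃ b, IsChord h a φ b := by
  have h2 := hh.strictMonoOn φ ⟨by linarith [h1.2], h1.1.le⟩ ⟨by linarith [pi_pos], le_rfl⟩ h1.1
  have h3 := hh.strictMonoOn φ ⟨le_rfl, by linarith [pi_pos]⟩ ⟨by linarith [h1.2], h1.1.le⟩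
    (show φ - π < a by linarith [h1.2])
  simp only at h2 h3
  rw [← hh.supportAt_add_two_pi (φ - π), show φ - π + 2 * π = φ + π by ring] at h3
  obtain ⟨b, hb, hb'⟩ := intermediate_value_Ioo' (by linarith [pi_pos] : φ ≤ φ + π)
    (hh.continuous_supportAt φ).continuousOn ⟨h3, h2⟩
  exact ⟨b, h1, ⟨by linarith [hb.2], hb.1⟩, hb'.symm⟩

theorem exists_left {b φ : ℝ} (h1 : φ ∈ Ioo (b - π) b) : ∃ a, IsChord h a φ b := by
  have h2 := hh.strictAntiOn φ ⟨le_rfl, by linarith [pi_pos]⟩ ⟨h1.2.le, by linarith [h1.1]⟩ h1.2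
  have h3 := hh.strictAntiOn φ ⟨h1.2.le, by linarith [h1.1]⟩ ⟨by linarith [pi_pos], le_rfl⟩
    (show b < φ + π by linarith [h1.1])
  simp only at h2 h3
  rw [show φ + π = φ - π + 2 * π by ring, hh.supportAt_add_two_pi] at h3
  obtain ⟨a, ha, ha'⟩ := intermediate_value_Ioo (by linarith [pi_pos] : φ - π ≤ φ)
    (hh.continuous_supportAt φ).continuousOn ⟨h3, h2⟩
  exact ⟨a, ⟨ha.2, by linarith [ha.1]⟩, h1, ha'⟩

theorem right_unique {a φ b b' : ℝ} (h1 : IsChord h a φ b) (h2 : IsChord h a φ b') : b = b' :=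
  (hh.strictAntiOn φ).injOn ⟨h1.right.2.le, by linarith [h1.right.1]⟩
    ⟨h2.right.2.le, by linarith [h2.right.1]⟩ (h1.eq.symm.trans h2.eq)

theorem left_unique {a a' φ b : ℝ} (h1 : IsChord h a φ b) (h2 : IsChord h a' φ b) : a = a' :=
  (hh.strictMonoOn φ).injOn ⟨by linarith [h1.left.2], h1.left.1.le⟩
    ⟨by linarith [h2.left.2], h2.left.1.le⟩ (h1.eq.trans h2.eq.symm)

/-- The twist property: turning a chord counterclockwise about its initial point advances its
endpoint. By the three-direction identity the old endpoint `b` lies strictly beyond the turned line,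
hence before `b'` on the decreasing arc. -/
theorem right_lt_right {a φ φ' b b' : ℝ} (h1 : IsChord h a φ b) (h2 : IsChord h a φ' b')
    (hφ : φ < φ') : b < b' := by
  rcases lt_or_ge b φ' with h3 | h3
  · exact h3.trans h2.right.2
  have ha : supportAt h b a < h a := hh.supportAt_lt' (h1.left.1.trans h1.right.2)
    (by linarith [h1.left.2, h1.right.1])
  rw [← supportAt_self h a] at ha
  have e1 := supportAt_identity h b a φ φ'
  have e2 := supportAt_identity h a a φ φ'
  have e3 := h1.eq
  have s1 : 0 < sin (φ' - φ) :=
    sin_pos_of_pos_of_lt_pi (by linarith) (by linarith [h1.left.1, h2.left.2])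
  have s2 : 0 < sin (φ - a) :=
    sin_pos_of_pos_of_lt_pi (by linarith [h1.left.1]) (by linarith [h1.left.2])
  rw [← neg_sub φ' φ, sin_neg, ← neg_sub φ a, sin_neg] at e1 e2
  have : 0 < (supportAt h b φ' - supportAt h a φ') * sin (φ - a) := by
    rw [e3] at e2
    nlinarith
  have h4 : supportAt h b' φ' < supportAt h b φ' := by
    rw [← h2.eq]
    linarith [pos_of_mul_pos_left this s2.le]
  exact ((hh.strictAntiOn φ').lt_iff_gt ⟨h2.right.2.le, by linarith [h2.right.1]⟩
    ⟨h3, by linarith [h1.right.1]⟩).1 h4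

theorem left_lt_left {a a' φ φ' b : ℝ} (h1 : IsChord h a φ b) (h2 : IsChord h a' φ' b)
    (hφ : φ < φ') : a < a' := by
  rcases lt_or_ge φ a' with h3 | h3
  · exact h1.left.1.trans h3
  have ha : supportAt h a' b < h b := hh.supportAt_lt (h2.left.1.trans h2.right.2)
    (by linarith [h2.left.2, h2.right.1])
  rw [← supportAt_self h b] at ha
  have e1 := supportAt_identity h b b φ' φ
  have e2 := supportAt_identity h a' b φ' φ
  have e3 := h2.eq
  have s1 : 0 < sin (φ' - φ) :=
    sin_pos_of_pos_of_lt_pi (by linarith) (by linarith [h1.right.1, h2.right.2])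
  have s2 : 0 < sin (b - φ') :=
    sin_pos_of_pos_of_lt_pi (by linarith [h2.right.2]) (by linarith [h2.right.1])
  have : 0 < (supportAt h a' φ - supportAt h b φ) * sin (b - φ') := by
    rw [e3] at e2
    nlinarith
  have h4 : supportAt h a φ < supportAt h a' φ := by
    rw [h1.eq]
    linarith [pos_of_mul_pos_left this s2.le]
  exact ((hh.strictMonoOn φ).lt_iff_lt ⟨by linarith [h1.left.2], h1.left.1.le⟩
    ⟨by linarith [h2.left.2], h3⟩).1 h4

theorem chord_lt_of_left_lt {a a' φ φ' b : ℝ} (h1 : IsChord h a φ b) (h2 : IsChord h a' φ' b)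
    (ha : a < a') : φ < φ' := by
  rcases lt_trichotomy φ φ' with h3 | rfl | h3
  · exact h3
  · exact absurd (hh.left_unique h1 h2) ha.ne
  · exact absurd (hh.left_lt_left h2 h1 h3) ha.not_gt

theorem chord_unique {a φ φ' b : ℝ} (h1 : IsChord h a φ b) (h2 : IsChord h a φ' b) : φ = φ' := by
  rcases lt_trichotomy φ φ' with h3 | h3 | h3
  · exact absurd (hh.right_lt_right h1 h2 h3) (lt_irrefl _)
  · exact h3
  · exact absurd (hh.right_lt_right h2 h1 h3) (lt_irrefl _)

end IsSmoothSupport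

/-! ### Billiard steps as chords. -/

/-- The value of the linear form `⟨·, (cos φ, sin φ)⟩`. -/
noncomputable def normalForm (v : Plane) (φ : ℝ) : ℝ := v 0 * cos φ + v 1 * sin φ

theorem normalForm_sub (v w : Plane) (φ : ℝ) :
    normalForm (v - w) φ = normalForm v φ - normalForm w φ := by
  simp [normalForm]
  ring

theorem normalForm_smul_unitTangent (s φ₀ φ : ℝ) :
    normalForm (s • unitTangent φ₀) φ = s * sin (φ - φ₀) := by
  simp [normalForm, unitTangent, sin_sub]
  ring

theorem normalForm_bdryPoint (Ω : Set Plane) (x φ : ℝ) :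
    normalForm (bdryPoint Ω x) φ = supportAt (supportFn Ω) x φ := by
  simp [normalForm, bdryPoint, supportAt, sin_sub, cos_sub]
  ring

theorem exists_polar (v : Plane) (hv : v ≠ 0) (a : ℝ) :
    ∃ s : ℝ, 0 < s ∧ ∃ φ ∈ Ico a (a + 2 * π), v = s • unitTangent φ := by
  -- This is -i times `v`: its argument is the angle whose unit tangent points along `v`.
  set w : ℂ := ⟨v 1, -v 0⟩ with hw
  have hw0 : w ≠ 0 := by
    intro h0
    apply hv
    have h1 := congrArg Complex.re h0
    have h2 := congrArg Complex.im h0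
    simp [hw] at h1 h2
    ext i
    fin_cases i
    · simpa using h2
    · simpa using h1
  refine ⟨‖w‖, norm_pos_iff.2 hw0, toIcoMod two_pi_pos a (Complex.arg w),
    toIcoMod_mem_Ico two_pi_pos a _, ?_⟩
  have e : toIcoMod two_pi_pos a (Complex.arg w) =
      Complex.arg w - toIcoDiv two_pi_pos a (Complex.arg w) * (2 * π) := by
    rw [toIcoMod, zsmul_eq_mul]
  have e1 : ‖w‖ * sin (toIcoMod two_pi_pos a (Complex.arg w)) = w.im := by
    rw [e, sin_sub_int_mul_two_pi, Complex.norm_mul_sin_arg]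
  have e2 : ‖w‖ * cos (toIcoMod two_pi_pos a (Complex.arg w)) = w.re := by
    rw [e, cos_sub_int_mul_two_pi, Complex.norm_mul_cos_arg]
  ext i
  fin_cases i
  · simp only [unitTangent, PiLp.smul_apply, smul_eq_mul, Fin.zero_eta, Matrix.cons_val_zero,
      mul_neg, e1]
    simp [hw]
  · simp only [unitTangent, PiLp.smul_apply, smul_eq_mul, Fin.mk_one, Matrix.cons_val_one,
      Matrix.cons_val_fin_one, e2]
    simp [hw]

theorem norm_unitTangent (φ : ℝ) : ‖unitTangent φ‖ = 1 := by
  simp [unitTangent, EuclideanSpace.norm_eq]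

theorem inner_unitTangent (φ ψ : ℝ) : inner ℝ (unitTangent φ) (unitTangent ψ) = cos (ψ - φ) := by
  simp [unitTangent, cos_sub, PiLp.inner_apply, Fin.sum_univ_two]
  ring

theorem angle_unitTangent_smul {a φ s : ℝ} (hs : 0 < s) (h1 : 0 ≤ φ - a) (h2 : φ - a ≤ π) :
    InnerProductGeometry.angle (unitTangent a) (s • unitTangent φ) = φ - a := by
  rw [InnerProductGeometry.angle_smul_right_of_pos _ _ hs, InnerProductGeometry.angle,
    inner_unitTangent, norm_unitTangent, norm_unitTangent, mul_one, div_one, arccos_cos h1 h2]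

theorem angle_unitTangent_smul' {a φ s : ℝ} (hs : 0 < s) (h1 : 0 ≤ a - φ) (h2 : a - φ ≤ π) :
    InnerProductGeometry.angle (unitTangent a) (s • unitTangent φ) = a - φ := by
  rw [InnerProductGeometry.angle_smul_right_of_pos _ _ hs, InnerProductGeometry.angle,
    inner_unitTangent, norm_unitTangent, norm_unitTangent, mul_one, div_one, ← cos_neg, neg_sub,
    arccos_cos h1 h2]

section Billiard

variable {Ω : Set Plane} (hh : IsSmoothSupport (supportFn Ω))
include hh

theorem exists_chord {a b : ℝ} (h1 : a < b) (h2 : b < a + 2 * π) :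
    ∃ s : ℝ, 0 < s ∧ ∃ φ, IsChord (supportFn Ω) a φ b ∧
      bdryPoint Ω b - bdryPoint Ω a = s • unitTangent φ := by
  have e1 := hh.supportAt_lt h1 h2
  have e2 := hh.supportAt_lt' h1 h2
  rw [← supportAt_self (supportFn Ω)] at e1 e2
  have hv : bdryPoint Ω b - bdryPoint Ω a ≠ 0 := by
    intro h0
    have := normalForm_sub (bdryPoint Ω b) (bdryPoint Ω a) b
    rw [h0, normalForm_bdryPoint, normalForm_bdryPoint] at this
    simp [normalForm] at this
    linarith
  obtain ⟨s, hs, φ, hφ, e⟩ := exists_polar _ hv a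
  have key : ∀ ψ, supportAt (supportFn Ω) b ψ - supportAt (supportFn Ω) a ψ = s * sin (ψ - φ) := by
    intro ψ
    rw [← normalForm_bdryPoint, ← normalForm_bdryPoint, ← normalForm_sub, e,
      normalForm_smul_unitTangent]
  have k1 : sin (a - φ) < 0 := by
    have := key a
    by_contra hc
    push Not at hc
    nlinarith [mul_nonneg hs.le hc]
  have k2 : 0 < sin (b - φ) := by
    have := key b
    by_contra hc
    push Not at hc
    nlinarith [mul_nonneg hs.le (neg_nonneg.2 hc)]
  have l1 : a < φ := by
    rcases hφ.1.eq_or_lt with h | h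
    · rw [h] at k1
      simp at k1
    · exact h
  have l2 : φ < a + π := by
    by_contra hc
    push Not at hc
    have : sin (a - φ) = sin (a - φ + 2 * π) := (sin_add_two_pi _).symm
    rw [this] at k1
    exact k1.not_ge (sin_nonneg_of_nonneg_of_le_pi (by linarith [hφ.2]) (by linarith))
  have l3 : φ < b := by
    by_contra hc
    push Not at hc
    exact k2.not_ge (sin_nonpos_of_nonpos_of_neg_pi_le (by linarith) (by linarith))
  have l4 : b - π < φ := by
    by_contra hc
    push Not at hc
    rw [← sin_sub_two_pi] at k2
    exact k2.not_ge (sin_nonpos_of_nonpos_of_neg_pi_le (by linarith) (by linarith))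
  refine ⟨s, hs, φ, ⟨⟨l1, l2⟩, ⟨l4, l3⟩, ?_⟩, e⟩
  have := key φ
  simp at this
  linarith

theorem IsChord.sub_eq {a φ b : ℝ} (hc : IsChord (supportFn Ω) a φ b) :
    ∃ s : ℝ, 0 < s ∧ bdryPoint Ω b - bdryPoint Ω a = s • unitTangent φ := by
  obtain ⟨s, hs, φ', hφ', e⟩ := exists_chord hh (hc.left.1.trans hc.right.2)
    (by linarith [hc.left.2, hc.right.1])
  rw [hh.chord_unique hc hφ']
  exact ⟨s, hs, e⟩

/-- The normal angle of the chord is both the initial normal angle plus the outgoing angle and the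
final normal angle minus the incoming one. The geometry reduces to one scalar equation for support
values. -/
theorem billiardStep_iff {p q : ℝ × ℝ} :
    BilliardStep Ω p q ↔ IsChord (supportFn Ω) p.1 (p.1 + p.2) q.1 ∧ q.2 = q.1 - (p.1 + p.2) := by
  constructor
  · rintro ⟨h1, h2, h3, h4⟩
    obtain ⟨s, hs, φ, hc, e⟩ := exists_chord hh h1 h2
    rw [e, angle_unitTangent_smul hs (by linarith [hc.left.1]) (by linarith [hc.left.2])] at h3
    rw [e, angle_unitTangent_smul' hs (by linarith [hc.right.2]) (by linarith [hc.right.1])] at h4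
    have : p.1 + p.2 = φ := by linarith
    rw [this]
    exact ⟨hc, h4⟩
  · rintro ⟨hc, h⟩
    obtain ⟨s, hs, e⟩ := hc.sub_eq hh
    refine ⟨hc.left.1.trans hc.right.2, by linarith [hc.left.2, hc.right.1], ?_, ?_⟩
    · rw [e, angle_unitTangent_smul hs (by linarith [hc.left.1]) (by linarith [hc.left.2])]
      ring
    · rw [e, angle_unitTangent_smul' hs (by linarith [hc.right.2]) (by linarith [hc.right.1]), h]

theorem BilliardStep.unique {p q q' : ℝ × ℝ} (h1 : BilliardStep Ω p q)
    (h2 : BilliardStep Ω p q') : q = q' := by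
  rw [billiardStep_iff hh] at h1 h2
  have := hh.right_unique h1.1 h2.1
  ext
  · exact this
  · rw [h1.2, h2.2, this]

theorem BilliardStep.unique_left {p p' q : ℝ × ℝ} (h1 : BilliardStep Ω p q)
    (h2 : BilliardStep Ω p' q) : p = p' := by
  rw [billiardStep_iff hh] at h1 h2
  have e : p.1 + p.2 = p'.1 + p'.2 := by linarith [h1.2, h2.2]
  have e1 := h1.1
  rw [e] at e1
  have := hh.left_unique e1 h2.1
  ext
  · exact this
  · linarith

theorem exists_orbit {a φ : ℝ} (h1 : φ ∈ Ioo a (a + π)) :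
    ∃ z, IsOrbit Ω z ∧ z 0 = (a, φ - a) := by
  -- On this open phase strip the billiard step is a bijection, so its integer powers give a
  -- bi-infinite orbit.
  let S := {p : ℝ × ℝ // p.2 ∈ Ioo 0 π}
  have hex : ∀ p : S, ∃ q : S, BilliardStep Ω p.1 q.1 := by
    rintro ⟨⟨x, θ⟩, hθ⟩
    obtain ⟨b, hb⟩ := hh.exists_right (a := x) (φ := x + θ) ⟨by linarith [hθ.1], by linarith [hθ.2]⟩
    refine ⟨⟨(b, b - (x + θ)), ⟨?_, ?_⟩⟩, (billiardStep_iff hh).2 ⟨hb, rfl⟩⟩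
    · simpa using hb.right.2
    · simp only
      linarith [hb.right.1]
  choose T hT using hex
  have hbij : Function.Bijective T := by
    constructor
    · intro p p' e
      have h2 := hT p'
      rw [← e] at h2
      exact Subtype.ext ((hT p).unique_left hh h2)
    · rintro ⟨⟨x, θ⟩, hθ⟩
      obtain ⟨b, hb⟩ := hh.exists_left (b := x) (φ := x - θ)
        ⟨by linarith [hθ.2], by linarith [hθ.1]⟩
      refine ⟨⟨(b, x - θ - b), ⟨?_, ?_⟩⟩, ?_⟩
      · simpa using hb.left.1
      · simp only
        linarith [hb.left.2]
      · refine Subtype.ext ((hT _).unique hh ((billiardStep_iff hh).2 ⟨?_, ?_⟩))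
        · simpa using hb
        · simp
  let E : Equiv.Perm S := Equiv.ofBijective T hbij
  let p : S := ⟨(a, φ - a), ⟨by simpa using h1.1, by simp only; linarith [h1.2]⟩⟩
  refine ⟨fun k => ((E ^ k) p).1, fun k => ?_, by simp [p]⟩
  simp only
  rw [add_comm, zpow_one_add]
  exact hT _

end Billiard

/-! ### The invariant curve of a rational caustic. -/

/-- A continuous invariant curve of the billiard map, made up of 4-periodic orbits: it is the
graph of `d`, and `f` is the induced map of the boundary. -/
structure IsInvariantCurve (h d f : ℝ → ℝ) : Prop where
  angle_mem : ∀ x, d x ∈ Ioo 0 π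
  chord : ∀ x, IsChord h x (x + d x) (f x)
  next : ∀ x, f x = x + d x + d (f x)
  iterate_four : ∀ x, f (f (f (f x))) = x + 2 * π
  strictMono : StrictMono f
  strictMono_normal : StrictMono fun x => x + d x
  periodic : Function.Periodic d (2 * π)

/-- The line through `γ_Ω(a)` with right-hand normal angle `φ` touches `K` and has it on its
left. -/
structure IsLeftTangent (Ω K : Set Plane) (a φ : ℝ) : Prop where
  mem : φ ∈ Ioo a (a + π)
  le : ∀ k ∈ K, normalForm k φ ≤ supportAt (supportFn Ω) a φ
  touch : ∃ k ∈ K, normalForm k φ = supportAt (supportFn Ω) a φ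

theorem continuous_normalForm (φ : ℝ) : Continuous fun v : Plane => normalForm v φ := by
  unfold normalForm
  fun_prop

theorem normalForm_identity (v : Plane) (p q r : ℝ) :
    normalForm v p * sin (q - r) + normalForm v q * sin (r - p) +
      normalForm v r * sin (p - q) = 0 := by
  simp only [normalForm, sin_sub]
  ring

theorem normalForm_add_smul_normal (v : Plane) (t φ : ℝ) :
    normalForm (v + t • !₂[cos φ, sin φ]) φ = normalForm v φ + t := by
  have := sin_sq_add_cos_sq φ
  simp [normalForm]
  linear_combination t * this

theorem normalForm_add_pi (v : Plane) (φ : ℝ) : normalForm v (φ + π) = -normalForm v φ := by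
  simp [normalForm]
  ring

theorem exists_smul_unitTangent {v : Plane} {φ : ℝ} (h : normalForm v φ = 0) :
    ∃ s : ℝ, v = s • unitTangent φ := by
  have h2 := sin_sq_add_cos_sq φ
  unfold normalForm at h
  refine ⟨v 1 * cos φ - v 0 * sin φ, ?_⟩
  ext i
  fin_cases i
  · simp [unitTangent]
    linear_combination cos φ * h - v 0 * h2
  · simp [unitTangent]
    linear_combination sin φ * h - v 1 * h2

theorem exists_normalForm_gt {A : Set Plane} {k : Plane} (hk : k ∈ interior A) (φ : ℝ) :
    ∃ k' ∈ A, normalForm k φ < normalForm k' φ := by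
  have hc : Continuous fun t : ℝ => k + t • (!₂[cos φ, sin φ] : Plane) := by fun_prop
  have h0 : ∀ᶠ t : ℝ in 𝓝[>] 0, k + t • (!₂[cos φ, sin φ] : Plane) ∈ A := by
    refine (hc.continuousAt.eventually_mem ?_).filter_mono nhdsWithin_le_nhds
    simpa using mem_interior_iff_mem_nhds.1 hk
  obtain ⟨t, ht, ht'⟩ := (h0.and self_mem_nhdsWithin).exists
  refine ⟨_, ht, ?_⟩
  rw [normalForm_add_smul_normal]
  exact lt_add_of_pos_right _ ht'

theorem normalForm_lt_supportFn {Ω : Set Plane} (hΩ : IsCompact Ω) {k : Plane}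
    (hk : k ∈ interior Ω) (φ : ℝ) : normalForm k φ < supportFn Ω φ := by
  obtain ⟨k', hk', hlt⟩ := exists_normalForm_gt hk φ
  exact hlt.trans_le (le_csSup (hΩ.bddAbove_image (continuous_normalForm φ).continuousOn)
    (mem_image_of_mem _ hk'))

theorem IsChord.lt_supportAt {h : ℝ → ℝ} (hh : IsSmoothSupport h) {a φ b x : ℝ}
    (hc : IsChord h a φ b) (h1 : a < x) (h2 : x < b) : supportAt h a φ < supportAt h x φ := by
  rcases le_total x φ with h3 | h3
  · exact hh.strictMonoOn φ ⟨by linarith [hc.left.2], hc.left.1.le⟩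
      ⟨by linarith [hc.left.2], h3⟩ h1
  · rw [hc.eq]
    exact hh.strictAntiOn φ ⟨h3, by linarith [hc.right.1]⟩ ⟨hc.right.2.le, by linarith [hc.right.1]⟩
      h2

section Caustic

variable {Ω K : Set Plane} (hΩ : IsCompact Ω) (hh : IsSmoothSupport (supportFn Ω))
  (hK : IsCompact K) (hKΩ : K ⊆ interior Ω)

include hΩ hKΩ in
theorem normalForm_sub_bdryPoint_neg {k : Plane} (hk : k ∈ K) (a : ℝ) :
    normalForm (k - bdryPoint Ω a) a < 0 := by
  rw [normalForm_sub, normalForm_bdryPoint, supportAt_self]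
  linarith [normalForm_lt_supportFn hΩ (hKΩ hk) a]

include hΩ hK hKΩ in
-- Seen from the boundary point, the compact set `K` lies strictly inside the tangent half-plane.
-- The direction towards `K` of least angle with the tangent is attained and gives the supporting
-- line.
theorem exists_leftTangent (hne : K.Nonempty) (a : ℝ) : ∃ φ, IsLeftTangent Ω K a φ := by
  have hpol : ∀ k ∈ K, ∃ s : ℝ, 0 < s ∧ ∃ φ ∈ Ioo a (a + π),
      k - bdryPoint Ω a = s • unitTangent φ := by
    intro k hk
    have h1 := normalForm_sub_bdryPoint_neg hΩ hKΩ hk a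
    have hv : k - bdryPoint Ω a ≠ 0 := by
      intro h0
      rw [h0] at h1
      simp [normalForm] at h1
    obtain ⟨s, hs, φ, hφ, e⟩ := exists_polar _ hv a
    rw [e, normalForm_smul_unitTangent] at h1
    have k1 : sin (a - φ) < 0 := by
      by_contra hc
      push Not at hc
      nlinarith [mul_nonneg hs.le hc]
    refine ⟨s, hs, φ, ⟨?_, ?_⟩, e⟩
    · rcases hφ.1.eq_or_lt with h | h
      · rw [h] at k1
        simp at k1
      · exact h
    · by_contra hc
      push Not at hc
      rw [← sin_add_two_pi] at k1
      exact k1.not_ge (sin_nonneg_of_nonneg_of_le_pi (by linarith [hφ.2]) (by linarith))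
  have hcont : ContinuousOn (fun k => InnerProductGeometry.angle (unitTangent a)
      (k - bdryPoint Ω a)) K := by
    intro k hk
    have hv : k - bdryPoint Ω a ≠ 0 := by
      intro h0
      have h1 := normalForm_sub_bdryPoint_neg hΩ hKΩ hk a
      rw [h0] at h1
      simp [normalForm] at h1
    have hu : unitTangent a ≠ 0 := by
      rw [← norm_ne_zero_iff, norm_unitTangent]
      exact one_ne_zero
    have h2 : ContinuousAt (fun k : Plane => (unitTangent a, k - bdryPoint Ω a)) k := by fun_prop
    exact (ContinuousAt.comp (f := fun k : Plane => (unitTangent a, k - bdryPoint Ω a))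
      (InnerProductGeometry.continuousAt_angle (x := (unitTangent a, k - bdryPoint Ω a)) hu hv)
      h2).continuousWithinAt
  obtain ⟨k₀, hk₀, hmin⟩ := hK.exists_isMinOn hne hcont
  obtain ⟨s₀, hs₀, φ₀, hφ₀, e₀⟩ := hpol k₀ hk₀
  refine ⟨φ₀, hφ₀, fun k hk => ?_, k₀, hk₀, ?_⟩
  · obtain ⟨s, hs, φ, hφ, e⟩ := hpol k hk
    have := hmin hk
    simp only [mem_ofPred_eq] at this
    rw [e, e₀, angle_unitTangent_smul hs₀ (by linarith [hφ₀.1]) (by linarith [hφ₀.2]),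
      angle_unitTangent_smul hs (by linarith [hφ.1]) (by linarith [hφ.2])] at this
    have h1 := normalForm_sub k (bdryPoint Ω a) φ₀
    rw [e, normalForm_smul_unitTangent, normalForm_bdryPoint] at h1
    have h2 : sin (φ₀ - φ) ≤ 0 :=
      sin_nonpos_of_nonpos_of_neg_pi_le (by linarith) (by linarith [hφ.2, hφ₀.1])
    nlinarith
  · have h1 := normalForm_sub k₀ (bdryPoint Ω a) φ₀
    rw [e₀, normalForm_smul_unitTangent, normalForm_bdryPoint] at h1
    simp at h1
    linarith

include hΩ hKΩ in
/-- Turning a tangent line through `γ_Ω(a)` counterclockwise makes it cross `K`. -/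
theorem IsLeftTangent.exists_pos {a φ φ' : ℝ} (h1 : IsLeftTangent Ω K a φ) (h2 : φ ≤ φ')
    (h3 : φ' < a + π) : ∃ k ∈ K, supportAt (supportFn Ω) a φ' ≤ normalForm k φ' ∧
      (φ < φ' → supportAt (supportFn Ω) a φ' < normalForm k φ') := by
  obtain ⟨k, hk, e⟩ := h1.touch
  have hneg := normalForm_sub_bdryPoint_neg hΩ hKΩ hk a
  have e0 : normalForm (k - bdryPoint Ω a) φ = 0 := by
    rw [normalForm_sub, normalForm_bdryPoint, e, sub_self]
  have e1 := normalForm_identity (k - bdryPoint Ω a) a φ φ'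
  have s2 : 0 < sin (φ - a) :=
    sin_pos_of_pos_of_lt_pi (by linarith [h1.mem.1]) (by linarith [h1.mem.2])
  rw [e0, ← neg_sub φ' φ, ← neg_sub φ a, sin_neg, sin_neg] at e1
  have e2 : normalForm (k - bdryPoint Ω a) φ' * sin (φ - a) =
      -normalForm (k - bdryPoint Ω a) a * sin (φ' - φ) := by linarith
  rw [normalForm_sub _ _ φ', normalForm_bdryPoint] at e2
  refine ⟨k, hk, ?_, fun hlt => ?_⟩
  · have s1 : 0 ≤ sin (φ' - φ) :=
      sin_nonneg_of_nonneg_of_le_pi (by linarith) (by linarith [h1.mem.1])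
    have : 0 ≤ (normalForm k φ' - supportAt (supportFn Ω) a φ') * sin (φ - a) := by
      rw [e2]
      exact mul_nonneg (by linarith) s1
    linarith [nonneg_of_mul_nonneg_left this s2]
  · have s1 : 0 < sin (φ' - φ) := sin_pos_of_pos_of_lt_pi (by linarith) (by linarith [h1.mem.1])
    have : 0 < (normalForm k φ' - supportAt (supportFn Ω) a φ') * sin (φ - a) := by
      rw [e2]
      exact mul_pos (by linarith) s1
    linarith [pos_of_mul_pos_left this s2.le]

include hΩ hKΩ in
theorem IsLeftTangent.unique {a φ φ' : ℝ} (h1 : IsLeftTangent Ω K a φ)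
    (h2 : IsLeftTangent Ω K a φ') : φ = φ' := by
  rcases lt_trichotomy φ φ' with h3 | h3 | h3
  · obtain ⟨k, hk, -, hlt⟩ := h1.exists_pos hΩ hKΩ h3.le h2.mem.2
    exact absurd (h2.le k hk) (hlt h3).not_ge
  · exact h3
  · obtain ⟨k, hk, -, hlt⟩ := h2.exists_pos hΩ hKΩ h3.le h1.mem.2
    exact absurd (h1.le k hk) (hlt h3).not_ge

include hΩ hh hKΩ in
-- If the second line were not turned further, `K` would have a point at least as far in direction
-- `φ` as the boundary point at `a'`. But boundary points strictly inside the arc cut off by the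
-- first chord lie beyond its line, while `K` does not.
theorem IsLeftTangent.normal_lt {a φ a' φ' : ℝ} (h1 : IsLeftTangent Ω K a φ)
    (h2 : IsLeftTangent Ω K a' φ') (ha : a < a') : φ < φ' := by
  obtain ⟨b, hb⟩ := hh.exists_right h1.mem
  rcases le_or_gt b a' with h3 | h3
  · exact hb.right.2.trans (h3.trans_lt h2.mem.1)
  by_contra hc
  push Not at hc
  obtain ⟨k, hk, hle, -⟩ := h2.exists_pos hΩ hKΩ hc (by linarith [h1.mem.2])
  linarith [h1.le k hk, hb.lt_supportAt hh ha h3]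

include hΩ hh hKΩ in
theorem IsLeftTangent.right_lt {a φ b a' φ' b' : ℝ} (h1 : IsLeftTangent Ω K a φ)
    (h2 : IsLeftTangent Ω K a' φ') (hb : IsChord (supportFn Ω) a φ b)
    (hb' : IsChord (supportFn Ω) a' φ' b') (ha : a < a') : b < b' := by
  have hφ := h1.normal_lt hΩ hh hKΩ h2 ha
  by_contra hc
  push Not at hc
  have h3 : supportAt (supportFn Ω) b φ ≤ supportAt (supportFn Ω) b' φ :=
    (hh.strictAntiOn φ).antitoneOn ⟨by linarith [hb'.right.2], by linarith [hb.right.1]⟩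
      ⟨hb.right.2.le, by linarith [hb.right.1]⟩ hc
  obtain ⟨k, hk, e⟩ := h2.touch
  have hneg := normalForm_sub_bdryPoint_neg hΩ hKΩ hk b'
  have e0 : normalForm (k - bdryPoint Ω b') φ' = 0 := by
    rw [normalForm_sub, normalForm_bdryPoint, e, hb'.eq, sub_self]
  have e1 := normalForm_identity (k - bdryPoint Ω b') b' φ' φ
  have e3 : normalForm (k - bdryPoint Ω b') φ ≤ 0 := by
    rw [normalForm_sub, normalForm_bdryPoint]
    linarith [h1.le k hk, hb.eq]
  have s1 : 0 < sin (φ' - φ) :=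
    sin_pos_of_pos_of_lt_pi (by linarith) (by linarith [hb'.right.2, hb.right.1])
  have s2 : 0 < sin (b' - φ') :=
    sin_pos_of_pos_of_lt_pi (by linarith [hb'.right.2]) (by linarith [hb'.right.1])
  rw [e0] at e1
  nlinarith

include hΩ hh hKΩ in
theorem mem_segment_of_normalForm_eq {a φ b : ℝ} (hc : IsChord (supportFn Ω) a φ b) {k : Plane}
    (hk : k ∈ K) (e : normalForm k φ = supportAt (supportFn Ω) a φ) :
    k ∈ segment ℝ (bdryPoint Ω a) (bdryPoint Ω b) := by
  obtain ⟨s, hs, e1⟩ := hc.sub_eq hh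
  have e0 : normalForm (k - bdryPoint Ω a) φ = 0 := by
    rw [normalForm_sub, normalForm_bdryPoint, e, sub_self]
  obtain ⟨t, ht⟩ := exists_smul_unitTangent e0
  have ht' : k - bdryPoint Ω b = (t - s) • unitTangent φ := by
    rw [sub_smul, ← ht, ← e1]
    abel
  have n1 := normalForm_sub_bdryPoint_neg hΩ hKΩ hk a
  have n2 := normalForm_sub_bdryPoint_neg hΩ hKΩ hk b
  rw [ht, normalForm_smul_unitTangent] at n1
  rw [ht', normalForm_smul_unitTangent] at n2
  have s1 : sin (a - φ) < 0 :=
    sin_neg_of_neg_of_neg_pi_lt (by linarith [hc.left.1]) (by linarith [hc.left.2])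
  have s2 : 0 < sin (b - φ) :=
    sin_pos_of_pos_of_lt_pi (by linarith [hc.right.2]) (by linarith [hc.right.1])
  have t1 : 0 < t := by
    by_contra h
    push Not at h
    nlinarith [mul_nonneg_of_nonpos_of_nonpos h s1.le]
  have t2 : t < s := by
    by_contra h
    push Not at h
    nlinarith [mul_nonneg (sub_nonneg.2 h) s2.le]
  rw [segment_eq_image']
  refine ⟨t / s, ⟨by positivity, (div_le_one hs).2 t2.le⟩, ?_⟩
  simp only
  rw [e1, smul_smul, div_mul_cancel₀ _ hs.ne', ← ht]
  abel

theorem normalForm_of_mem_segment {a φ b : ℝ} (hc : IsChord (supportFn Ω) a φ b) {x : Plane}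
    (hx : x ∈ segment ℝ (bdryPoint Ω a) (bdryPoint Ω b)) :
    normalForm x φ = supportAt (supportFn Ω) a φ := by
  obtain ⟨u, v, hu, hv, huv, rfl⟩ := hx
  have : normalForm (u • bdryPoint Ω a + v • bdryPoint Ω b) φ =
      u * normalForm (bdryPoint Ω a) φ + v * normalForm (bdryPoint Ω b) φ := by
    simp [normalForm]
    ring
  rw [this, normalForm_bdryPoint, normalForm_bdryPoint, ← hc.eq, ← add_mul, huv, one_mul]

include hΩ hh hK hKΩ in
theorem IsLeftTangent.segmentTangent {a φ b : ℝ} (h1 : IsLeftTangent Ω K a φ)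
    (hc : IsChord (supportFn Ω) a φ b) : SegmentTangent K (bdryPoint Ω a) (bdryPoint Ω b) := by
  have hnot : ∀ x ∈ interior K, normalForm x φ ≠ supportAt (supportFn Ω) a φ := by
    intro x hx e
    obtain ⟨k', hk', hlt⟩ := exists_normalForm_gt hx φ
    linarith [h1.le k' hk']
  constructor
  · obtain ⟨k, hk, e⟩ := h1.touch
    refine ⟨k, mem_segment_of_normalForm_eq hΩ hh hKΩ hc hk e, ?_⟩
    rw [hK.isClosed.frontier_eq]
    exact ⟨hk, fun hi => hnot k hi e⟩
  · rw [Set.disjoint_left]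
    intro x hx hi
    exact hnot x hi (normalForm_of_mem_segment hc hx)

include hΩ hh hK hKΩ in
-- The interior of `K` is connected and misses the line of the chord, so it lies on one side, and so
-- does its closure `K`.
theorem SegmentTangent.left_or_right (hconv : Convex ℝ K) (hint : (interior K).Nonempty)
    {a φ b : ℝ} (hc : IsChord (supportFn Ω) a φ b)
    (ht : SegmentTangent K (bdryPoint Ω a) (bdryPoint Ω b)) :
    IsLeftTangent Ω K a φ ∨ (∀ k ∈ K, supportAt (supportFn Ω) a φ ≤ normalForm k φ) ∧
      ∃ k ∈ K, normalForm k φ = supportAt (supportFn Ω) a φ := by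
  obtain ⟨⟨q, hq, hqf⟩, hdisj⟩ := ht
  have htouch : ∃ k ∈ K, normalForm k φ = supportAt (supportFn Ω) a φ :=
    ⟨q, hK.isClosed.frontier_subset hqf, normalForm_of_mem_segment hc hq⟩
  have hne : ∀ x ∈ interior K, normalForm x φ ≠ supportAt (supportFn Ω) a φ := fun x hx e =>
    Set.disjoint_left.1 hdisj (mem_segment_of_normalForm_eq hΩ hh hKΩ hc (interior_subset hx) e) hx
  have hcl : closure (interior K) = K := by
    rw [hconv.closure_interior_eq_closure_of_nonempty_interior hint, hK.isClosed.closure_eq]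
  have hcont := continuous_normalForm φ
  by_cases hside : ∃ x ∈ interior K, normalForm x φ < supportAt (supportFn Ω) a φ
  · left
    refine ⟨hc.left, fun k hk => ?_, htouch⟩
    obtain ⟨x, hx, hlt⟩ := hside
    have hall : interior K ⊆ {v | normalForm v φ ≤ supportAt (supportFn Ω) a φ} := by
      intro y hy
      by_contra hgt
      simp only [mem_ofPred_eq, not_le] at hgt
      obtain ⟨w, hw, e⟩ := hconv.interior.isPreconnected.intermediate_value hx hy
        hcont.continuousOn ⟨hlt.le, hgt.le⟩
      exact hne w hw e
    rw [← hcl] at hk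
    exact closure_minimal hall (isClosed_le hcont continuous_const) hk
  · right
    push Not at hside
    refine ⟨fun k hk => ?_, htouch⟩
    rw [← hcl] at hk
    exact closure_minimal (t := {v | supportAt (supportFn Ω) a φ ≤ normalForm v φ}) hside
      (isClosed_le continuous_const hcont) hk

include hΩ hKΩ in
/-- At a reflection, a left tangent becomes a right tangent only for a perpendicular bounce. -/
theorem IsLeftTangent.eq_of_right {a φ b θ : ℝ} (h1 : IsLeftTangent Ω K a φ)
    (hc : IsChord (supportFn Ω) a φ b) (hθ : θ = b - φ)
    (h2 : ∀ k ∈ K, supportAt (supportFn Ω) b (b + θ) ≤ normalForm k (b + θ))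
    (h3 : ∃ k ∈ K, normalForm k (b + θ) = supportAt (supportFn Ω) b (b + θ)) : θ = π / 2 := by
  have r1 := hc.right
  have hs : 0 < sin (b - φ) := sin_pos_of_pos_of_lt_pi (by linarith [r1.2]) (by linarith [r1.1])
  obtain ⟨k, hk, e⟩ := h1.touch
  obtain ⟨k', hk', e'⟩ := h3
  have e0 : normalForm (k - bdryPoint Ω b) φ = 0 := by
    rw [normalForm_sub, normalForm_bdryPoint, e, hc.eq, sub_self]
  have e0' : normalForm (k' - bdryPoint Ω b) (b + θ) = 0 := by
    rw [normalForm_sub, normalForm_bdryPoint, e', sub_self]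
  obtain ⟨s, hs1⟩ := exists_smul_unitTangent e0
  obtain ⟨s', hs1'⟩ := exists_smul_unitTangent e0'
  have n1 := normalForm_sub_bdryPoint_neg hΩ hKΩ hk b
  have n1' := normalForm_sub_bdryPoint_neg hΩ hKΩ hk' b
  have m1 := h2 k hk
  have m1' := h1.le k' hk'
  rw [hc.eq] at m1'
  rw [← sub_nonneg, ← normalForm_bdryPoint, ← normalForm_sub, hs1,
    normalForm_smul_unitTangent] at m1
  rw [← sub_nonpos, ← normalForm_bdryPoint, ← normalForm_sub, hs1',
    normalForm_smul_unitTangent] at m1'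
  rw [hs1, normalForm_smul_unitTangent] at n1
  rw [hs1', normalForm_smul_unitTangent] at n1'
  have a1 : b + θ - φ = 2 * θ := by linarith
  have a2 : φ - (b + θ) = -(2 * θ) := by linarith
  have a3 : b - (b + θ) = -(b - φ) := by linarith
  rw [a1] at m1
  rw [a2, sin_neg] at m1'
  rw [a3, sin_neg] at n1'
  -- The touching point of the incoming line comes before the bounce and that of the outgoing line
  -- after it. Their positions force opposite weak signs on sin 2θ.
  have s1 : s < 0 := by
    by_contra h
    push Not at h
    nlinarith [mul_nonneg h hs.le]
  have s2 : 0 < s' := by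
    by_contra h
    push Not at h
    nlinarith [mul_nonneg (neg_nonneg.2 h) hs.le]
  have z1 : sin (2 * θ) ≤ 0 := by
    by_contra h
    push Not at h
    nlinarith [mul_pos_of_neg_of_neg s1 (neg_neg_of_pos h)]
  have z2 : 0 ≤ sin (2 * θ) := by
    by_contra h
    push Not at h
    nlinarith [mul_pos s2 (neg_pos.2 h)]
  rcases lt_trichotomy θ (π / 2) with h | h | h
  · exact absurd (sin_pos_of_pos_of_lt_pi (x := 2 * θ) (by linarith [r1.2]) (by linarith)) z1.not_gt
  · exact h
  · have : sin (2 * θ - 2 * π) < 0 :=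
      sin_neg_of_neg_of_neg_pi_lt (by linarith [r1.1]) (by linarith)
    rw [sin_sub_two_pi] at this
    exact absurd this z2.not_gt

include hΩ hKΩ in
-- The touching point of the incoming line must stay left of the outgoing one, which forces sin 2θ ≥
-- 0. At a right angle both lines coincide with opposite orientations and would squeeze `K` into a
-- line.
theorem IsLeftTangent.lt_of_left (hint : (interior K).Nonempty) {a φ b θ : ℝ}
    (h1 : IsLeftTangent Ω K a φ) (hc : IsChord (supportFn Ω) a φ b) (hθ : θ = b - φ)
    (h2 : IsLeftTangent Ω K b (b + θ)) : θ < π / 2 := by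
  have r1 := hc.right
  have hs : 0 < sin (b - φ) := sin_pos_of_pos_of_lt_pi (by linarith [r1.2]) (by linarith [r1.1])
  obtain ⟨k, hk, e⟩ := h1.touch
  have e0 : normalForm (k - bdryPoint Ω b) φ = 0 := by
    rw [normalForm_sub, normalForm_bdryPoint, e, hc.eq, sub_self]
  obtain ⟨s, hs1⟩ := exists_smul_unitTangent e0
  have n1 := normalForm_sub_bdryPoint_neg hΩ hKΩ hk b
  have m1 := h2.le k hk
  rw [← sub_nonpos, ← normalForm_bdryPoint, ← normalForm_sub, hs1,
    normalForm_smul_unitTangent, show b + θ - φ = 2 * θ by linarith] at m1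
  rw [hs1, normalForm_smul_unitTangent] at n1
  have s1 : s < 0 := by
    by_contra h
    push Not at h
    nlinarith [mul_nonneg h hs.le]
  have z1 : 0 ≤ sin (2 * θ) := by
    by_contra h
    push Not at h
    nlinarith [mul_pos_of_neg_of_neg s1 h]
  rcases lt_trichotomy θ (π / 2) with h | h | h
  · exact h
  · exfalso
    obtain ⟨x, hx⟩ := hint
    obtain ⟨k1, hk1, l1⟩ := exists_normalForm_gt hx φ
    obtain ⟨k2, hk2, l2⟩ := exists_normalForm_gt hx (b + θ)
    have m1 := h1.le k1 hk1
    have m2 := h2.le k2 hk2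
    rw [hc.eq] at m1
    rw [show b + θ = φ + π by linarith] at l2 m2
    rw [normalForm_add_pi] at l2
    rw [supportAt_add_pi] at m2
    linarith
  · have : sin (2 * θ - 2 * π) < 0 :=
      sin_neg_of_neg_of_neg_pi_lt (by linarith [r1.1]) (by linarith)
    rw [sin_sub_two_pi] at this
    exact absurd this z1.not_gt

include hh in
theorem IsChord.perpendicular {a φ b e : ℝ} (hc : IsChord (supportFn Ω) a φ b)
    (hc' : IsChord (supportFn Ω) b (φ + π) e) : e = a + 2 * π := by
  refine hh.right_unique hc' ⟨⟨by linarith [hc.right.1], by linarith [hc.right.2]⟩,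
    ⟨by linarith [hc.left.1], by linarith [hc.left.2]⟩, ?_⟩
  rw [hh.supportAt_add_two_pi, supportAt_add_pi, supportAt_add_pi, hc.eq]

include hh in
theorem IsOrbit.angle_mem {z : ℤ → ℝ × ℝ} (hz : IsOrbit Ω z) (k : ℤ) : (z k).2 ∈ Ioo 0 π := by
  have := ((billiardStep_iff hh).1 (hz k)).1.left
  exact ⟨by linarith [this.1], by linarith [this.2]⟩

include hh in
theorem IsOrbit.sum_angle {z : ℤ → ℝ × ℝ} (hz : IsOrbit Ω z) {p : ℕ}
    (hp : IsPeriodicOrbit p 4 z) (k : ℤ) :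
    (z k).2 + (z (k + 1)).2 + (z (k + 2)).2 + (z (k + 3)).2 = π * p := by
  have h0 := ((billiardStep_iff hh).1 (hz k)).2
  have h1 := ((billiardStep_iff hh).1 (hz (k + 1))).2
  have h2 := ((billiardStep_iff hh).1 (hz (k + 2))).2
  have h3 := ((billiardStep_iff hh).1 (hz (k + 3))).2
  rw [show k + 1 + 1 = k + 2 by ring] at h1
  rw [show k + 2 + 1 = k + 3 by ring] at h2
  rw [show k + 3 + 1 = k + 4 by ring] at h3
  have h4 := hp k
  have e1 := congrArg Prod.fst h4
  have e2 := congrArg Prod.snd h4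
  simp at e1 e2
  linarith

include hΩ hh in
theorem IsRationalCaustic.left_step (hc : IsRationalCaustic 4 Ω K) {z : ℤ → ℝ × ℝ}
    (hz : IsOrbit Ω z) (ht : ∀ k, OrbitTangentAt Ω K z k) (k : ℤ)
    (hl : IsLeftTangent Ω K (z k).1 ((z k).1 + (z k).2)) :
    IsLeftTangent Ω K (z (k + 1)).1 ((z (k + 1)).1 + (z (k + 1)).2) ∧ (z (k + 1)).2 < π / 2 := by
  have hca := hc.1
  obtain ⟨c0, a0⟩ := (billiardStep_iff hh).1 (hz k)
  obtain ⟨c1, a1⟩ := (billiardStep_iff hh).1 (hz (k + 1))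
  rcases (ht (k + 1)).left_or_right hΩ hh hca.isCompact hca.subset_interior hca.convex
    hca.interior_nonempty c1 with h | ⟨h, h'⟩
  · exact ⟨h, hl.lt_of_left hΩ hca.subset_interior hca.interior_nonempty c0 a0 h⟩
  · exfalso
    -- After a perpendicular bounce the orbit retraces its chord, so three successive angles are θ,
    -- π/2 and π - θ. The angle sum of a period, π or 3π, would then put the fourth angle outside
    -- (0, π).
    have e := hl.eq_of_right hΩ hca.subset_interior c0 a0 h h'
    have e1 : (z (k + 1)).1 + (z (k + 1)).2 = (z k).1 + (z k).2 + π := by linarith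
    rw [e1] at c1 a1
    have e2 := c0.perpendicular hh c1
    rw [show k + 1 + 1 = k + 2 by ring] at a1 e2
    have m := hz.angle_mem hh (k + 3)
    rcases hc.2 z hz ht with hp | hp <;>
    · have hs := hz.sum_angle hh hp k
      push_cast at hs
      nlinarith [m.1, m.2, pi_pos]

include hΩ hh in
theorem IsRationalCaustic.exists_invariantCurve (hc : IsRationalCaustic 4 Ω K) :
    ∃ d f, IsInvariantCurve (supportFn Ω) d f := by
  have hca := hc.1
  have hKΩ := hca.subset_interior
  choose φ hφ using exists_leftTangent hΩ hca.isCompact hKΩ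
    (hca.interior_nonempty.mono interior_subset)
  choose f hf using fun a => hh.exists_right (hφ a).mem
  have horb : ∀ a, ∃ z, IsOrbit Ω z ∧ z 0 = (a, φ a - a) ∧ IsPeriodicOrbit 1 4 z ∧
      ∀ k : ℕ, IsLeftTangent Ω K (z k).1 ((z k).1 + (z k).2) := by
    intro a
    obtain ⟨z, hz, hz0⟩ := exists_orbit hh (hφ a).mem
    have hl0 : IsLeftTangent Ω K (z 0).1 ((z 0).1 + (z 0).2) := by
      rw [hz0]
      simpa using hφ a
    have ht : ∀ k, OrbitTangentAt Ω K z k :=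
      hca.tangent z hz 0 (hl0.segmentTangent hΩ hh hca.isCompact hKΩ
        ((billiardStep_iff hh).1 (hz 0)).1)
    have hl : ∀ k : ℕ, IsLeftTangent Ω K (z k).1 ((z k).1 + (z k).2) := by
      intro k
      induction k with
      | zero => exact hl0
      | succ k ih => exact_mod_cast (hc.left_step hΩ hh hz ht k ih).1
    refine ⟨z, hz, hz0, ?_, hl⟩
    rcases hc.2 z hz ht with hp | hp
    · exact hp
    -- Period type (3, 4) needs angle sum 3π, but four angles below π/2 sum to less than 2π.
    · exfalso
      have h1 := (hc.left_step hΩ hh hz ht 0 (hl 0)).2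
      have h2 := (hc.left_step hΩ hh hz ht 1 (hl 1)).2
      have h3 := (hc.left_step hΩ hh hz ht 2 (hl 2)).2
      have h4 := (hc.left_step hΩ hh hz ht 3 (hl 3)).2
      have hs := hz.sum_angle hh hp 1
      norm_num at hs h1 h2 h3 h4
      linarith [pi_pos]
  have hstep : ∀ (z : ℤ → ℝ × ℝ), IsOrbit Ω z →
      (∀ k : ℕ, IsLeftTangent Ω K (z k).1 ((z k).1 + (z k).2)) → ∀ k : ℕ,
      (z k).2 = φ (z k).1 - (z k).1 ∧ (z (k + 1)).1 = f (z k).1 := by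
    intro z hz hl k
    have e : (z k).1 + (z k).2 = φ (z k).1 := (hl k).unique hΩ hKΩ (hφ _)
    refine ⟨by linarith, ?_⟩
    have hc := ((billiardStep_iff hh).1 (hz k)).1
    rw [e] at hc
    exact hh.right_unique hc (hf _)
  refine ⟨fun a => φ a - a, f, fun a => ⟨by linarith [(hφ a).mem.1], by linarith [(hφ a).mem.2]⟩,
    fun a => by simpa using hf a, fun a => ?_, fun a => ?_,
    fun a b hab => (hφ a).right_lt hΩ hh hKΩ (hφ b) (hf a) (hf b) hab,
    fun a b hab => by simpa using (hφ a).normal_lt hΩ hh hKΩ (hφ b) hab, fun a => ?_⟩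
  · obtain ⟨z, hz, hz0, -, hl⟩ := horb a
    have h0 := hstep z hz hl 0
    have h1 := hstep z hz hl 1
    have h2 := ((billiardStep_iff hh).1 (hz 0)).2
    norm_num at h0 h1 h2
    rw [hz0] at h0 h2
    rw [h1.1, h0.2] at h2
    simp only at h2 ⊢
    linarith
  · obtain ⟨z, hz, hz0, hp, hl⟩ := horb a
    have h0 := (hstep z hz hl 0).2
    have h1 := (hstep z hz hl 1).2
    have h2 := (hstep z hz hl 2).2
    have h3 := (hstep z hz hl 3).2
    have h4 := congrArg Prod.fst (hp 0)
    norm_num at h0 h1 h2 h3 h4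
    rw [h3, h2, h1, h0, hz0] at h4
    exact h4
  · have : IsLeftTangent Ω K (a + 2 * π) (φ a + 2 * π) := by
      have e1 : ∀ v, normalForm v (φ a + 2 * π) = normalForm v (φ a) := fun v => by
        simp [normalForm]
      have e2 : supportAt (supportFn Ω) (a + 2 * π) (φ a + 2 * π) =
          supportAt (supportFn Ω) a (φ a) := by
        rw [← normalForm_bdryPoint, e1, normalForm_bdryPoint, hh.supportAt_add_two_pi]
      refine ⟨⟨by linarith [(hφ a).mem.1], by linarith [(hφ a).mem.2]⟩, fun k hk => ?_, ?_⟩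
      · rw [e1, e2]
        exact (hφ a).le k hk
      · obtain ⟨k, hk, e⟩ := (hφ a).touch
        exact ⟨k, hk, by rw [e1, e2, e]⟩
    have := (hφ (a + 2 * π)).unique hΩ hKΩ this
    linarith

end Caustic

/-! ### Orbits relative to the invariant curve; loops. -/

theorem IsOrbit.ext {Ω : Set Plane} (hh : IsSmoothSupport (supportFn Ω)) {z w : ℤ → ℝ × ℝ}
    (hz : IsOrbit Ω z) (hw : IsOrbit Ω w) (h0 : z 0 = w 0) : z = w := by
  funext k
  induction k using Int.induction_on with
  | zero => exact h0
  | succ k ih =>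
    have h1 := hz k
    rw [ih] at h1
    exact h1.unique hh (hw k)
  | pred k ih =>
    have h1 := hz (-k - 1)
    have h2 := hw (-k - 1)
    rw [show (-k - 1 + 1 : ℤ) = -k by ring] at h1 h2
    rw [ih] at h1
    exact h1.unique_left hh h2

namespace IsInvariantCurve

variable {h d f : ℝ → ℝ} (hc : IsInvariantCurve h d f)
include hc

theorem iterate_add_four (k : ℕ) (x : ℝ) : f^[k + 4] x = f^[k] x + 2 * π := by
  rw [show k + 4 = 4 + k by ring, Function.iterate_add_apply]
  exact hc.iterate_four _

theorem bijective : Function.Bijective f :=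
  ⟨hc.strictMono.injective, fun y => ⟨f (f (f (y - 2 * π))), by rw [hc.iterate_four]; ring⟩⟩

theorem exists_preimage (y : ℝ) : ∃ x, f x = y ∧ IsChord h x (y - d y) y := by
  obtain ⟨x, rfl⟩ := hc.bijective.2 y
  refine ⟨x, rfl, ?_⟩
  have := hc.chord x
  rwa [show x + d x = f x - d (f x) by linarith [hc.next x]] at this

end IsInvariantCurve

section

variable {Ω : Set Plane} {d f : ℝ → ℝ} (hh : IsSmoothSupport (supportFn Ω))
  (hc : IsInvariantCurve (supportFn Ω) d f)
include hh hc

/-- By twist the chord ends ahead of the invariant one. The invariant chord ending at the same point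
therefore starts later and is turned further, so the present chord arrives at a larger angle. -/
theorem BilliardStep.above {p q : ℝ × ℝ} (hs : BilliardStep Ω p q) (hp : d p.1 < p.2) :
    f p.1 < q.1 ∧ d q.1 < q.2 := by
  obtain ⟨h1, h2⟩ := (billiardStep_iff hh).1 hs
  have h3 : f p.1 < q.1 := hh.right_lt_right (hc.chord p.1) h1 (by linarith)
  refine ⟨h3, ?_⟩
  obtain ⟨x, hx, hx'⟩ := hc.exists_preimage q.1
  rw [← hx] at h3
  have := hh.chord_lt_of_left_lt h1 hx' (hc.strictMono.lt_iff_lt.1 h3)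
  linarith

theorem BilliardStep.below {p q : ℝ × ℝ} (hs : BilliardStep Ω p q) (hp : p.2 < d p.1) :
    q.1 < f p.1 ∧ q.2 < d q.1 := by
  obtain ⟨h1, h2⟩ := (billiardStep_iff hh).1 hs
  have h3 : q.1 < f p.1 := hh.right_lt_right h1 (hc.chord p.1) (by linarith)
  refine ⟨h3, ?_⟩
  obtain ⟨x, hx, hx'⟩ := hc.exists_preimage q.1
  rw [← hx] at h3
  have := hh.chord_lt_of_left_lt hx' h1 (hc.strictMono.lt_iff_lt.1 h3)
  linarith

theorem IsInvariantCurve.billiardStep (x : ℝ) : BilliardStep Ω (x, d x) (f x, d (f x)) :=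
  (billiardStep_iff hh).2 ⟨hc.chord x, by linarith [hc.next x]⟩

/-- Off the graph, four steps strictly overtake or fall behind `f^[4]`, so they cannot end at ψ +
2π. -/
theorem IsInvariantCurve.isLoopAngle : IsLoopAngle Ω 4 d := by
  refine fun ψ => ⟨hc.angle_mem ψ, fun θ => ⟨?_, ?_⟩⟩
  · rintro ⟨z, h0, hz, h4⟩
    have e4 : f^[4] ψ = ψ + 2 * π := hc.iterate_four ψ
    rcases lt_trichotomy θ (d ψ) with hlt | heq | hlt
    · have key : ∀ k, k < 4 → (z (k + 1)).1 < f^[k + 1] ψ ∧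
          (z (k + 1)).2 < d (z (k + 1)).1 := by
        intro k hk
        induction k with
        | zero =>
          have := (hz 0 hk).below hh hc (by simpa [h0] using hlt)
          simpa [h0] using this
        | succ k ih =>
          obtain ⟨i1, i2⟩ := ih (by omega)
          obtain ⟨j1, j2⟩ := (hz (k + 1) hk).below hh hc i2
          refine ⟨j1.trans ?_, j2⟩
          rw [Function.iterate_succ_apply']
          exact hc.strictMono i1
      have := (key 3 (by norm_num)).1
      norm_num only at this
      linarith
    · exact heq
    · have key : ∀ k, k < 4 → f^[k + 1] ψ < (z (k + 1)).1 ∧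
          d (z (k + 1)).1 < (z (k + 1)).2 := by
        intro k hk
        induction k with
        | zero =>
          have := (hz 0 hk).above hh hc (by simpa [h0] using hlt)
          simpa [h0] using this
        | succ k ih =>
          obtain ⟨i1, i2⟩ := ih (by omega)
          obtain ⟨j1, j2⟩ := (hz (k + 1) hk).above hh hc i2
          refine ⟨lt_trans ?_ j1, j2⟩
          rw [Function.iterate_succ_apply']
          exact hc.strictMono i1
      have := (key 3 (by norm_num)).1
      norm_num only at this
      linarith
  · rintro rfl
    refine ⟨fun k => (f^[k] ψ, d (f^[k] ψ)), rfl, fun k _ => ?_, hc.iterate_four ψ⟩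
    simp only [Function.iterate_succ_apply']
    exact hc.billiardStep hh _

theorem IsInvariantCurve.exists_orbits : ∃ z : ℝ → ℤ → ℝ × ℝ,
    (∀ ψ, IsOrbit Ω (z ψ) ∧ IsPeriodicOrbit 1 4 (z ψ) ∧ z ψ 0 = (ψ, d ψ)) ∧
    (∀ w, IsOrbit Ω w → IsPeriodicOrbit 1 4 w → w = z (w 0).1) ∧
    ∀ ψ, ∀ k : ℕ, (z ψ k).1 = f^[k] ψ := by
  let E : Equiv.Perm ℝ := Equiv.ofBijective f hc.bijective
  have hE : ∀ k : ℤ, ∀ ψ, (E ^ (k + 1)) ψ = f ((E ^ k) ψ) := fun k ψ => by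
    rw [add_comm, zpow_one_add]
    rfl
  have horb : ∀ ψ, IsOrbit Ω fun k => ((E ^ k) ψ, d ((E ^ k) ψ)) := fun ψ k => by
    simp only [hE]
    exact hc.billiardStep hh _
  have hper : ∀ ψ, IsPeriodicOrbit 1 4 fun k => ((E ^ k) ψ, d ((E ^ k) ψ)) := fun ψ k => by
    have : (E ^ (k + (4 : ℕ))) ψ = (E ^ k) ψ + 2 * π := by
      rw [show k + ((4 : ℕ) : ℤ) = k + 1 + 1 + 1 + 1 by push_cast; ring, hE, hE, hE, hE,
        hc.iterate_four]
    simp only [this, hc.periodic ((E ^ k) ψ)]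
    simp
  refine ⟨fun ψ k => ((E ^ k) ψ, d ((E ^ k) ψ)), fun ψ => ⟨horb ψ, hper ψ, by simp⟩, ?_, ?_⟩
  · intro w hw hp
    refine hw.ext hh (horb _) ?_
    have hloop : IsLoop Ω 4 (w 0).1 (w 0).2 := by
      refine ⟨fun k => w k, rfl, fun k _ => hw k, ?_⟩
      have := congrArg Prod.fst (hp 0)
      simpa using this
    ext
    · simp
    · simpa using (((hc.isLoopAngle hh) (w 0).1).2 _).1 hloop
  · intro ψ k
    induction k with
    | zero => simp
    | succ k ih =>
      push_cast
      simp only [hE, Function.iterate_succ_apply'] at ih ⊢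
      rw [ih]

end

/-! ### Billiard data: vertices, chords and reflection angles. -/

/-- A support function `h` with an invariant curve of 4-periodic orbits, almost invariant under
the rotation by `π`. -/
structure BilliardDatum (r B : ℝ) where
  h : ℝ → ℝ
  d : ℝ → ℝ
  f : ℝ → ℝ
  ε : ℝ
  R : ℝ
  bound : CBound 12 B h
  smooth : IsSmoothSupport h
  curv : ∀ x, r ≤ h x + deriv (deriv h) x
  curve : IsInvariantCurve h d f
  ε_nonneg : 0 ≤ ε
  near : CBound 5 (2 * ε) fun x => h (x + π) - h x
  R_nonneg : 0 ≤ R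
  R_sq : |h 0 ^ 2 + h (π / 2) ^ 2 - R ^ 2| ≤ 6 * B * ε

namespace BilliardDatum

variable {r B : ℝ}

/-- The filter of data whose defect of symmetry tends to zero. -/
def small (r B : ℝ) : Filter (BilliardDatum r B) := comap ε (𝓝 0)

/-- The `k`-th vertex of the orbit that starts at `ψ`. -/
def X (k : ℕ) (D : BilliardDatum r B) (ψ : ℝ) : ℝ := D.f^[k] ψ

/-- The angle of reflection at the `k`-th vertex. -/
def δ (k : ℕ) (D : BilliardDatum r B) (ψ : ℝ) : ℝ := D.d (D.X k ψ)

/-- The normal angle of the chord from the `k`-th vertex to the next one. -/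
def Y (k : ℕ) (D : BilliardDatum r B) (ψ : ℝ) : ℝ := D.X k ψ + D.δ k ψ

variable (D : BilliardDatum r B) (k : ℕ) (ψ : ℝ)

@[simp] theorem X_zero : D.X 0 ψ = ψ := rfl

theorem X_succ' : D.X (k + 1) ψ = D.f (D.X k ψ) := Function.iterate_succ_apply' _ _ _

theorem X_succ : D.X (k + 1) ψ = D.Y k ψ + D.δ (k + 1) ψ := by
  rw [Y, δ, δ, X_succ']
  exact D.curve.next _

theorem X_add_four : D.X (k + 4) ψ = D.X k ψ + 2 * π := D.curve.iterate_add_four k ψ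

theorem δ_add_four : D.δ (k + 4) ψ = D.δ k ψ := by
  rw [δ, X_add_four, D.curve.periodic, δ]

theorem Y_add_four : D.Y (k + 4) ψ = D.Y k ψ + 2 * π := by
  rw [Y, X_add_four, δ_add_four, Y]
  ring

theorem X_succ_eq : D.X (k + 1) ψ = (D.Y k ψ + D.Y (k + 1) ψ) / 2 := by
  have := D.X_succ k ψ
  have : D.Y (k + 1) ψ = D.X (k + 1) ψ + D.δ (k + 1) ψ := rfl
  linarith

theorem δ_succ_eq : D.δ (k + 1) ψ = (D.Y (k + 1) ψ - D.Y k ψ) / 2 := by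
  have := D.X_succ k ψ
  have : D.Y (k + 1) ψ = D.X (k + 1) ψ + D.δ (k + 1) ψ := rfl
  linarith

theorem Y_three_eq : D.Y 3 ψ = ψ - D.d ψ + 2 * π := by
  have h1 := D.X_succ 3 ψ
  rw [X_add_four D 0, δ_add_four D 0] at h1
  simp only [δ, X_zero] at h1
  linarith

theorem sum_δ : D.δ 0 ψ + D.δ 1 ψ + D.δ 2 ψ + D.δ 3 ψ = π := by
  have h0 := D.X_succ 0 ψ
  have h1 := D.X_succ 1 ψ
  have h2 := D.X_succ 2 ψ
  have h3 := D.X_succ 3 ψ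
  rw [X_add_four D 0, δ_add_four D 0] at h3
  simp only [Y] at h0 h1 h2 h3
  norm_num at h0 h1 h2 h3
  linarith

theorem δ_mem : D.δ k ψ ∈ Ioo 0 π := D.curve.angle_mem _

theorem δ_succ_le : D.δ k ψ + D.δ (k + 1) ψ ≤ π := by
  have h1 := D.sum_δ (D.X k ψ)
  have h2 := D.δ_mem 2 (D.X k ψ)
  have h3 := D.δ_mem 3 (D.X k ψ)
  have e0 : D.δ 0 (D.X k ψ) = D.δ k ψ := rfl
  have e1 : D.δ 1 (D.X k ψ) = D.δ (k + 1) ψ := by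
    rw [δ, δ, X_succ', X_succ']
    rfl
  rw [e0, e1] at h1
  linarith [h2.1, h3.1]

theorem chord : IsChord D.h (D.X k ψ) (D.Y k ψ) (D.X (k + 1) ψ) := by
  rw [X_succ']
  exact D.curve.chord _

/-- The chord equation in terms of the normals of three consecutive chords. -/
theorem chord_eq : supportAt D.h ((D.Y k ψ + D.Y (k + 1) ψ) / 2) (D.Y (k + 1) ψ) =
    supportAt D.h ((D.Y (k + 1) ψ + D.Y (k + 2) ψ) / 2) (D.Y (k + 1) ψ) := by
  rw [← X_succ_eq, ← X_succ_eq D (k + 1)]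
  exact (D.chord (k + 1) ψ).eq

theorem strictMono_X : StrictMono (D.X k) := D.curve.strictMono.iterate k

theorem strictMono_Y : StrictMono (D.Y k) := fun _ _ hab =>
  D.curve.strictMono_normal (D.strictMono_X k hab)

/-- The normal angles of the outgoing and the incoming chord, x + d(x) and x - d(x) up to 2π, both
increase with x. -/
theorem abs_d_sub_le (x y : ℝ) : |D.d x - D.d y| ≤ |x - y| := by
  wlog hxy : y ≤ x generalizing x y
  · rw [abs_sub_comm, abs_sub_comm x]
    exact this y x (le_of_not_ge hxy)
  have h0 := (D.strictMono_Y 0).monotone hxy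
  have h3 := (D.strictMono_Y 3).monotone hxy
  rw [Y_three_eq, Y_three_eq] at h3
  simp only [Y, δ, X_zero] at h0
  rw [abs_of_nonneg (sub_nonneg.2 hxy), abs_le]
  constructor <;> linarith

theorem continuous_d : Continuous D.d := by
  have : LipschitzWith 1 D.d := LipschitzWith.of_dist_le_mul fun x y => by
    rw [Real.dist_eq, Real.dist_eq, NNReal.coe_one, one_mul]
    exact D.abs_d_sub_le x y
  exact this.continuous

theorem continuous_X : Continuous (D.X k) :=
  (D.curve.strictMono.monotone.continuous_of_surjective D.curve.bijective.2).iterate k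

theorem continuous_δ : Continuous (D.δ k) := D.continuous_d.comp (D.continuous_X k)

theorem continuous_Y : Continuous (D.Y k) := (D.continuous_X k).add (D.continuous_δ k)

theorem X_mem : D.X k ψ ∈ Icc ψ (ψ + 2 * π * k) := by
  induction k with
  | zero => simp
  | succ k ih =>
    have h1 := D.X_succ k ψ
    have h2 := D.δ_mem k ψ
    have h3 := D.δ_mem (k + 1) ψ
    rw [Y] at h1
    push_cast
    constructor <;> linarith [h2.1, h2.2, h3.1, h3.2, ih.1, ih.2]

theorem abs_X_sub_le : |D.X k ψ - ψ| ≤ 2 * π * k := by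
  have := D.X_mem k ψ
  rw [abs_le]
  have : 0 ≤ 2 * π * k := by positivity
  constructor <;> linarith [(D.X_mem k ψ).1, (D.X_mem k ψ).2]

theorem abs_Y_sub_le : |D.Y k ψ - ψ| ≤ 2 * π * k + π := by
  have h1 := abs_le.1 (D.abs_X_sub_le k ψ)
  have h2 := D.δ_mem k ψ
  rw [Y, abs_le]
  constructor <;> linarith [h2.1, h2.2]

theorem surjective_Y : Function.Surjective (D.Y k) := by
  refine (D.continuous_Y k).surjective ?_ ?_
  · refine tendsto_atTop_mono (fun x => ?_) (tendsto_atTop_add_const_right atTop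
      (-(2 * π * k + π)) tendsto_id)
    have := (abs_le.1 (D.abs_Y_sub_le k x)).1
    simp only [id]
    linarith
  · refine tendsto_atBot_mono (fun x => ?_) (tendsto_atBot_add_const_right atBot
      (2 * π * k + π) tendsto_id)
    have := (abs_le.1 (D.abs_Y_sub_le k x)).2
    simp only [id]
    linarith

theorem abs_h_le (x : ℝ) : |D.h x| ≤ B := D.bound.abs_le x

theorem abs_deriv_h_le (x : ℝ) : |deriv D.h x| ≤ B := (CBound.succ_iff.1 D.bound).2.2.abs_le x

theorem abs_deriv_deriv_h_le (x : ℝ) : |deriv (deriv D.h) x| ≤ B :=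
  (CBound.succ_iff.1 (CBound.succ_iff.1 D.bound).2.2).2.2.abs_le x

theorem curv_le (x : ℝ) : D.h x + deriv (deriv D.h) x ≤ 2 * B := by
  linarith [(abs_le.1 (D.abs_h_le x)).2, (abs_le.1 (D.abs_deriv_deriv_h_le x)).2]

include D in
theorem B_nonneg : 0 ≤ B := (abs_nonneg _).trans (D.abs_h_le 0)

end BilliardDatum

/-! ### Bounds for the reflection angles. -/

theorem le_of_deriv_eq_mul_sin {G g : ℝ → ℝ} {φ : ℝ} (hG : ∀ x, HasDerivAt G (g x * sin (φ - x)) x)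
    (hg : ∀ x, 0 ≤ g x) {x : ℝ} (h1 : φ - π ≤ x) (h2 : x ≤ φ + π) : G x ≤ G φ := by
  have hc : Continuous G := continuous_iff_continuousAt.2 fun x => (hG x).continuousAt
  rcases le_total x φ with h3 | h3
  · refine monotoneOn_of_deriv_nonneg (convex_Icc (φ - π) φ) hc.continuousOn
      (fun y _ => (hG y).differentiableAt.differentiableWithinAt) (fun y hy => ?_) ⟨h1, h3⟩
      ⟨by linarith, le_rfl⟩ h3
    rw [interior_Icc] at hy
    rw [(hG y).deriv]
    exact mul_nonneg (hg y)
      (sin_nonneg_of_nonneg_of_le_pi (by linarith [hy.2]) (by linarith [hy.1]))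
  · refine antitoneOn_of_deriv_nonpos (convex_Icc φ (φ + π)) hc.continuousOn
      (fun y _ => (hG y).differentiableAt.differentiableWithinAt) (fun y hy => ?_)
      ⟨le_rfl, by linarith⟩ ⟨h3, h2⟩ h3
    rw [interior_Icc] at hy
    rw [(hG y).deriv]
    exact mul_nonpos_of_nonneg_of_nonpos (hg y)
      (sin_nonpos_of_nonpos_of_neg_pi_le (by linarith [hy.1]) (by linarith [hy.2]))

namespace BilliardDatum

variable {r B : ℝ} (D : BilliardDatum r B)

theorem hasDerivAt_cos_sub (φ x : ℝ) : HasDerivAt (fun x => cos (φ - x)) (sin (φ - x)) x := by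
  have h1 : HasDerivAt (fun x => φ - x) (-1) x := by simpa using (hasDerivAt_id x).const_sub φ
  simpa using h1.cos

/-- Comparison with a circle of radius `r`; the next lemma compares with radius `2 * B`. For a chord
with normal angle `φ` this is the height of the arc above it, measured from either end, so
consecutive reflection angles control each other. -/
theorem le_support_sub {φ x : ℝ} (h1 : φ - π ≤ x) (h2 : x ≤ φ + π) :
    r * (1 - cos (φ - x)) ≤ D.h φ - supportAt D.h x φ := by
  have := le_of_deriv_eq_mul_sin (G := fun x => supportAt D.h x φ - r * cos (φ - x))
    (g := fun x => D.h x + deriv (deriv D.h) x - r) (φ := φ) (fun x => ?_)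
    (fun x => sub_nonneg.2 (D.curv x)) h1 h2
  · simp only [supportAt_self, sub_self, cos_zero] at this
    linarith
  · refine ((D.smooth.hasDerivAt_supportAt φ x).sub
      ((hasDerivAt_cos_sub φ x).const_mul r)).congr_deriv ?_
    ring

theorem support_sub_le {φ x : ℝ} (h1 : φ - π ≤ x) (h2 : x ≤ φ + π) :
    D.h φ - supportAt D.h x φ ≤ 2 * B * (1 - cos (φ - x)) := by
  have := le_of_deriv_eq_mul_sin (G := fun x => 2 * B * cos (φ - x) - supportAt D.h x φ)
    (g := fun x => 2 * B - (D.h x + deriv (deriv D.h) x)) (φ := φ) (fun x => ?_)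
    (fun x => sub_nonneg.2 (D.curv_le x)) h1 h2
  · simp only [supportAt_self, sub_self, cos_zero] at this
    linarith
  · refine (((hasDerivAt_cos_sub φ x).const_mul (2 * B)).sub
      (D.smooth.hasDerivAt_supportAt φ x)).congr_deriv ?_
    ring

theorem one_sub_cos_succ_le (k : ℕ) (ψ : ℝ) :
    r * (1 - cos (D.δ (k + 1) ψ)) ≤ 2 * B * (1 - cos (D.δ k ψ)) := by
  have hc := D.chord k ψ
  have h1 := D.support_sub_le (φ := D.Y k ψ) (x := D.X k ψ) (by linarith [hc.left.2])
    (by linarith [hc.left.1, pi_pos])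
  have h2 := D.le_support_sub (φ := D.Y k ψ) (x := D.X (k + 1) ψ)
    (by linarith [hc.right.2, pi_pos]) (by linarith [hc.right.1])
  have e1 : D.Y k ψ - D.X k ψ = D.δ k ψ := by
    rw [Y]
    ring
  have e2 : D.Y k ψ - D.X (k + 1) ψ = -D.δ (k + 1) ψ := by linarith [D.X_succ k ψ]
  rw [e1] at h1
  rw [e2, cos_neg] at h2
  linarith [hc.eq]

/-- The angles of reflection stay away from `0` and `π`. -/
theorem exists_angle_bound (hr : 0 < r) : ∃ c, 0 < c ∧ ∀ D : BilliardDatum r B, ∀ k ψ,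
    c ≤ D.δ k ψ ∧ D.δ k ψ ≤ π - c ∧ c ≤ sin (D.δ k ψ) := by
  rcases le_or_gt B 0 with hB | hB
  · refine ⟨1, one_pos, fun D => ?_⟩
    linarith [D.curv 0, D.curv_le 0]
  -- One bounce multiplies 1 - cos δ by at most `K`. The four angles sum to π, so one of them is at
  -- least π/4 and has 1 - cos δ ≥ `c₀`; it is at most three bounces away.
  set K := max 1 (2 * B / r) with hK
  have hK1 : 1 ≤ K := le_max_left _ _
  have hcos : cos (π / 4) < 1 := by
    rw [← cos_zero]
    exact cos_lt_cos_of_nonneg_of_le_pi le_rfl (by linarith [pi_pos]) (by linarith [pi_pos])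
  set c₀ := 1 - cos (π / 4) with hc₀
  have hc₀' : 0 < c₀ := by linarith
  have hstep : ∀ (D : BilliardDatum r B) k ψ,
      1 - cos (D.δ (k + 1) ψ) ≤ K * (1 - cos (D.δ k ψ)) := by
    intro D k ψ
    have h1 := D.one_sub_cos_succ_le k ψ
    have h2 : 0 ≤ 1 - cos (D.δ k ψ) := by linarith [cos_le_one (D.δ k ψ)]
    calc 1 - cos (D.δ (k + 1) ψ) ≤ 2 * B / r * (1 - cos (D.δ k ψ)) := by
          rw [div_mul_eq_mul_div, le_div_iff₀ hr]
          linarith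
      _ ≤ K * (1 - cos (D.δ k ψ)) := mul_le_mul_of_nonneg_right (le_max_right _ _) h2
  have hlow : ∀ (D : BilliardDatum r B) x, c₀ / K ^ 3 ≤ 1 - cos (D.d x) := by
    intro D x
    have hsum := D.sum_δ x
    have h0 := hstep D 0 x
    have h1 := hstep D 1 x
    have h2 := hstep D 2 x
    have hbig : ∀ k, π / 4 ≤ D.δ k x → c₀ ≤ 1 - cos (D.δ k x) := by
      intro k hk
      have := cos_le_cos_of_nonneg_of_le_pi (by linarith [pi_pos]) (D.δ_mem k x).2.le hk
      linarith
    have hnn : ∀ k, 0 ≤ 1 - cos (D.δ k x) := fun k => by linarith [cos_le_one (D.δ k x)]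
    rw [div_le_iff₀ (by positivity)]
    change c₀ ≤ (1 - cos (D.δ 0 x)) * K ^ 3
    norm_num only at h0 h1 h2
    have K0 : 0 ≤ K := by linarith
    have i1 : 1 - cos (D.δ 1 x) ≤ K ^ 3 * (1 - cos (D.δ 0 x)) := h0.trans
      (mul_le_mul_of_nonneg_right (le_self_pow₀ hK1 (by norm_num)) (hnn 0))
    have i2' : 1 - cos (D.δ 2 x) ≤ K ^ 2 * (1 - cos (D.δ 0 x)) := by
      have := mul_le_mul_of_nonneg_left h0 K0
      calc _ ≤ _ := h1
        _ ≤ _ := this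
        _ = _ := by ring
    have i2 : 1 - cos (D.δ 2 x) ≤ K ^ 3 * (1 - cos (D.δ 0 x)) := i2'.trans
      (mul_le_mul_of_nonneg_right (pow_le_pow_right₀ hK1 (by norm_num)) (hnn 0))
    have i3 : 1 - cos (D.δ 3 x) ≤ K ^ 3 * (1 - cos (D.δ 0 x)) := by
      have := mul_le_mul_of_nonneg_left i2' K0
      calc _ ≤ _ := h2
        _ ≤ _ := this
        _ = _ := by ring
    have i0 : 1 - cos (D.δ 0 x) ≤ K ^ 3 * (1 - cos (D.δ 0 x)) :=
      le_mul_of_one_le_left (hnn 0) (one_le_pow₀ hK1)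
    by_contra hlt
    push Not at hlt
    have g : ∀ k, 1 - cos (D.δ k x) ≤ K ^ 3 * (1 - cos (D.δ 0 x)) → D.δ k x < π / 4 := by
      intro k hk
      by_contra hge
      push Not at hge
      linarith [hbig k hge]
    linarith [g 0 i0, g 1 i1, g 2 i2, g 3 i3]
  have hc : 0 < c₀ / K ^ 3 := by positivity
  have hδ : ∀ (D : BilliardDatum r B) k ψ, c₀ / K ^ 3 ≤ D.δ k ψ := by
    intro D k ψ
    have h1 := hlow D (D.X k ψ)
    change _ ≤ 1 - cos (D.δ k ψ) at h1
    -- From 1 - cos δ ≤ δ²/2, which is at most δ when δ ≤ 2.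
    have h2 := one_sub_sq_div_two_le_cos (x := D.δ k ψ)
    rcases le_or_gt (D.δ k ψ) 2 with h3 | h3
    · nlinarith [(D.δ_mem k ψ).1]
    · linarith [neg_one_le_cos (D.δ k ψ)]
  refine ⟨c₀ / K ^ 3, hc, fun D k ψ => ⟨hδ D k ψ, ?_, ?_⟩⟩
  · linarith [D.δ_succ_le k ψ, hδ D (k + 1) ψ]
  · have h1 := hlow D (D.X k ψ)
    have h2 := hlow D (D.X (k + 1) ψ)
    change _ ≤ 1 - cos (D.δ k ψ) at h1
    change _ ≤ 1 - cos (D.δ (k + 1) ψ) at h2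
    -- Consecutive angles sum to at most π, so 1 + cos δ_k ≥ 1 - cos δ_{k+1}. Then both factors of
    -- sin² δ_k = (1 - cos δ_k)(1 + cos δ_k) are bounded below.
    have h3 : cos (π - D.δ (k + 1) ψ) ≤ cos (D.δ k ψ) :=
      cos_le_cos_of_nonneg_of_le_pi (D.δ_mem k ψ).1.le (by linarith [(D.δ_mem (k + 1) ψ).1])
        (by linarith [D.δ_succ_le k ψ])
    rw [cos_pi_sub] at h3
    have h4 : 0 < sin (D.δ k ψ) := sin_pos_of_pos_of_lt_pi (D.δ_mem k ψ).1 (D.δ_mem k ψ).2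
    have h5 := sin_sq_add_cos_sq (D.δ k ψ)
    refine le_of_sq_le_sq ?_ h4.le
    nlinarith

end BilliardDatum

/-! ### The linearized orbit equations and differentiability. -/

/-- The support function of a line is half the derivative of the generating function
`2 h((u + v) / 2) sin((v - u) / 2)` of the billiard map, in the normal angles of two
consecutive chords. -/
noncomputable def chordForm (h : ℝ → ℝ) (u v : ℝ) : ℝ := supportAt h ((u + v) / 2) v

/-- The derivative of `chordForm` in the first variable. -/
noncomputable def chordForm₁ (h : ℝ → ℝ) (u v : ℝ) : ℝ :=
  (h ((u + v) / 2) + deriv (deriv h) ((u + v) / 2)) * sin ((v - u) / 2) / 2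

/-- The derivative of `chordForm` in the second variable. -/
noncomputable def chordForm₂ (h : ℝ → ℝ) (u v : ℝ) : ℝ :=
  (deriv (deriv h) ((u + v) / 2) - h ((u + v) / 2)) * sin ((v - u) / 2) / 2 +
    deriv h ((u + v) / 2) * cos ((v - u) / 2)

namespace IsSmoothSupport

variable {h : ℝ → ℝ} (hh : IsSmoothSupport h)
include hh

theorem hasDerivAt_chordForm₁ (u v : ℝ) :
    HasDerivAt (fun u => chordForm h u v) (chordForm₁ h u v) u := by
  have h1 : HasDerivAt (fun u => (u + v) / 2) (1 / 2) u :=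
    ((hasDerivAt_id u).add_const v).div_const 2
  refine (HasDerivAt.comp u (hh.hasDerivAt_supportAt v ((u + v) / 2)) h1).congr_deriv ?_
  rw [chordForm₁, show v - (u + v) / 2 = (v - u) / 2 by ring]
  ring

theorem hasDerivAt_chordForm₂ (u v : ℝ) :
    HasDerivAt (fun v => chordForm h u v) (chordForm₂ h u v) v := by
  have h1 : HasDerivAt (fun v => (u + v) / 2) (1 / 2) v :=
    ((hasDerivAt_id v).const_add u).div_const 2
  have h2 : HasDerivAt (fun v => v - (u + v) / 2) (1 - 1 / 2) v := (hasDerivAt_id v).sub h1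
  have h3 := HasDerivAt.comp v (hh.hasDerivAt ((u + v) / 2)) h1
  have h4 := HasDerivAt.comp v (hh.hasDerivAt_deriv ((u + v) / 2)) h1
  refine ((h3.mul h2.cos).add (h4.mul h2.sin)).congr_deriv ?_
  simp only [Function.comp]
  rw [chordForm₂, show v - (u + v) / 2 = (v - u) / 2 by ring]
  ring

theorem continuous_deriv : Continuous (deriv h) :=
  continuous_iff_continuousAt.2 fun x => (hh.hasDerivAt_deriv x).continuousAt

theorem continuous_deriv_deriv : Continuous (deriv (deriv h)) := by
  have : ContDiff ℝ (1 + 1) h := by simpa [one_add_one_eq_two] using hh.contDiff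
  have h1 : ContDiff ℝ (0 + 1) (deriv h) := by simpa using (contDiff_succ_iff_deriv.1 this).2.2
  exact (contDiff_succ_iff_deriv.1 h1).2.2.continuous

theorem continuous_chordForm₁ : Continuous fun p : ℝ × ℝ => chordForm₁ h p.1 p.2 := by
  have := hh.contDiff.continuous
  have := hh.continuous_deriv_deriv
  unfold chordForm₁
  fun_prop

theorem continuous_chordForm₂ : Continuous fun p : ℝ × ℝ => chordForm₂ h p.1 p.2 := by
  have := hh.contDiff.continuous
  have := hh.continuous_deriv
  have := hh.continuous_deriv_deriv
  unfold chordForm₂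
  fun_prop

end IsSmoothSupport

theorem exists_slope_eq {G g : ℝ → ℝ} (hG : ∀ x, HasDerivAt G (g x) x) {a b : ℝ} (hab : a ≠ b) :
    ∃ ξ, |ξ - a| ≤ |b - a| ∧ (G b - G a) / (b - a) = g ξ := by
  have hc : Continuous G := continuous_iff_continuousAt.2 fun x => (hG x).continuousAt
  rcases hab.lt_or_gt with h | h
  · obtain ⟨ξ, hξ, e⟩ := exists_hasDerivAt_eq_slope G g h hc.continuousOn fun x _ => hG x
    refine ⟨ξ, ?_, e.symm⟩
    rw [abs_of_nonneg (by linarith [hξ.1]), abs_of_nonneg (by linarith)]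
    linarith [hξ.2]
  · obtain ⟨ξ, hξ, e⟩ := exists_hasDerivAt_eq_slope G g h hc.continuousOn fun x _ => hG x
    refine ⟨ξ, ?_, ?_⟩
    · rw [abs_of_nonpos (by linarith [hξ.2]), abs_of_nonpos (by linarith)]
      linarith [hξ.1]
    · rw [e, ← neg_sub, ← neg_sub a b, neg_div_neg_eq]

/-- Partial difference quotients of a `C¹` function converge along any continuous curve. -/
theorem tendsto_partial_slope {G g : ℝ → ℝ → ℝ} (hG : ∀ v u, HasDerivAt (G v) (g v u) u)
    (hg : Continuous fun p : ℝ × ℝ => g p.1 p.2) {U V : ℝ → ℝ} {t : ℝ} (hU : ContinuousAt U t)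
    (hV : ContinuousAt V t) (hne : ∀ s, s ≠ t → U s ≠ U t) :
    Tendsto (fun s => (G (V s) (U s) - G (V s) (U t)) / (U s - U t)) (𝓝[≠] t)
      (𝓝 (g (V t) (U t))) := by
  have hex : ∀ s, ∃ ξ, |ξ - U t| ≤ |U s - U t| ∧
      (s ≠ t → (G (V s) (U s) - G (V s) (U t)) / (U s - U t) = g (V s) ξ) := by
    intro s
    by_cases hs : s = t
    · exact ⟨U t, by simp, fun h => absurd hs h⟩
    · obtain ⟨ξ, h1, h2⟩ := exists_slope_eq (hG (V s)) (hne s hs).symm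
      exact ⟨ξ, h1, fun _ => h2⟩
  choose ξ hξ1 hξ2 using hex
  have hξ : Tendsto ξ (𝓝 t) (𝓝 (U t)) := by
    rw [tendsto_iff_norm_sub_tendsto_zero]
    have h0 : Tendsto (fun s => |U s - U t|) (𝓝 t) (𝓝 0) := by
      have := (tendsto_iff_norm_sub_tendsto_zero.1 hU.tendsto)
      simpa using this
    exact squeeze_zero (fun _ => norm_nonneg _) hξ1 h0
  have h1 : Tendsto (fun s => g (V s) (ξ s)) (𝓝 t) (𝓝 (g (V t) (U t))) :=
    (hg.tendsto (V t, U t)).comp (hV.tendsto.prodMk_nhds hξ)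
  refine (h1.mono_left nhdsWithin_le_nhds).congr' ?_
  filter_upwards [self_mem_nhdsWithin] with s hs
  exact (hξ2 s hs).symm

/-- The solution of a cyclic Jacobi system with positive solution. -/
theorem cyclic_system {p₁ p₂ p₃ q₁ q₂ q₃ a₁ a₂ a₃ u₀ u₁ u₂ u₃ : ℝ} (hp₁ : 0 < p₁) (hp₂ : 0 < p₂)
    (hp₃ : 0 < p₃) (hq₁ : 0 < q₁) (hq₂ : 0 < q₂) (hq₃ : 0 < q₃) (h₀ : 0 < u₀) (h₁ : 0 < u₁)
    (h₂ : 0 < u₂) (h₃ : 0 < u₃) (e₁ : p₁ * u₀ + q₁ * u₂ = a₁ * u₁)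
    (e₂ : p₂ * u₁ + q₂ * u₃ = a₂ * u₂) (e₃ : p₃ * u₂ + q₃ * u₀ = a₃ * u₃) (e : u₃ + u₀ = 2) :
    0 < a₁ ∧ 0 < a₁ * a₂ - p₂ * q₁ ∧ 0 < (a₁ * a₂ - p₂ * q₁) * a₃ - p₃ * q₂ * a₁ ∧
    u₀ = 2 * ((a₁ * a₂ - p₂ * q₁) * a₃ - p₃ * q₂ * a₁) /
      ((a₁ * a₂ - p₂ * q₁) * a₃ - p₃ * q₂ * a₁ + (p₃ * p₂ * p₁ + (a₁ * a₂ - p₂ * q₁) * q₃)) ∧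
    u₂ = (p₂ * p₁ * u₀ + a₁ * q₂ * u₃) / (a₁ * a₂ - p₂ * q₁) ∧
    u₁ = (p₁ * u₀ + q₁ * u₂) / a₁ := by
  -- Gaussian elimination: each pivot times a positive unknown equals a positive expression, so each
  -- pivot is positive.
  have ha₁ : 0 < a₁ := pos_of_mul_pos_left (e₁ ▸ by positivity) h₁.le
  have k₂ : (a₁ * a₂ - p₂ * q₁) * u₂ = p₂ * p₁ * u₀ + a₁ * q₂ * u₃ := by
    linear_combination (-a₁) * e₂ - p₂ * e₁
  have hD : 0 < a₁ * a₂ - p₂ * q₁ := pos_of_mul_pos_left (k₂ ▸ by positivity) h₂.le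
  have k₃ : ((a₁ * a₂ - p₂ * q₁) * a₃ - p₃ * q₂ * a₁) * u₃ =
      (p₃ * p₂ * p₁ + (a₁ * a₂ - p₂ * q₁) * q₃) * u₀ := by
    linear_combination (-(a₁ * a₂ - p₂ * q₁)) * e₃ + p₃ * k₂
  have hE : 0 < (a₁ * a₂ - p₂ * q₁) * a₃ - p₃ * q₂ * a₁ :=
    pos_of_mul_pos_left (k₃ ▸ by positivity) h₃.le
  refine ⟨ha₁, hD, hE, ?_, ?_, ?_⟩
  · rw [eq_div_iff (by positivity)]
    have : u₃ = 2 - u₀ := by linarith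
    rw [this] at k₃
    linear_combination -k₃
  · rw [eq_div_iff hD.ne']
    linarith
  · rw [eq_div_iff ha₁.ne']
    linarith

namespace BilliardDatum

variable {r B : ℝ}

/-- The off-diagonal coefficients of the linearized orbit equations. -/
noncomputable def b (k : ℕ) (D : BilliardDatum r B) (ψ : ℝ) : ℝ :=
  (D.h (D.X k ψ) + deriv (deriv D.h) (D.X k ψ)) * sin (D.δ k ψ) / 2

/-- The diagonal coefficients of the linearized orbit equations. -/
noncomputable def A (k : ℕ) (D : BilliardDatum r B) (ψ : ℝ) : ℝ :=
  (D.h (D.X (k + 1) ψ) - deriv (deriv D.h) (D.X (k + 1) ψ)) * sin (D.δ (k + 1) ψ) / 2 +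
    deriv D.h (D.X (k + 1) ψ) * cos (D.δ (k + 1) ψ) -
  ((deriv (deriv D.h) (D.X k ψ) - D.h (D.X k ψ)) * sin (D.δ k ψ) / 2 +
    deriv D.h (D.X k ψ) * cos (D.δ k ψ))

variable (D : BilliardDatum r B) (k : ℕ) (ψ : ℝ)

theorem chordForm_eq : chordForm D.h (D.Y k ψ) (D.Y (k + 1) ψ) =
    chordForm D.h (D.Y (k + 2) ψ) (D.Y (k + 1) ψ) := by
  rw [chordForm, D.chord_eq, chordForm, add_comm (D.Y (k + 2) ψ)]

theorem chordForm₁_eq : chordForm₁ D.h (D.Y k ψ) (D.Y (k + 1) ψ) = D.b (k + 1) ψ := by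
  rw [b, X_succ_eq, δ_succ_eq, chordForm₁]

theorem chordForm₁_eq' : chordForm₁ D.h (D.Y (k + 2) ψ) (D.Y (k + 1) ψ) = -D.b (k + 2) ψ := by
  rw [b, X_succ_eq, δ_succ_eq, chordForm₁, add_comm (D.Y (k + 2) ψ),
    show (D.Y (k + 1) ψ - D.Y (k + 2) ψ) / 2 = -((D.Y (k + 2) ψ - D.Y (k + 1) ψ) / 2) by ring,
    sin_neg]
  ring

theorem chordForm₂_eq : chordForm₂ D.h (D.Y (k + 2) ψ) (D.Y (k + 1) ψ) -
    chordForm₂ D.h (D.Y k ψ) (D.Y (k + 1) ψ) = D.A (k + 1) ψ := by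
  rw [A, X_succ_eq, δ_succ_eq, X_succ_eq, δ_succ_eq, chordForm₂, chordForm₂,
    add_comm (D.Y (k + 2) ψ),
    show (D.Y (k + 1) ψ - D.Y (k + 2) ψ) / 2 = -((D.Y (k + 2) ψ - D.Y (k + 1) ψ) / 2) by ring,
    sin_neg, cos_neg]
  ring

theorem slope_Y_pos {s : ℝ} (hs : s ≠ ψ) : 0 < slope (D.Y k) ψ s := by
  rw [slope_def_field]
  rcases hs.lt_or_gt with h | h
  · exact div_pos_of_neg_of_neg (sub_neg.2 (D.strictMono_Y k h)) (sub_neg.2 h)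
  · exact div_pos (sub_pos.2 (D.strictMono_Y k h)) (sub_pos.2 h)

/-- Subtract the orbit equation at ψ from that at s, changing one argument at a time. The
coefficients are partial difference quotients of `chordForm`; they converge by continuity of the `Y
k` alone, before any differentiability is known. -/
theorem exists_slope_system : ∃ p q a : ℝ → ℝ,
    Tendsto p (𝓝[≠] ψ) (𝓝 (D.b (k + 1) ψ)) ∧ Tendsto q (𝓝[≠] ψ) (𝓝 (D.b (k + 2) ψ)) ∧
    Tendsto a (𝓝[≠] ψ) (𝓝 (D.A (k + 1) ψ)) ∧ ∀ s, s ≠ ψ →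
      p s * slope (D.Y k) ψ s + q s * slope (D.Y (k + 2)) ψ s =
        a s * slope (D.Y (k + 1)) ψ s := by
  have hne : ∀ j s, s ≠ ψ → D.Y j s ≠ D.Y j ψ := fun j s hs => (D.strictMono_Y j).injective.ne hs
  have hc : ∀ j, ContinuousAt (D.Y j) ψ := fun j => (D.continuous_Y j).continuousAt
  have t₁ : ∀ j, Tendsto (fun s => (chordForm D.h (D.Y j s) (D.Y (k + 1) s) -
      chordForm D.h (D.Y j ψ) (D.Y (k + 1) s)) / (D.Y j s - D.Y j ψ)) (𝓝[≠] ψ)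
      (𝓝 (chordForm₁ D.h (D.Y j ψ) (D.Y (k + 1) ψ))) := fun j =>
    tendsto_partial_slope (G := fun v u => chordForm D.h u v) (g := fun v u => chordForm₁ D.h u v)
      (fun v u => D.smooth.hasDerivAt_chordForm₁ u v)
      (D.smooth.continuous_chordForm₁.comp continuous_swap) (hc j) (hc (k + 1)) (hne j)
  have t₂ : ∀ j, Tendsto (fun s => (chordForm D.h (D.Y j ψ) (D.Y (k + 1) s) -
      chordForm D.h (D.Y j ψ) (D.Y (k + 1) ψ)) / (D.Y (k + 1) s - D.Y (k + 1) ψ)) (𝓝[≠] ψ)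
      (𝓝 (chordForm₂ D.h (D.Y j ψ) (D.Y (k + 1) ψ))) := fun j =>
    tendsto_partial_slope (G := fun v u => chordForm D.h v u) (g := fun v u => chordForm₂ D.h v u)
      (V := fun _ => D.Y j ψ)
      (fun v u => D.smooth.hasDerivAt_chordForm₂ v u)
      D.smooth.continuous_chordForm₂ (hc (k + 1)) continuousAt_const (hne (k + 1))
  refine ⟨_, fun s => -((chordForm D.h (D.Y (k + 2) s) (D.Y (k + 1) s) -
      chordForm D.h (D.Y (k + 2) ψ) (D.Y (k + 1) s)) / (D.Y (k + 2) s - D.Y (k + 2) ψ)), _,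
    chordForm₁_eq D k ψ ▸ t₁ k, ?_, chordForm₂_eq D k ψ ▸ (t₂ (k + 2)).sub (t₂ k), ?_⟩
  · have := (t₁ (k + 2)).neg
    rwa [chordForm₁_eq', neg_neg] at this
  · intro s hs
    have n0 := sub_ne_zero.2 (hne k s hs)
    have n1 := sub_ne_zero.2 (hne (k + 1) s hs)
    have n2 := sub_ne_zero.2 (hne (k + 2) s hs)
    have n := sub_ne_zero.2 hs
    have e1 := D.chordForm_eq k s
    have e2 := D.chordForm_eq k ψ
    simp only [slope_def_field]
    have c : ∀ x y : ℝ, y ≠ 0 → x / y * (y / (s - ψ)) = x / (s - ψ) := fun x y hy => by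
      field_simp
    rw [c _ _ n0, neg_mul, c _ _ n2, sub_mul, c _ _ n1, c _ _ n1, ← sub_eq_zero,
      show ∀ x y z w : ℝ, x / (s - ψ) + -(y / (s - ψ)) - (z / (s - ψ) - w / (s - ψ)) =
        (x - y - z + w) / (s - ψ) from fun x y z w => by ring]
    rw [div_eq_zero_iff]
    left
    linarith

theorem b_add_four : D.b (k + 4) ψ = D.b k ψ := by
  rw [b, b, X_add_four, δ_add_four, D.smooth.periodic,
    deriv_periodic (deriv_periodic D.smooth.periodic)]

theorem slope_Y_add_four (s : ℝ) : slope (D.Y (k + 4)) ψ s = slope (D.Y k) ψ s := by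
  simp only [slope_def_field, Y_add_four]
  ring

theorem slope_Y_sum {s : ℝ} (hs : s ≠ ψ) : slope (D.Y 3) ψ s + slope (D.Y 0) ψ s = 2 := by
  have e : ∀ x, D.Y 3 x + D.Y 0 x = 2 * x + 2 * π := fun x => by
    rw [Y_three_eq, Y]
    simp only [δ, X_zero]
    ring
  rw [slope_def_field, slope_def_field, ← add_div, div_eq_iff (sub_ne_zero.2 hs)]
  linarith [e s, e ψ]

theorem b_pos (hr : 0 < r) : 0 < D.b k ψ := by
  have h1 := D.curv (D.X k ψ)
  have h2 := sin_pos_of_pos_of_lt_pi (D.δ_mem k ψ).1 (D.δ_mem k ψ).2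
  rw [b]
  have := hr.trans_le h1
  positivity

/-- The determinants that occur in the solution of the linearized orbit equations. -/
noncomputable def det₂ (D : BilliardDatum r B) (ψ : ℝ) : ℝ :=
  D.A 1 ψ * D.A 2 ψ - D.b 2 ψ * D.b 2 ψ

/-- See `det₂`. -/
noncomputable def det₃ (D : BilliardDatum r B) (ψ : ℝ) : ℝ :=
  D.det₂ ψ * D.A 3 ψ - D.b 3 ψ * D.b 3 ψ * D.A 1 ψ

/-- See `det₂`. -/
noncomputable def num (D : BilliardDatum r B) (ψ : ℝ) : ℝ :=
  D.b 3 ψ * D.b 2 ψ * D.b 1 ψ + D.det₂ ψ * D.b 4 ψ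

/-- The speed of the normal angle of the `k`-th chord. -/
noncomputable def U (k : ℕ) (D : BilliardDatum r B) (ψ : ℝ) : ℝ := deriv (D.Y k) ψ

/-- The `Y k` increase, so their slopes are positive, and the slopes of `Y 0` and `Y 3` sum to 2.
`cyclic_system` then expresses the slopes through convergent coefficients, and the limits are the
derivatives. -/
theorem hasDerivAt_Y_aux (hr : 0 < r) : 0 ≤ D.A 1 ψ ∧ 0 ≤ D.det₂ ψ ∧ 0 ≤ D.det₃ ψ ∧
    (∀ k < 4, HasDerivAt (D.Y k) (D.U k ψ) ψ) ∧
    D.U 0 ψ = 2 * D.det₃ ψ / (D.det₃ ψ + D.num ψ) ∧ D.U 3 ψ = 2 - D.U 0 ψ ∧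
    D.U 2 ψ = (D.b 2 ψ * D.b 1 ψ * D.U 0 ψ + D.A 1 ψ * D.b 3 ψ * D.U 3 ψ) / D.det₂ ψ ∧
    D.U 1 ψ = (D.b 1 ψ * D.U 0 ψ + D.b 2 ψ * D.U 2 ψ) / D.A 1 ψ := by
  obtain ⟨p₁, q₁, a₁, hp₁, hq₁, ha₁, e₁⟩ := D.exists_slope_system 0 ψ
  obtain ⟨p₂, q₂, a₂, hp₂, hq₂, ha₂, e₂⟩ := D.exists_slope_system 1 ψ
  obtain ⟨p₃, q₃, a₃, hp₃, hq₃, ha₃, e₃⟩ := D.exists_slope_system 2 ψ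
  norm_num only at hp₁ hq₁ ha₁ e₁ hp₂ hq₂ ha₂ e₂ hp₃ hq₃ ha₃ e₃
  have hb := fun k => D.b_pos k ψ hr
  have hne : ∀ᶠ s in 𝓝[≠] ψ, s ≠ ψ := self_mem_nhdsWithin
  have key : ∀ᶠ s in 𝓝[≠] ψ, s ≠ ψ ∧ 0 < a₁ s ∧ 0 < a₁ s * a₂ s - p₂ s * q₁ s ∧
      0 < (a₁ s * a₂ s - p₂ s * q₁ s) * a₃ s - p₃ s * q₂ s * a₁ s ∧
      slope (D.Y 0) ψ s = 2 * ((a₁ s * a₂ s - p₂ s * q₁ s) * a₃ s - p₃ s * q₂ s * a₁ s) /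
        ((a₁ s * a₂ s - p₂ s * q₁ s) * a₃ s - p₃ s * q₂ s * a₁ s +
          (p₃ s * p₂ s * p₁ s + (a₁ s * a₂ s - p₂ s * q₁ s) * q₃ s)) ∧
      slope (D.Y 2) ψ s = (p₂ s * p₁ s * slope (D.Y 0) ψ s + a₁ s * q₂ s * slope (D.Y 3) ψ s) /
        (a₁ s * a₂ s - p₂ s * q₁ s) ∧
      slope (D.Y 1) ψ s = (p₁ s * slope (D.Y 0) ψ s + q₁ s * slope (D.Y 2) ψ s) / a₁ s := by
    filter_upwards [hne, hp₁.eventually_const_lt (hb 1), hp₂.eventually_const_lt (hb 2),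
      hp₃.eventually_const_lt (hb 3), hq₁.eventually_const_lt (hb 2),
      hq₂.eventually_const_lt (hb 3), hq₃.eventually_const_lt (hb 4)]
      with s hs i₁ i₂ i₃ j₁ j₂ j₃
    have e₄ := e₃ s hs
    rw [slope_Y_add_four D 0] at e₄
    exact ⟨hs, cyclic_system i₁ i₂ i₃ j₁ j₂ j₃ (D.slope_Y_pos 0 ψ hs) (D.slope_Y_pos 1 ψ hs)
      (D.slope_Y_pos 2 ψ hs) (D.slope_Y_pos 3 ψ hs) (e₁ s hs) (e₂ s hs) e₄ (D.slope_Y_sum ψ hs)⟩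
  have tD : Tendsto (fun s => a₁ s * a₂ s - p₂ s * q₁ s) (𝓝[≠] ψ) (𝓝 (D.det₂ ψ)) :=
    (ha₁.mul ha₂).sub (hp₂.mul hq₁)
  have tE : Tendsto (fun s => (a₁ s * a₂ s - p₂ s * q₁ s) * a₃ s - p₃ s * q₂ s * a₁ s) (𝓝[≠] ψ)
      (𝓝 (D.det₃ ψ)) := (tD.mul ha₃).sub ((hp₃.mul hq₂).mul ha₁)
  have tN : Tendsto (fun s => p₃ s * p₂ s * p₁ s + (a₁ s * a₂ s - p₂ s * q₁ s) * q₃ s) (𝓝[≠] ψ)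
      (𝓝 (D.num ψ)) := ((hp₃.mul hp₂).mul hp₁).add (tD.mul hq₃)
  have hA : 0 ≤ D.A 1 ψ := ge_of_tendsto ha₁ (key.mono fun s hs => hs.2.1.le)
  have hD : 0 ≤ D.det₂ ψ := ge_of_tendsto tD (key.mono fun s hs => hs.2.2.1.le)
  have hE : 0 ≤ D.det₃ ψ := ge_of_tendsto tE (key.mono fun s hs => hs.2.2.2.1.le)
  -- In the limit the pivots are only nonnegative. A vanishing pivot would make the next minor
  -- negative, because the `b k` are positive.
  have hA' : 0 < D.A 1 ψ := by
    refine hA.lt_of_ne fun h0 => ?_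
    rw [det₂, ← h0] at hD
    nlinarith [hb 2]
  have hD' : 0 < D.det₂ ψ := by
    refine hD.lt_of_ne fun h0 => ?_
    rw [det₃, ← h0] at hE
    have := mul_pos (mul_pos (hb 3) (hb 3)) hA'
    linarith
  have hN' : 0 < D.num ψ := by
    have h1 := mul_pos (mul_pos (hb 3) (hb 2)) (hb 1)
    have h2 := mul_pos hD' (hb 4)
    rw [num]
    linarith
  have t0 : Tendsto (slope (D.Y 0) ψ) (𝓝[≠] ψ) (𝓝 (2 * D.det₃ ψ / (D.det₃ ψ + D.num ψ))) :=
    ((tE.const_mul 2).div (tE.add tN) (by positivity)).congr' (key.mono fun s hs => hs.2.2.2.2.1.symm)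
  have t3 : Tendsto (slope (D.Y 3) ψ) (𝓝[≠] ψ) (𝓝 (2 - 2 * D.det₃ ψ / (D.det₃ ψ + D.num ψ))) :=
    (t0.const_sub 2).congr' (key.mono fun s hs => by linarith [D.slope_Y_sum ψ hs.1])
  have t2 := (((hp₂.mul hp₁).mul t0).add ((ha₁.mul hq₂).mul t3)).div tD hD'.ne'
  replace t2 := t2.congr' (key.mono fun s hs => hs.2.2.2.2.2.1.symm)
  have t1 := ((hp₁.mul t0).add (hq₁.mul t2)).div ha₁ hA'.ne'
  replace t1 := t1.congr' (key.mono fun s hs => hs.2.2.2.2.2.2.symm)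
  have d0 := hasDerivAt_iff_tendsto_slope.2 t0
  have d1 := hasDerivAt_iff_tendsto_slope.2 t1
  have d2 := hasDerivAt_iff_tendsto_slope.2 t2
  have d3 := hasDerivAt_iff_tendsto_slope.2 t3
  refine ⟨hA, hD, hE, fun k hk => ?_, ?_⟩
  · rw [U]
    interval_cases k
    exacts [d0.differentiableAt.hasDerivAt, d1.differentiableAt.hasDerivAt,
      d2.differentiableAt.hasDerivAt, d3.differentiableAt.hasDerivAt]
  · rw [U, U, U, U, d0.deriv, d1.deriv, d2.deriv, d3.deriv]
    exact ⟨rfl, rfl, rfl, rfl⟩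

theorem hasDerivAt_Y (hr : 0 < r) : HasDerivAt (D.Y k) (D.U k ψ) ψ := by
  obtain ⟨j, m, hj, rfl⟩ : ∃ j m, j < 4 ∧ k = j + 4 * m :=
    ⟨k % 4, k / 4, Nat.mod_lt _ (by norm_num), (Nat.mod_add_div k 4).symm⟩
  have h := (D.hasDerivAt_Y_aux ψ hr).2.2.2.1 j hj
  have e : D.Y (j + 4 * m) = fun x => D.Y j x + 2 * π * m := by
    funext x
    induction m with
    | zero => simp
    | succ m ih =>
      rw [show j + 4 * (m + 1) = j + 4 * m + 4 by ring, Y_add_four, ih]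
      push_cast
      ring
  rw [U, e, deriv_add_const]
  exact h.add_const _

theorem U_add_four : D.U (k + 4) ψ = D.U k ψ := by
  rw [U, show D.Y (k + 4) = fun x => D.Y k x + 2 * π from funext (D.Y_add_four k),
    deriv_add_const, U]

theorem U_nonneg : 0 ≤ D.U k ψ := (D.strictMono_Y k).monotone.deriv_nonneg

/-- The linearized orbit equations. -/
theorem linear_eq (hr : 0 < r) : D.b (k + 1) ψ * D.U k ψ + D.b (k + 2) ψ * D.U (k + 2) ψ =
    D.A (k + 1) ψ * D.U (k + 1) ψ := by
  obtain ⟨p, q, a, hp, hq, ha, e⟩ := D.exists_slope_system k ψ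
  have t := fun k => hasDerivAt_iff_tendsto_slope.1 (D.hasDerivAt_Y k ψ hr)
  refine tendsto_nhds_unique ((hp.mul (t k)).add (hq.mul (t (k + 2))))
    ((ha.mul (t (k + 1))).congr' ?_)
  filter_upwards [self_mem_nhdsWithin] with s hs
  exact (e s hs).symm

end BilliardDatum

/-! ### Uniform bounds for the derivatives of the orbits. -/

theorem UniformPos.of_mul_ge {ι : Type*} {l : Filter ι} {F G H : ι → ℝ → ℝ}
    (hH : UniformPos l H) (hG : UniformO l 0 1 G) (hF : ∀ᶠ i in l, ∀ x, 0 ≤ F i x)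
    (hFG : ∀ᶠ i in l, ∀ x, H i x ≤ F i x * G i x) : UniformPos l F := by
  obtain ⟨c, hc, h⟩ := hH
  obtain ⟨C, hC, h'⟩ := hG.bound
  refine ⟨c / (C + 1), by positivity, ?_⟩
  filter_upwards [h, h', hF, hFG] with i h1 h2 h3 h4 x
  rw [div_le_iff₀ (by positivity)]
  refine (h1 x).trans ((h4 x).trans (mul_le_mul_of_nonneg_left ?_ (h3 x)))
  have := (abs_le.1 (h2 x)).2
  rw [Pi.one_apply] at this
  linarith

namespace BilliardDatum

variable {r B : ℝ} {l : Filter (BilliardDatum r B)} {n : ℕ}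

theorem uniformO_h (hn : n ≤ 12) : UniformO l n 1 fun D : BilliardDatum r B => D.h :=
  UniformO.of_le ⟨max B 0, le_max_right _ _, Eventually.of_forall fun D =>
    D.bound.mono le_rfl (by simp)⟩ hn

theorem uniformO_deriv_h (hn : n ≤ 11) :
    UniformO l n 1 fun D : BilliardDatum r B => deriv D.h :=
  (uniformO_h le_rfl).deriv.of_le hn

theorem uniformO_deriv_deriv_h (hn : n ≤ 10) :
    UniformO l n 1 fun D : BilliardDatum r B => deriv (deriv D.h) :=
  (uniformO_deriv_h le_rfl).deriv.of_le hn

theorem uniformO_X_succ {k : ℕ} (hY : ∀ k, UniformO l n 1 fun D x => Y k D x - x) :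
    UniformO l n 1 fun D x => X (k + 1) D x - x :=
  (((hY k).add (hY (k + 1))).const_mul (1 / 2)).congr' fun D x => by
    rw [X_succ_eq]
    ring

theorem uniformO_δ_succ {k : ℕ} (hY : ∀ k, UniformO l n 1 fun D x => Y k D x - x) :
    UniformO l n 1 (δ (r := r) (B := B) (k + 1)) :=
  (((hY (k + 1)).sub (hY k)).const_mul (1 / 2)).congr' fun D x => by
    rw [δ_succ_eq]
    ring

theorem uniformO_b {k : ℕ} (hn : n ≤ 10) (hY : ∀ k, UniformO l n 1 fun D x => Y k D x - x) :
    UniformO l n 1 (b (r := r) (B := B) (k + 1)) := by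
  have hX := uniformO_X_succ (k := k) hY
  have hs := UniformO.sin_const.comp_bdd (uniformO_δ_succ (k := k) hY)
  have h0 := (uniformO_h (hn.trans (by norm_num))).comp zero_le_one hX
  have h2 := (uniformO_deriv_deriv_h hn).comp zero_le_one hX
  exact (((h0.add h2).mul11 hs).const_mul (1 / 2)).congr' fun D x => by
    rw [b]
    ring

theorem uniformO_A {k : ℕ} (hn : n ≤ 10) (hY : ∀ k, UniformO l n 1 fun D x => Y k D x - x) :
    UniformO l n 1 (A (r := r) (B := B) (k + 1)) := by
  have hX := fun k => uniformO_X_succ (k := k) hY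
  have hs := fun k => UniformO.sin_const.comp_bdd (uniformO_δ_succ (k := k) hY)
  have hc := fun k => UniformO.cos_const.comp_bdd (uniformO_δ_succ (k := k) hY)
  have h0 := fun k => (uniformO_h (hn.trans (by norm_num))).comp zero_le_one (hX k)
  have h1 := fun k => (uniformO_deriv_h (hn.trans (by norm_num))).comp zero_le_one (hX k)
  have h2 := fun k => (uniformO_deriv_deriv_h hn).comp zero_le_one (hX k)
  exact ((((((h0 (k + 1)).sub (h2 (k + 1))).mul11 (hs (k + 1))).const_mul (1 / 2)).add
    ((h1 (k + 1)).mul11 (hc (k + 1)))).sub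
    (((((h2 k).sub (h0 k)).mul11 (hs k)).const_mul (1 / 2)).add
    ((h1 k).mul11 (hc k)))).congr' fun D x => by
      rw [A]
      ring

theorem uniformPos_sin_δ (hr : 0 < r) (k : ℕ) :
    UniformPos l fun (D : BilliardDatum r B) x => sin (D.δ k x) := by
  obtain ⟨c, hc, h⟩ := exists_angle_bound (B := B) hr
  exact ⟨c, hc, Eventually.of_forall fun D x => (h D k x).2.2⟩

theorem uniformPos_b (hr : 0 < r) (k : ℕ) : UniformPos l (b (r := r) (B := B) k) := by
  have h1 : UniformPos l fun (_ : BilliardDatum r B) _ => r / 2 :=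
    ⟨r / 2, by positivity, Eventually.of_forall fun _ _ => le_rfl⟩
  refine (h1.mul (uniformPos_sin_δ hr k)).mono (Eventually.of_forall fun D x => ?_)
  have h2 := D.curv (D.X k x)
  have h3 := sin_pos_of_pos_of_lt_pi (D.δ_mem k x).1 (D.δ_mem k x).2
  rw [b, mul_div_right_comm]
  exact mul_le_mul_of_nonneg_right (by linarith) h3.le

theorem uniformO_Y_zero (k : ℕ) : UniformO l 0 1 fun (D : BilliardDatum r B) x => Y k D x - x := by
  refine UniformO.zero_of (C := 2 * π * k + π)
    (Eventually.of_forall fun D => (D.continuous_Y k).sub continuous_id) (by positivity)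
    (Eventually.of_forall fun D x => ?_)
  simpa using D.abs_Y_sub_le k x

/-- Nonnegativity of `det₂` says that `A 1` times the bounded `A 2` is at least `b 2` squared.
Similarly `det₃ ≥ 0` bounds `det₂` from below. -/
theorem uniformPos_A_one (hr : 0 < r) : UniformPos l (A (r := r) (B := B) 1) := by
  refine ((uniformPos_b hr 2).mul (uniformPos_b hr 2)).of_mul_ge
    (uniformO_A (k := 1) (Nat.zero_le _) uniformO_Y_zero)
    (Eventually.of_forall fun D x => (D.hasDerivAt_Y_aux x hr).1)
    (Eventually.of_forall fun D x => ?_)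
  have := (D.hasDerivAt_Y_aux x hr).2.1
  rw [det₂] at this
  linarith

theorem uniformPos_det₂ (hr : 0 < r) : UniformPos l (det₂ (r := r) (B := B)) := by
  refine (((uniformPos_b hr 3).mul (uniformPos_b hr 3)).mul (uniformPos_A_one hr)).of_mul_ge
    (uniformO_A (k := 2) (Nat.zero_le _) uniformO_Y_zero)
    (Eventually.of_forall fun D x => (D.hasDerivAt_Y_aux x hr).2.1)
    (Eventually.of_forall fun D x => ?_)
  have := (D.hasDerivAt_Y_aux x hr).2.2.1
  rw [det₃] at this
  linarith

theorem uniformPos_det₃_add_num (hr : 0 < r) :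
    UniformPos l fun (D : BilliardDatum r B) x => D.det₃ x + D.num x := by
  refine (((uniformPos_b hr 3).mul (uniformPos_b hr 2)).mul (uniformPos_b hr 1)).mono
    (Eventually.of_forall fun D x => ?_)
  obtain ⟨-, h1, h2, -⟩ := D.hasDerivAt_Y_aux x hr
  have := mul_nonneg h1 (D.b_pos 4 x hr).le
  rw [num]
  linarith

theorem uniformO_U_of_uniformO_Y (hr : 0 < r) (hn : n ≤ 10)
    (hY : ∀ k, UniformO l n 1 fun (D : BilliardDatum r B) x => Y k D x - x) (k : ℕ) :
    UniformO l n 1 (U (r := r) (B := B) k) := by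
  have hb := fun k => uniformO_b (k := k) hn hY
  have hA := fun k => uniformO_A (k := k) hn hY
  have hdet₂ : UniformO l n 1 (det₂ (r := r) (B := B)) :=
    ((hA 0).mul11 (hA 1)).sub ((hb 1).mul11 (hb 1))
  have hdet₃ : UniformO l n 1 (det₃ (r := r) (B := B)) :=
    (hdet₂.mul11 (hA 2)).sub (((hb 2).mul11 (hb 2)).mul11 (hA 0))
  have hnum : UniformO l n 1 (num (r := r) (B := B)) :=
    (((hb 2).mul11 (hb 1)).mul11 (hb 0)).add (hdet₂.mul11 (hb 3))
  have h0 : UniformO l n 1 (U (r := r) (B := B) 0) :=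
    ((hdet₃.const_mul 2).div zero_le_one (hdet₃.add hnum) (uniformPos_det₃_add_num hr)).congr'
      fun D x => (D.hasDerivAt_Y_aux x hr).2.2.2.2.1.symm
  have h3 : UniformO l n 1 (U (r := r) (B := B) 3) :=
    ((UniformO.const_one 2).sub h0).congr' fun D x => (D.hasDerivAt_Y_aux x hr).2.2.2.2.2.1.symm
  have h2 : UniformO l n 1 (U (r := r) (B := B) 2) :=
    (((((hb 1).mul11 (hb 0)).mul11 h0).add (((hA 0).mul11 (hb 2)).mul11 h3)).div zero_le_one hdet₂
      (uniformPos_det₂ hr)).congr' fun D x => (D.hasDerivAt_Y_aux x hr).2.2.2.2.2.2.1.symm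
  have h1 : UniformO l n 1 (U (r := r) (B := B) 1) :=
    ((((hb 0).mul11 h0).add ((hb 1).mul11 h2)).div zero_le_one (hA 0)
      (uniformPos_A_one hr)).congr' fun D x => (D.hasDerivAt_Y_aux x hr).2.2.2.2.2.2.2.symm
  induction k using Nat.strong_induction_on with
  | _ k ih =>
    rcases lt_or_ge k 4 with hk | hk
    · interval_cases k <;> assumption
    · obtain ⟨j, rfl⟩ := Nat.exists_eq_add_of_le' hk
      exact (ih j (by omega)).congr' fun D x => (D.U_add_four j x).symm

/-- Bootstrapping: the derivative `U k` is a rational expression in h, h', h'' and sines and cosines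
taken along the orbit, with denominators bounded below. So a C^n bound for the `Y k` gives one for
the `U k`, that is, C^(n+1) for the `Y k`. -/
theorem uniformO_Y (hr : 0 < r) (hn : n ≤ 11) (k : ℕ) :
    UniformO l n 1 fun (D : BilliardDatum r B) x => Y k D x - x := by
  induction n generalizing k with
  | zero => exact uniformO_Y_zero k
  | succ n ih =>
    have h := uniformO_U_of_uniformO_Y hr (by omega) (ih (by omega)) k
    exact UniformO.succ_of_hasDerivAt zero_le_one (uniformO_Y_zero k)
      (Eventually.of_forall fun D x => (D.hasDerivAt_Y k x hr).sub (hasDerivAt_id x))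
      (h.sub (UniformO.const_one 1))

theorem uniformO_U (hr : 0 < r) (hn : n ≤ 10) (k : ℕ) :
    UniformO l n 1 (U (r := r) (B := B) k) :=
  uniformO_U_of_uniformO_Y hr hn (fun k => uniformO_Y hr (by omega) k) k

/-- The formula for `δ` through the chords starts at index 1; a shift by the period 4 covers index
0. -/
theorem uniformO_δ (hr : 0 < r) (hn : n ≤ 11) (k : ℕ) :
    UniformO l n 1 (δ (r := r) (B := B) k) :=
  (uniformO_δ_succ (k := k + 3) (uniformO_Y hr hn)).congr' fun D x => D.δ_add_four k x

theorem uniformO_X (hr : 0 < r) (hn : n ≤ 11) (k : ℕ) :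
    UniformO l n 1 fun (D : BilliardDatum r B) x => X k D x - x :=
  ((uniformO_X_succ (k := k + 3) (uniformO_Y hr hn)).sub (UniformO.const_one (2 * π))).congr'
    fun D x => by
      rw [show k + 3 + 1 = k + 4 by ring, X_add_four]
      ring

theorem uniformO_d (hr : 0 < r) (hn : n ≤ 11) :
    UniformO l n 1 fun D : BilliardDatum r B => D.d := uniformO_δ hr hn 0

/-- The normal angle of the outgoing chord increases at a definite rate. -/
theorem uniformPos_U_zero (hr : 0 < r) : UniformPos l (U (r := r) (B := B) 0) := by
  have h : UniformPos l fun (D : BilliardDatum r B) x => 2 * D.b 4 x :=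
    UniformPos.mul ⟨2, two_pos, Eventually.of_forall fun _ _ => le_rfl⟩ (uniformPos_b hr 4)
  refine h.of_mul_ge ((uniformO_A (k := 3) (Nat.zero_le _) uniformO_Y_zero).add
    (uniformO_b (k := 3) (Nat.zero_le _) uniformO_Y_zero))
    (Eventually.of_forall fun D x => D.U_nonneg 0 x) (Eventually.of_forall fun D x => ?_)
  -- Inserting `U 3 = 2 - U 0` and dropping the nonnegative term with `U 1` leaves 2 b₄ ≤ U₀ (A₄ +
  -- b₄).
  have h1 := D.linear_eq 3 x hr
  norm_num only at h1
  rw [b_add_four D 1, U_add_four D 1, U_add_four D 0] at h1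
  have h2 := (D.hasDerivAt_Y_aux x hr).2.2.2.2.2.1
  have h3 := mul_nonneg (D.b_pos 1 x hr).le (D.U_nonneg 1 x)
  rw [h2] at h1
  norm_num only
  linarith

end BilliardDatum

/-! ### Approximate central symmetry in C^0. -/

theorem sin_ge_of_mem {a x : ℝ} (ha : 0 ≤ a) (h1 : a ≤ x) (h2 : x ≤ π - a) : sin a ≤ sin x := by
  rcases le_total x (π / 2) with h | h
  · exact sin_le_sin_of_le_of_le_pi_div_two (by linarith [pi_pos]) h h1
  · rw [← sin_pi_sub x]
    exact sin_le_sin_of_le_of_le_pi_div_two (by linarith [pi_pos]) (by linarith) (by linarith)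

theorem UniformO.lipschitz {ι : Type*} {l : Filter ι} {F : ι → ℝ → ℝ}
    (h : UniformO l 1 1 fun i x => F i x - x) :
    ∃ L, 0 ≤ L ∧ ∀ᶠ i in l, ∀ x y, |F i x - F i y| ≤ L * |x - y| := by
  obtain ⟨C, hC, h⟩ := h
  refine ⟨C + 1, by positivity, ?_⟩
  filter_upwards [h] with i hi x y
  obtain ⟨-, hd, hb⟩ := CBound.succ_iff.1 hi
  have h1 := Convex.norm_image_sub_le_of_norm_deriv_le (s := univ) (C := C) (fun z _ => hd z)
    (fun z _ => by simpa using hb.abs_le z) convex_univ (mem_univ y) (mem_univ x)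
  rw [Real.norm_eq_abs, Real.norm_eq_abs] at h1
  have h2 := abs_add_le (F i x - x - (F i y - y)) (x - y)
  rw [show F i x - x - (F i y - y) + (x - y) = F i x - F i y by ring] at h2
  linarith

namespace BilliardDatum

variable {r B : ℝ} (D : BilliardDatum r B)

/-- The twist condition in quantitative form: the derivative `chordForm₁` is bounded below while the
angle (v - u)/2 stays away from 0 and π. -/
theorem chordForm_left_sub_ge (hr : 0 < r) {a u u' v : ℝ} (ha : 0 ≤ a) (hu : u ≤ u')
    (h1 : 2 * a ≤ v - u') (h2 : v - u ≤ 2 * π - 2 * a) :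
    r * sin a / 2 * (u' - u) ≤ chordForm D.h u' v - chordForm D.h u v := by
  have hd := fun u => D.smooth.hasDerivAt_chordForm₁ u v
  refine (convex_Icc u u').mul_sub_le_image_sub_of_le_deriv
    (fun x _ => (hd x).continuousAt.continuousWithinAt)
    (fun x _ => (hd x).differentiableAt.differentiableWithinAt) (fun x hx => ?_) u
    (left_mem_Icc.2 hu) u' (right_mem_Icc.2 hu) hu
  rw [interior_Icc] at hx
  rw [(hd x).deriv, chordForm₁]
  have h3 := sin_ge_of_mem ha (x := (v - x) / 2) (by linarith [hx.2]) (by linarith [hx.1])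
  have h4 : 0 ≤ sin a := sin_nonneg_of_nonneg_of_le_pi ha (by linarith)
  have h5 := mul_le_mul (D.curv ((x + v) / 2)) h3 h4 (hr.le.trans (D.curv _))
  linarith

theorem chordForm_right_sub_ge (hr : 0 < r) {a w w' v : ℝ} (ha : 0 ≤ a) (hw : w ≤ w')
    (h1 : 2 * a ≤ w - v) (h2 : w' - v ≤ 2 * π - 2 * a) :
    r * sin a / 2 * (w' - w) ≤ chordForm D.h w v - chordForm D.h w' v := by
  have hd := fun u => (D.smooth.hasDerivAt_chordForm₁ u v).neg
  have := (convex_Icc w w').mul_sub_le_image_sub_of_le_deriv (C := r * sin a / 2)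
    (fun x _ => (hd x).continuousAt.continuousWithinAt)
    (fun x _ => (hd x).differentiableAt.differentiableWithinAt) (fun x hx => ?_) w
    (left_mem_Icc.2 hw) w' (right_mem_Icc.2 hw) hw
  · simp only [Pi.neg_apply] at this
    linarith
  rw [interior_Icc] at hx
  rw [(hd x).deriv, chordForm₁, show (v - x) / 2 = -((x - v) / 2) by ring, sin_neg]
  have h3 := sin_ge_of_mem ha (x := (x - v) / 2) (by linarith [hx.1]) (by linarith [hx.2])
  have h4 : 0 ≤ sin a := sin_nonneg_of_nonneg_of_le_pi ha (by linarith)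
  have h5 := mul_le_mul (D.curv ((x + v) / 2)) h3 h4 (hr.le.trans (D.curv _))
  linarith

theorem abs_chordForm_sub_le (u v v' : ℝ) :
    |chordForm D.h u v' - chordForm D.h u v| ≤ 2 * B * |v' - v| := by
  have hd := fun v => D.smooth.hasDerivAt_chordForm₂ u v
  have := Convex.norm_image_sub_le_of_norm_deriv_le (s := univ) (C := 2 * B)
    (fun z _ => (hd z).differentiableAt) (fun z _ => ?_) convex_univ (mem_univ v) (mem_univ v')
  · simpa using this
  rw [(hd z).deriv, chordForm₂, Real.norm_eq_abs]
  set m := (u + z) / 2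
  set q := (z - u) / 2
  have h0 := D.abs_h_le m
  have h1 := D.abs_deriv_h_le m
  have h2 := D.abs_deriv_deriv_h_le m
  have h3 : |(deriv (deriv D.h) m - D.h m) * sin q| ≤ 2 * B * 1 := by
    rw [abs_mul]
    refine mul_le_mul ?_ (abs_sin_le_one q) (abs_nonneg _) (by linarith [D.B_nonneg])
    exact (abs_sub _ _).trans (by linarith)
  have h4 : |deriv D.h m * cos q| ≤ B * 1 := by
    rw [abs_mul]
    exact mul_le_mul h1 (abs_cos_le_one q) (abs_nonneg _) D.B_nonneg
  refine (abs_add_le _ _).trans ?_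
  rw [abs_div, abs_of_pos (two_pos : (0 : ℝ) < 2)]
  linarith

theorem deriv_near (x : ℝ) :
    deriv (fun x => D.h (x + π) - D.h x) x = deriv D.h (x + π) - deriv D.h x :=
  ((HasDerivAt.comp_add_const x π (D.smooth.hasDerivAt (x + π))).sub
    (D.smooth.hasDerivAt x)).deriv

theorem abs_chordForm_add_pi_sub_le (u v : ℝ) :
    |chordForm D.h (u + π) (v + π) - chordForm D.h u v| ≤ 4 * D.ε := by
  have h0 := D.near.abs_le ((u + v) / 2)
  have h1 := (CBound.succ_iff.1 D.near).2.2.abs_le ((u + v) / 2)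
  rw [deriv_near] at h1
  set m := (u + v) / 2 with hm
  have e : chordForm D.h (u + π) (v + π) - chordForm D.h u v =
      (D.h (m + π) - D.h m) * cos (v - m) + (deriv D.h (m + π) - deriv D.h m) * sin (v - m) := by
    rw [chordForm, chordForm, supportAt, supportAt, show (u + π + (v + π)) / 2 = m + π by ring,
      show v + π - (m + π) = v - m by ring, ← hm]
    ring
  rw [e]
  have h3 : |(D.h (m + π) - D.h m) * cos (v - m)| ≤ 2 * D.ε * 1 := by
    rw [abs_mul]
    exact mul_le_mul h0 (abs_cos_le_one _) (abs_nonneg _) (by linarith [D.ε_nonneg])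
  have h4 : |(deriv D.h (m + π) - deriv D.h m) * sin (v - m)| ≤ 2 * D.ε * 1 := by
    rw [abs_mul]
    exact mul_le_mul h1 (abs_sin_le_one _) (abs_nonneg _) (by linarith [D.ε_nonneg])
  exact (abs_add_le _ _).trans (by linarith)

/-- The centrally reflected orbit almost solves the orbit equations. -/
theorem abs_chordForm_reflected_le (k : ℕ) (ψ : ℝ) :
    |chordForm D.h (D.Y (k + 2) ψ - π) (D.Y (k + 3) ψ - π) -
      chordForm D.h (D.Y (k + 4) ψ - π) (D.Y (k + 3) ψ - π)| ≤ 8 * D.ε := by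
  have h1 := D.abs_chordForm_add_pi_sub_le (D.Y (k + 2) ψ - π) (D.Y (k + 3) ψ - π)
  have h2 := D.abs_chordForm_add_pi_sub_le (D.Y (k + 4) ψ - π) (D.Y (k + 3) ψ - π)
  simp only [sub_add_cancel] at h1 h2
  have h3 := D.chordForm_eq (k + 2) ψ
  rw [show k + 2 + 1 = k + 3 by ring, show k + 2 + 2 = k + 4 by ring] at h3
  rw [h3] at h1
  rw [abs_le] at *
  constructor <;> linarith [h1.1, h1.2, h2.1, h2.2]

/-- An orbit that touches the reflected orbit from above. -/
theorem exists_touching (ψ : ℝ) : ∃ t j, D.Y (j + 4) t = D.Y (j + 4 + 2) ψ - π ∧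
    ∀ k, D.Y (k + 2) ψ - π ≤ D.Y k t := by
  choose s hs using fun k => D.surjective_Y k (D.Y (k + 2) ψ - π)
  -- `s k` is the parameter at which the k-th chord has the reflected normal angle. The largest of
  -- the four parameters gives an orbit above the reflected one, touching it at index `j`. The index
  -- is then raised by 4 so that a left neighbour exists in ℕ.
  obtain ⟨j, hj, hmax⟩ := Finset.exists_max_image (Finset.range 4) s ⟨0, by simp⟩
  refine ⟨s j, j, ?_, fun k => ?_⟩
  · rw [show j + 4 + 2 = j + 2 + 4 by ring, Y_add_four, Y_add_four, hs]
    ring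
  · induction k using Nat.strong_induction_on with
    | _ k ih =>
      rcases lt_or_ge k 4 with hk | hk
      · rw [← hs k]
        exact (D.strictMono_Y k).monotone (hmax k (by simpa using hk))
      · obtain ⟨i, rfl⟩ := Nat.exists_eq_add_of_le' hk
        have := ih i (by omega)
        rw [show i + 4 + 2 = i + 2 + 4 by ring, Y_add_four, Y_add_four]
        linarith

theorem tendsto_ε : Tendsto ε (small r B) (𝓝 0) := tendsto_comap

/-- The reflected orbit is close to an orbit. -/
theorem exists_orbit_close (hr : 0 < r) : ∃ C, 0 ≤ C ∧ ∀ᶠ D in small r B, ∀ ψ, ∃ t, ∀ k,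
    D.Y (k + 2) ψ - π ≤ D.Y k t ∧ D.Y k t ≤ D.Y (k + 2) ψ - π + C * D.ε := by
  rcases le_or_gt B 0 with hB | hB
  · exact ⟨0, le_rfl, Eventually.of_forall fun D => by linarith [D.curv 0, D.curv_le 0]⟩
  obtain ⟨c, hc, hδ⟩ := exists_angle_bound (B := B) hr
  rcases lt_or_ge π c with hcπ | hcπ
  · refine ⟨0, le_rfl, Eventually.of_forall fun D => ?_⟩
    linarith [(hδ D 0 0).1, (hδ D 0 0).2.1]
  have hs1 : 0 < r * sin (c / 2) / 2 := by
    have : 0 < sin (c / 2) := sin_pos_of_pos_of_lt_pi (by linarith) (by linarith)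
    positivity
  set β := r * sin (c / 2) / 2 with hβ
  have hY : ∀ (D : BilliardDatum r B) k ψ, 2 * c ≤ D.Y (k + 1) ψ - D.Y k ψ ∧
      D.Y (k + 1) ψ - D.Y k ψ ≤ 2 * π - 2 * c := by
    intro D k ψ
    have h1 := D.δ_succ_eq k ψ
    have h2 := hδ D (k + 1) ψ
    constructor <;> linarith [h2.1, h2.2.1]
  -- `C₁` is the residual 8 of the reflected orbit divided by the twist constant. In `C₂` a middle
  -- argument is also displaced by up to `C₁ * ε` in two chord forms with Lipschitz constant `2 *
  -- B`.
  set C₁ := 8 / β with hC₁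
  have hC₁0 : 0 < C₁ := by positivity
  set C₂ := (8 + 4 * B * C₁) / β with hC₂
  have hC₂0 : 0 < C₂ := by positivity
  -- Gaps between chord angles lie between 2c and 2π - 2c. Half of this margin is kept for the twist
  -- bound (a = c/2), the other half absorbs the displacement `C₁ * ε`.
  have hsmall : ∀ᶠ D in small r B, C₁ * D.ε < c := by
    have h3 : Tendsto (fun D => C₁ * D.ε) (small r B) (𝓝 0) := by
      simpa using tendsto_ε.const_mul C₁
    exact h3.eventually_lt_const hc
  refine ⟨C₁ + C₂, by positivity, ?_⟩
  filter_upwards [hsmall] with D hD ψ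
  obtain ⟨t, j, hj, ht⟩ := D.exists_touching ψ
  refine ⟨t, fun k => ⟨ht k, ?_⟩⟩
  set Δ : ℕ → ℝ := fun k => D.Y k t - (D.Y (k + 2) ψ - π) with hΔ
  have hΔ0 : ∀ k, 0 ≤ Δ k := fun k => sub_nonneg.2 (ht k)
  have hper : ∀ k, Δ k = Δ (k % 4) := by
    intro k
    induction k using Nat.strong_induction_on with
    | _ k ih =>
      rcases lt_or_ge k 4 with hk | hk
      · rw [Nat.mod_eq_of_lt hk]
      · obtain ⟨i, rfl⟩ := Nat.exists_eq_add_of_le' hk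
        rw [Nat.add_mod_right, ← ih i (by omega)]
        simp only [hΔ]
        rw [show i + 4 + 2 = i + 2 + 4 by ring, Y_add_four, Y_add_four]
        ring
  have hεC₁ : 0 ≤ C₁ * D.ε := mul_nonneg hC₁0.le D.ε_nonneg
  have hεC₂ : 0 ≤ C₂ * D.ε := mul_nonneg hC₂0.le D.ε_nonneg
  have d4 : Δ (j + 4) = 0 := by simp only [hΔ, hj, sub_self]
  -- At the touching index both sequences have the same middle argument. As the exact orbit is above
  -- on both sides, the two twist gains add up and are paid for by the residual.
  have step1 : β * (Δ (j + 3) + Δ (j + 5)) ≤ 8 * D.ε := by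
    have a1 := D.chordForm_left_sub_ge hr (a := c / 2) (u := D.Y (j + 5) ψ - π)
      (u' := D.Y (j + 3) t) (v := D.Y (j + 4) t) (by linarith) (ht (j + 3))
      (by linarith [(hY D (j + 3) t).1]) (by
        have := (hY D (j + 5) ψ).2
        rw [hj]
        linarith)
    have a2 := D.chordForm_right_sub_ge hr (a := c / 2) (w := D.Y (j + 7) ψ - π)
      (w' := D.Y (j + 5) t) (v := D.Y (j + 4) t) (by linarith) (ht (j + 5))
      (by
        have := (hY D (j + 6) ψ).1
        rw [hj]
        linarith) (by linarith [(hY D (j + 4) t).2])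
    have a3 := D.chordForm_eq (j + 3) t
    have a4 := (abs_le.1 (D.abs_chordForm_reflected_le (j + 3) ψ)).1
    norm_num only [show j + 3 + 1 = j + 4 by ring, show j + 3 + 2 = j + 5 by ring,
      show j + 3 + 3 = j + 6 by ring, show j + 3 + 4 = j + 7 by ring,
      show j + 4 + 2 = j + 6 by ring] at a3 a4 hj
    rw [← hj] at a4
    rw [a3] at a1
    rw [← hβ] at a1 a2
    simp only [hΔ]
    rw [show j + 3 + 2 = j + 5 by ring, show j + 5 + 2 = j + 7 by ring, mul_add]
    linarith
  have b3 : Δ (j + 3) ≤ C₁ * D.ε := by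
    rw [hC₁, div_mul_eq_mul_div, le_div_iff₀ hs1]
    have := mul_nonneg hs1.le (hΔ0 (j + 5))
    linarith
  have b5 : Δ (j + 5) ≤ C₁ * D.ε := by
    rw [hC₁, div_mul_eq_mul_div, le_div_iff₀ hs1]
    have := mul_nonneg hs1.le (hΔ0 (j + 3))
    linarith
  -- The remaining residue class mod 4 comes from the orbit equation one index further, where the
  -- middle arguments differ by `Δ (j + 5)`.
  have b6 : Δ (j + 6) ≤ C₂ * D.ε := by
    have hv : D.Y (j + 5) t = D.Y (j + 7) ψ - π + Δ (j + 5) := by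
      simp only [hΔ]
      ring_nf
    have a2 := D.chordForm_right_sub_ge hr (a := c / 2) (w := D.Y (j + 8) ψ - π)
      (w' := D.Y (j + 6) t) (v := D.Y (j + 7) ψ - π) (by linarith) (ht (j + 6))
      (by linarith [(hY D (j + 7) ψ).1]) (by linarith [(hY D (j + 5) t).2])
    have a3 := D.chordForm_eq (j + 4) t
    have a4 := (abs_le.1 (D.abs_chordForm_reflected_le (j + 4) ψ)).1
    have a5 := (abs_le.1 (D.abs_chordForm_sub_le (D.Y (j + 4) t) (D.Y (j + 7) ψ - π)
      (D.Y (j + 5) t))).1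
    have a6 := (abs_le.1 (D.abs_chordForm_sub_le (D.Y (j + 6) t) (D.Y (j + 7) ψ - π)
      (D.Y (j + 5) t))).2
    have e : |D.Y (j + 5) t - (D.Y (j + 7) ψ - π)| = Δ (j + 5) := by
      rw [hv, add_sub_cancel_left, abs_of_nonneg (hΔ0 _)]
    rw [e] at a5 a6
    norm_num only [show j + 4 + 1 = j + 5 by ring, show j + 4 + 2 = j + 6 by ring,
      show j + 4 + 3 = j + 7 by ring, show j + 4 + 4 = j + 8 by ring] at a3 a4 hj
    rw [← hj] at a4
    rw [← hβ] at a2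
    have a7 : 4 * B * Δ (j + 5) ≤ 4 * B * (C₁ * D.ε) := mul_le_mul_of_nonneg_left b5 (by positivity)
    have a8 : β * Δ (j + 6) ≤ 8 * D.ε + 4 * B * (C₁ * D.ε) := by
      simp only [hΔ] at a7 a5 a6 ⊢
      rw [show j + 6 + 2 = j + 8 by ring]
      linarith
    rw [hC₂, div_mul_eq_mul_div, le_div_iff₀ hs1]
    linarith
  have hk : Δ k ≤ (C₁ + C₂) * D.ε := by
    have hi : (k + 3 * j + 1) % 4 < 4 := Nat.mod_lt _ (by norm_num)
    have e : Δ k = Δ (j + (3 + (k + 3 * j + 1) % 4)) := by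
      rw [hper k, hper (j + _)]
      congr 1
      omega
    rw [e, add_mul]
    interval_cases (k + 3 * j + 1) % 4
    · linarith
    · rw [show j + (3 + 1) = j + 4 by ring, d4]
      positivity
    · norm_num only
      linarith
    · norm_num only
      linarith
  simp only [hΔ] at hk
  linarith

theorem ε_nonneg' : (0 : BilliardDatum r B → ℝ) ≤ ε := fun D => D.ε_nonneg

/-- The map σ(ψ) = X₂(ψ) - π is increasing, and the nearby orbit from t ≈ σ(ψ) shows σ(σ(ψ)) ≈ ψ.
For an increasing map |σ(ψ) - ψ| ≤ |σ(σ(ψ)) - ψ|, so t ≈ ψ. -/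
theorem uniformO_symm_zero (hr : 0 < r) (k : ℕ) :
    UniformO (small r B) 0 ε fun D x => Y (k + 2) D x - Y k D x - π := by
  obtain ⟨C, hC, h⟩ := exists_orbit_close (B := B) hr
  obtain ⟨L, hL, hX⟩ := (uniformO_X (B := B) (l := small r B) hr (n := 1) (by norm_num) 2).lipschitz
  obtain ⟨L', hL', hY⟩ := (uniformO_Y (B := B) (l := small r B) hr (n := 1) (by norm_num) k).lipschitz
  refine UniformO.zero_of (C := C + L' * (C + (1 + L) * C)) (Eventually.of_forall fun D =>
    ((D.continuous_Y _).sub (D.continuous_Y _)).sub continuous_const) (by positivity) ?_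
  filter_upwards [h, hX, hY] with D h hX hY ψ
  obtain ⟨t, ht⟩ := h ψ
  have hε : 0 ≤ C * D.ε := mul_nonneg hC D.ε_nonneg
  set G := D.X 2 ψ - π with hG
  have t1 : G ≤ t ∧ t ≤ G + C * D.ε := by
    have e1 := D.X_succ_eq 3 t
    have e2 := D.X_succ_eq 5 ψ
    have i3 := ht 3
    have i4 := ht 4
    norm_num only at e1 e2 i3 i4
    rw [X_add_four D 0, X_zero] at e1
    rw [X_add_four D 2] at e2
    constructor <;> linarith [i3.1, i3.2, i4.1, i4.2]
  have t2 : ψ + π ≤ D.X 2 t ∧ D.X 2 t ≤ ψ + π + C * D.ε := by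
    have e1 := D.X_succ_eq 1 t
    have e2 := D.X_succ_eq 3 ψ
    have i3 := ht 1
    have i4 := ht 2
    norm_num only at e1 e2 i3 i4
    rw [X_add_four D 0, X_zero] at e2
    constructor <;> linarith [i3.1, i3.2, i4.1, i4.2]
  have t3 : |D.X 2 t - D.X 2 G| ≤ L * (C * D.ε) := (hX t G).trans
    (mul_le_mul_of_nonneg_left (by rw [abs_of_nonneg (by linarith [t1.1])]; linarith [t1.2]) hL)
  have t4 : |G - ψ| ≤ (1 + L) * (C * D.ε) := by
    have t5 := abs_le.1 t3
    rcases le_total ψ G with hle | hle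
    · have := (D.strictMono_X 2).monotone hle
      rw [abs_of_nonneg (by linarith)]
      linarith [t5.1, t2.2]
    · have := (D.strictMono_X 2).monotone hle
      rw [abs_of_nonpos (by linarith)]
      linarith [t5.2, t2.1]
  have t6 : |t - ψ| ≤ C * D.ε + (1 + L) * (C * D.ε) := by
    have := abs_le.1 t4
    rw [abs_le]
    constructor <;> linarith [t1.1, t1.2]
  have t7 := abs_le.1 ((hY t ψ).trans (mul_le_mul_of_nonneg_left t6 hL'))
  have t8 := ht k
  rw [abs_le]
  constructor <;> linarith [t7.1, t7.2, t8.1, t8.2]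

end BilliardDatum

/-! ### Approximate central symmetry of the derivatives. -/

namespace BilliardDatum

variable {r B : ℝ} {n : ℕ}

theorem uniformO_near : UniformO (small r B) 5 ε fun D x => D.h (x + π) - D.h x :=
  ⟨2, by norm_num, Eventually.of_forall fun D => D.near⟩

theorem uniformO_deriv_near :
    UniformO (small r B) 4 ε fun D x => deriv D.h (x + π) - deriv D.h x :=
  uniformO_near.deriv.congr' fun D x => D.deriv_near x

theorem uniformO_deriv_deriv_near :
    UniformO (small r B) 3 ε fun D x => deriv (deriv D.h) (x + π) - deriv (deriv D.h) x :=
  uniformO_deriv_near.deriv.congr' fun D x =>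
    ((HasDerivAt.comp_add_const x π (D.smooth.hasDerivAt_deriv (x + π))).sub
      (D.smooth.hasDerivAt_deriv x)).deriv

theorem UniformO.symm_comp (hr : 0 < r) {k j : ℕ} (hn : n ≤ 11) {G : BilliardDatum r B → ℝ → ℝ}
    (hG : UniformO (small r B) (n + 1) 1 G)
    (hG' : UniformO (small r B) n ε fun D x => G D (x + π) - G D x)
    (hX : UniformO (small r B) n ε fun D x => X k D x - X j D x - π) :
    UniformO (small r B) n ε fun D x => G D (D.X k x) - G D (D.X j x) := by
  have h1 := uniformO_X (B := B) (l := small r B) hr hn k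
  have h2 := uniformO_X (B := B) (l := small r B) hr hn j
  have h3 : UniformO (small r B) n 1 fun D x => X j D x + π - x :=
    (h2.add (UniformO.const_one π)).congr' fun D x => by ring
  have h4 : UniformO (small r B) n ε fun D x => X k D x - (X j D x + π) :=
    hX.congr' fun D x => by ring
  exact ((UniformO.comp_sub ε_nonneg' hG h1 h3 h4).add (hG'.comp ε_nonneg' h2)).congr'
    fun D x => by ring

/-- The coefficients `b` and `A` are 2-periodic in `k` up to O(ε). Subtracting linearized equations
two indices apart leaves an almost homogeneous 2 × 2 system for `U 2 - U 0` and `U 3 - U 1`. The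
coefficients involve h'', so the C^5 defect of `h` counts in C^3; integrating `U` reaches C^4. -/
theorem uniformO_symm_succ (hr : 0 < r) (hn : n ≤ 3)
    (h : ∀ k, UniformO (small r B) n ε fun D x => Y (k + 2) D x - Y k D x - π) (k : ℕ) :
    UniformO (small r B) (n + 1) ε fun D x => Y (k + 2) D x - Y k D x - π := by
  have he := ε_nonneg' (r := r) (B := B)
  have hX : ∀ k, UniformO (small r B) n ε fun D x => X (k + 1 + 2) D x - X (k + 1) D x - π :=
    fun k => (((h k).add (h (k + 1))).const_mul (1 / 2)).congr' fun D x => by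
      rw [X_succ_eq, show k + 1 + 2 = k + 2 + 1 by ring, X_succ_eq]
      ring
  have hδ : ∀ k, UniformO (small r B) n ε fun D x => δ (k + 1 + 2) D x - δ (k + 1) D x :=
    fun k => (((h (k + 1)).sub (h k)).const_mul (1 / 2)).congr' fun D x => by
      rw [δ_succ_eq, show k + 1 + 2 = k + 2 + 1 by ring, δ_succ_eq]
      ring
  have hδ1 : ∀ k, UniformO (small r B) n 1 (δ k) := fun k => uniformO_δ hr (by omega) k
  have hX1 : ∀ k, UniformO (small r B) n 1 fun D x => X k D x - x :=
    fun k => uniformO_X hr (by omega) k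
  have hs : ∀ k, UniformO (small r B) n ε
      fun D x => sin (δ (k + 1 + 2) D x) - sin (δ (k + 1) D x) :=
    fun k => UniformO.comp_bdd_sub he UniformO.sin_const (hδ1 _) (hδ1 _) (hδ k)
  have hc : ∀ k, UniformO (small r B) n ε
      fun D x => cos (δ (k + 1 + 2) D x) - cos (δ (k + 1) D x) :=
    fun k => UniformO.comp_bdd_sub he UniformO.cos_const (hδ1 _) (hδ1 _) (hδ k)
  have hs1 : ∀ k, UniformO (small r B) n 1 fun D x => sin (δ k D x) :=
    fun k => UniformO.sin_const.comp_bdd (hδ1 k)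
  have hc1 : ∀ k, UniformO (small r B) n 1 fun D x => cos (δ k D x) :=
    fun k => UniformO.cos_const.comp_bdd (hδ1 k)
  have h0 := fun k => UniformO.symm_comp hr (by omega)
    (uniformO_h (by omega)) (uniformO_near.of_le (by omega)) (hX k)
  have h1 := fun k => UniformO.symm_comp hr (by omega)
    (uniformO_deriv_h (by omega)) (uniformO_deriv_near.of_le (by omega)) (hX k)
  have h2 := fun k => UniformO.symm_comp hr (by omega)
    (uniformO_deriv_deriv_h (by omega)) (uniformO_deriv_deriv_near.of_le hn) (hX k)
  have k0 := fun k => UniformO.comp (l := small r B) zero_le_one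
    (uniformO_h (n := n) (by omega)) (hX1 k)
  have k1 := fun k => UniformO.comp (l := small r B) zero_le_one
    (uniformO_deriv_h (n := n) (by omega)) (hX1 k)
  have k2 := fun k => UniformO.comp (l := small r B) zero_le_one
    (uniformO_deriv_deriv_h (n := n) (by omega)) (hX1 k)
  have t₀ : ∀ k, UniformO (small r B) n ε fun D x =>
      (D.h (D.X (k + 1 + 2) x) + deriv (deriv D.h) (D.X (k + 1 + 2) x)) *
        sin (D.δ (k + 1 + 2) x) -
      (D.h (D.X (k + 1) x) + deriv (deriv D.h) (D.X (k + 1) x)) * sin (D.δ (k + 1) x) :=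
    fun k => UniformO.mul_sub_mul he ((k0 _).add (k2 _)) (hs1 _)
      (((h0 k).add (h2 k)).congr' fun D x => by ring) (hs k)
  have hb : ∀ k, UniformO (small r B) n ε fun D x => b (k + 1 + 2) D x - b (k + 1) D x :=
    fun k => ((t₀ k).const_mul (1 / 2)).congr' fun D x => by
      rw [b, b]
      ring
  have hA : ∀ k, UniformO (small r B) n ε fun D x => A (k + 1 + 2) D x - A (k + 1) D x := by
    intro k
    have t₁ : ∀ k, UniformO (small r B) n ε fun D x =>
        (D.h (D.X (k + 1 + 2) x) - deriv (deriv D.h) (D.X (k + 1 + 2) x)) *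
          sin (D.δ (k + 1 + 2) x) -
        (D.h (D.X (k + 1) x) - deriv (deriv D.h) (D.X (k + 1) x)) * sin (D.δ (k + 1) x) :=
      fun k => UniformO.mul_sub_mul he ((k0 _).sub (k2 _)) (hs1 _)
        (((h0 k).sub (h2 k)).congr' fun D x => by ring) (hs k)
    have t₂ : ∀ k, UniformO (small r B) n ε fun D x =>
        deriv D.h (D.X (k + 1 + 2) x) * cos (D.δ (k + 1 + 2) x) -
        deriv D.h (D.X (k + 1) x) * cos (D.δ (k + 1) x) :=
      fun k => UniformO.mul_sub_mul he (k1 _) (hc1 _) (h1 k) (hc k)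
    exact (((((t₁ (k + 1)).add (t₁ k)).const_mul (1 / 2)).add (t₂ (k + 1))).sub (t₂ k)).congr'
      fun D x => by
        rw [A, A, show k + 1 + 2 + 1 = k + 1 + 1 + 2 by ring]
        ring
  have hU : ∀ k, UniformO (small r B) n 1 (U k) := fun k => uniformO_U hr (by omega) k
  have hA1 : ∀ k, UniformO (small r B) n 1 (A (k + 1)) :=
    fun k => uniformO_A (by omega) (uniformO_Y hr (by omega))
  have hb1 : ∀ k, UniformO (small r B) n 1 (b (k + 1)) :=
    fun k => uniformO_b (by omega) (uniformO_Y hr (by omega))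
  have hb31 := hb 0
  have hb42 := hb 1
  have hA31 := hA 0
  have hA42 := hA 1
  norm_num only at hb31 hb42 hA31 hA42
  have eqs : ∀ (D : BilliardDatum r B) x,
      (D.b 1 x * D.U 0 x + D.b 2 x * D.U 2 x = D.A 1 x * D.U 1 x ∧
      D.b 2 x * D.U 1 x + D.b 3 x * D.U 3 x = D.A 2 x * D.U 2 x) ∧
      (D.b 3 x * D.U 2 x + D.b 4 x * D.U 0 x = D.A 3 x * D.U 3 x ∧
      D.b 4 x * D.U 3 x + D.b 1 x * D.U 1 x = D.A 4 x * D.U 0 x) := by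
    intro D x
    have e3 := D.linear_eq 2 x hr
    have e4 := D.linear_eq 3 x hr
    norm_num only at e3 e4
    rw [U_add_four D 0] at e3
    rw [U_add_four D 1, U_add_four D 0, b_add_four D 1] at e4
    exact ⟨⟨D.linear_eq 0 x hr, D.linear_eq 1 x hr⟩, e3, e4⟩
  have E₁ : UniformO (small r B) n ε fun D x =>
      D.A 2 x * (D.U 2 x - D.U 0 x) - (D.b 3 x - D.b 2 x) * (D.U 3 x - D.U 1 x) :=
    (((hb31.mul_one' he (hU 1)).sub (hb42.mul_one' he (hU 3))).add
      (hA42.mul_one' he (hU 0))).congr' fun D x => by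
        obtain ⟨⟨-, e2⟩, -, e4⟩ := eqs D x
        linear_combination e2 - e4
  have E₂ : UniformO (small r B) n ε fun D x =>
      D.A 3 x * (D.U 3 x - D.U 1 x) - (D.b 3 x - D.b 2 x) * (D.U 2 x - D.U 0 x) :=
    (((hb42.add hb31).mul_one' he (hU 0)).sub (hA31.mul_one' he (hU 1))).congr' fun D x => by
      obtain ⟨⟨e1, -⟩, e3, -⟩ := eqs D x
      linear_combination e3 - e1
  have E₃ : UniformO (small r B) n ε fun D x =>
      D.A 2 x * (D.U 0 x + D.U 2 x) - (D.b 2 x + D.b 3 x) * (D.U 1 x + D.U 3 x) :=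
    (((hb42.mul_one' he (hU 3)).sub (hb31.mul_one' he (hU 1))).sub
      (hA42.mul_one' he (hU 0))).congr' fun D x => by
        obtain ⟨⟨-, e2⟩, -, e4⟩ := eqs D x
        linear_combination e2 + e4
  have E₄ : UniformO (small r B) n ε fun D x =>
      D.A 3 x * (D.U 1 x + D.U 3 x) - (D.b 2 x + D.b 3 x) * (D.U 0 x + D.U 2 x) :=
    (((hb42.sub hb31).mul_one' he (hU 0)).add (hA31.mul_one' he (hU 1))).congr' fun D x => by
      obtain ⟨⟨e1, -⟩, e3, -⟩ := eqs D x
      linear_combination e1 + e3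
  set Δ : BilliardDatum r B → ℝ → ℝ := fun D x =>
    D.A 2 x * D.A 3 x - (D.b 3 x - D.b 2 x) * (D.b 3 x - D.b 2 x) with hΔ
  have hΔ1 : UniformO (small r B) n 1 Δ :=
    ((hA1 1).mul11 (hA1 2)).sub (((hb1 2).sub (hb1 1)).mul11 ((hb1 2).sub (hb1 1)))
  have hsum : UniformPos (small r B) fun D x => D.U 0 x + D.U 2 x :=
    (uniformPos_U_zero hr).mono (Eventually.of_forall fun D x => by linarith [D.U_nonneg 2 x])
  -- The sums U₀ + U₂ and U₁ + U₃ almost solve the companion system `E₃`, `E₄`. As U₀ + U₂ is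
  -- bounded below, A₂A₃ ≈ (b₂ + b₃)², hence Δ ≈ (b₂ + b₃)² - (b₃ - b₂)² = 4 b₂ b₃.
  have hΔpos : UniformPos (small r B) Δ := by
    have p1 : UniformPos (small r B) fun D x => 4 * (D.b 2 x * D.b 3 x) :=
      UniformPos.mul ⟨4, four_pos, Eventually.of_forall fun _ _ => le_rfl⟩
        ((uniformPos_b hr 2).mul (uniformPos_b hr 3))
    obtain ⟨c, hc, hcs⟩ := hsum
    refine p1.of_sub (n := n) tendsto_ε ((((((hA1 2).one_mul' he E₃).add
      (((hb1 1).add (hb1 2)).one_mul' he E₄)).neg).div he ((hU 0).add (hU 2))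
        ⟨c, hc, hcs⟩).congr ?_)
    filter_upwards [hcs] with D hD x
    rw [div_eq_iff (hc.trans_le (hD x)).ne']
    simp only [hΔ]
    ring
  have w0 : UniformO (small r B) n ε fun D x => D.U 2 x - D.U 0 x := by
    refine ((((hA1 2).one_mul' he E₁).add (((hb1 2).sub (hb1 1)).one_mul' he E₂)).div he hΔ1
      hΔpos).congr ?_
    obtain ⟨c, hc, hcs⟩ := hΔpos
    filter_upwards [hcs] with D hD x
    rw [div_eq_iff (hc.trans_le (hD x)).ne']
    simp only [hΔ]
    ring
  have w1 : UniformO (small r B) n ε fun D x => D.U 3 x - D.U 1 x := by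
    refine ((((hA1 1).one_mul' he E₂).add (((hb1 2).sub (hb1 1)).one_mul' he E₁)).div he hΔ1
      hΔpos).congr ?_
    obtain ⟨c, hc, hcs⟩ := hΔpos
    filter_upwards [hcs] with D hD x
    rw [div_eq_iff (hc.trans_le (hD x)).ne']
    simp only [hΔ]
    ring
  have hw : ∀ k, UniformO (small r B) n ε fun D x => D.U (k + 2) x - D.U k x := by
    intro k
    induction k using Nat.strong_induction_on with
    | _ k ih =>
      rcases lt_or_ge k 2 with hk | hk
      · interval_cases k
        · exact w0
        · exact w1
      · obtain ⟨i, rfl⟩ := Nat.exists_eq_add_of_le' hk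
        refine (ih i (by omega)).neg.congr' fun D x => ?_
        rw [show i + 2 + 2 = i + 4 by ring, U_add_four]
        ring
  exact UniformO.succ_of_hasDerivAt he ((h k).of_le n.zero_le) (Eventually.of_forall fun D x =>
    ((D.hasDerivAt_Y (k + 2) x hr).sub (D.hasDerivAt_Y k x hr)).sub_const π) (hw k)

theorem uniformO_symm (hr : 0 < r) (hn : n ≤ 4) (k : ℕ) :
    UniformO (small r B) n ε fun D x => Y (k + 2) D x - Y k D x - π := by
  induction n generalizing k with
  | zero => exact uniformO_symm_zero hr k
  | succ n ih => exact uniformO_symm_succ hr (by omega) (ih (by omega)) k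

theorem uniformO_X_symm (hr : 0 < r) (hn : n ≤ 4) (k : ℕ) :
    UniformO (small r B) n ε fun D x => X (k + 2) D x - X k D x - π :=
  (((uniformO_symm hr hn (k + 3)).add (uniformO_symm hr hn (k + 4))).const_mul (1 / 2)).congr'
    fun D x => by
      have e1 := D.X_succ_eq (k + 3) x
      have e2 := D.X_succ_eq (k + 5) x
      rw [show k + 3 + 1 = k + 4 by ring, X_add_four] at e1
      rw [show k + 5 + 1 = k + 2 + 4 by ring, X_add_four] at e2
      rw [show k + 3 + 2 = k + 5 by ring, show k + 4 + 2 = k + 2 + 4 by ring]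
      linarith

theorem uniformO_δ_symm (hr : 0 < r) (hn : n ≤ 4) (k : ℕ) :
    UniformO (small r B) n ε fun D x => δ (k + 2) D x - δ k D x :=
  ((uniformO_symm hr hn k).sub (uniformO_X_symm hr hn k)).congr' fun D x => by
    rw [Y, Y]
    ring

/-- Consecutive vertices of the orbits are a quarter turn apart. -/
theorem uniformO_X_one (hr : 0 < r) (hn : n ≤ 4) :
    UniformO (small r B) n ε fun D x => X 1 D x - (x + π / 2) :=
  (((uniformO_δ_symm hr hn 0).add (uniformO_δ_symm hr hn 1)).const_mul (-1 / 2)).congr'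
    fun D x => by
      have h0 := D.X_succ 0 x
      have h1 := D.sum_δ x
      rw [Y, X_zero] at h0
      norm_num only at h0 ⊢
      linarith

theorem uniformO_δ_one (hr : 0 < r) (hn : n ≤ 4) :
    UniformO (small r B) n ε fun D x => δ 1 D x - (π / 2 - D.d x) :=
  (uniformO_X_one hr hn).congr' fun D x => by
    have h0 := D.X_succ 0 x
    rw [Y, X_zero] at h0
    change D.X 1 x = x + D.d x + D.δ 1 x at h0
    linarith

theorem uniformO_id_add (a : ℝ) :
    UniformO (small r B) n 1 fun (_ : BilliardDatum r B) x => x + a - x :=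
  (UniformO.const_one a).congr' fun D x => by ring

theorem uniformO_d_add_pi (hr : 0 < r) (hn : n ≤ 4) :
    UniformO (small r B) n ε fun D x => D.d (x + π) - D.d x :=
  ((uniformO_δ_symm hr hn 0).sub (UniformO.comp_sub ε_nonneg' (uniformO_d hr (by omega))
    (uniformO_X hr (by omega) 2) (uniformO_id_add π)
    ((uniformO_X_symm hr hn 0).congr' fun D x => by rw [X_zero]; ring))).congr' fun D x => by
      simp only [δ, X_zero]
      ring

theorem uniformO_d_add_pi_div_two (hr : 0 < r) (hn : n ≤ 4) :
    UniformO (small r B) n ε fun D x => D.d (x + π / 2) - (π / 2 - D.d x) :=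
  ((uniformO_δ_one hr hn).sub (UniformO.comp_sub ε_nonneg' (uniformO_d hr (by omega))
    (uniformO_X hr (by omega) 1) (uniformO_id_add (π / 2)) (uniformO_X_one hr hn))).congr'
    fun D x => by
      simp only [δ]
      ring

end BilliardDatum

/-! ### The relations between the support function and the loop angle. -/

namespace BilliardDatum

variable {r B : ℝ} {n : ℕ}

theorem uniformO_cos_δ_one (hr : 0 < r) (hn : n ≤ 4) :
    UniformO (small r B) n ε fun D x => cos (D.δ 1 x) - sin (D.d x) :=
  (UniformO.comp_bdd_sub ε_nonneg' UniformO.cos_const (uniformO_δ hr (by omega) 1)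
    ((UniformO.const_one (π / 2)).sub (uniformO_d hr (by omega)))
    (uniformO_δ_one hr hn)).congr' fun D x => by rw [cos_pi_div_two_sub]

theorem uniformO_sin_δ_one (hr : 0 < r) (hn : n ≤ 4) :
    UniformO (small r B) n ε fun D x => sin (D.δ 1 x) - cos (D.d x) :=
  (UniformO.comp_bdd_sub ε_nonneg' UniformO.sin_const (uniformO_δ hr (by omega) 1)
    ((UniformO.const_one (π / 2)).sub (uniformO_d hr (by omega)))
    (uniformO_δ_one hr hn)).congr' fun D x => by rw [sin_pi_div_two_sub]

theorem uniformPos_cos_d (hr : 0 < r) :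
    UniformPos (small r B) fun D x => cos (D.d x) :=
  (uniformPos_sin_δ hr 1).of_sub tendsto_ε (uniformO_sin_δ_one hr (Nat.zero_le 4))

theorem uniformO_sin_d (hr : 0 < r) (hn : n ≤ 11) :
    UniformO (small r B) n 1 fun D x => sin (D.d x) :=
  UniformO.sin_const.comp_bdd (uniformO_d hr hn)

theorem uniformO_cos_d (hr : 0 < r) (hn : n ≤ 11) :
    UniformO (small r B) n 1 fun D x => cos (D.d x) :=
  UniformO.cos_const.comp_bdd (uniformO_d hr hn)

theorem uniformO_h_quarter (hn : n ≤ 12) :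
    UniformO (small r B) n 1 fun D x => D.h (x + π / 2) :=
  (uniformO_h hn).comp zero_le_one (uniformO_id_add (π / 2))

/-- The equations of the first two chords, reduced to values at `x` and `x + π / 2`. -/
theorem uniformO_chords (hr : 0 < r) (hn : n ≤ 4) :
    (UniformO (small r B) n ε fun D x =>
      D.h x * cos (D.d x) - D.h (x + π / 2) * sin (D.d x)) ∧
    UniformO (small r B) n ε fun D x =>
      deriv D.h x * sin (D.d x) + deriv D.h (x + π / 2) * cos (D.d x) := by
  have he := ε_nonneg' (r := r) (B := B)
  have hX : ∀ k, UniformO (small r B) n 1 fun D x => X k D x - x :=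
    fun k => uniformO_X hr (by omega) k
  have hq : UniformO (small r B) n 1 fun (_ : BilliardDatum r B) x => x + π / 2 - x :=
    uniformO_id_add _
  have hX1 := uniformO_X_one (B := B) hr hn
  have hX2 := uniformO_X_symm (B := B) hr hn 0
  have hδ2 := uniformO_δ_symm (B := B) hr hn 0
  have hδ : ∀ k, UniformO (small r B) n 1 (δ k) := fun k => uniformO_δ hr (by omega) k
  have a1 := UniformO.comp_sub he (uniformO_h (by omega)) (hX 1) hq hX1
  have a2 := UniformO.comp_sub he (uniformO_deriv_h (by omega)) (hX 1) hq hX1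
  have a3 := UniformO.symm_comp hr (by omega) (uniformO_h (by omega))
    (uniformO_near.of_le (by omega)) hX2
  have a4 := UniformO.symm_comp hr (by omega) (uniformO_deriv_h (by omega))
    (uniformO_deriv_near.of_le hn) hX2
  have c3 := UniformO.comp_bdd_sub he UniformO.cos_const (hδ _) (hδ _) hδ2
  have c4 := UniformO.comp_bdd_sub he UniformO.sin_const (hδ _) (hδ _) hδ2
  have s1 := uniformO_sin_d (B := B) hr (show n ≤ 11 by omega)
  have s2 := uniformO_cos_d (B := B) hr (show n ≤ 11 by omega)
  have b1 : UniformO (small r B) n ε fun D x =>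
      D.h (D.X 1 x) * cos (D.δ 1 x) - D.h (x + π / 2) * sin (D.d x) :=
    UniformO.mul_sub_mul he ((uniformO_h (by omega)).comp zero_le_one (hX 1)) s1 a1
      (uniformO_cos_δ_one hr hn)
  have b2 : UniformO (small r B) n ε fun D x =>
      deriv D.h (D.X 1 x) * sin (D.δ 1 x) - deriv D.h (x + π / 2) * cos (D.d x) :=
    UniformO.mul_sub_mul he ((uniformO_deriv_h (by omega)).comp zero_le_one (hX 1)) s2 a2
      (uniformO_sin_δ_one hr hn)
  have b3 : UniformO (small r B) n ε fun D x =>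
      D.h (D.X 2 x) * cos (D.δ 2 x) - D.h x * cos (D.d x) :=
    UniformO.mul_sub_mul he ((uniformO_h (by omega)).comp zero_le_one (hX 2)) s2 a3 c3
  have b4 : UniformO (small r B) n ε fun D x =>
      deriv D.h (D.X 2 x) * sin (D.δ 2 x) - deriv D.h x * sin (D.d x) :=
    UniformO.mul_sub_mul he ((uniformO_deriv_h (by omega)).comp zero_le_one (hX 2)) s1 a4 c4
  have e : ∀ (D : BilliardDatum r B) x,
      D.h x * cos (D.d x) + deriv D.h x * sin (D.d x) =
        D.h (D.X 1 x) * cos (D.δ 1 x) - deriv D.h (D.X 1 x) * sin (D.δ 1 x) ∧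
      D.h (D.X 1 x) * cos (D.δ 1 x) + deriv D.h (D.X 1 x) * sin (D.δ 1 x) =
        D.h (D.X 2 x) * cos (D.δ 2 x) - deriv D.h (D.X 2 x) * sin (D.δ 2 x) := by
    intro D x
    have e0 := (D.chord 0 x).eq
    have e1 := (D.chord 1 x).eq
    have f0 : ∀ k, D.Y k x - D.X k x = D.δ k x := fun k => by
      rw [Y]
      ring
    have f1 : ∀ k, D.Y k x - D.X (k + 1) x = -D.δ (k + 1) x := fun k => by
      rw [X_succ]
      ring
    rw [supportAt, supportAt, f0, f1, cos_neg, sin_neg] at e0 e1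
    norm_num only at e0 e1
    change D.h x * cos (D.d x) + deriv D.h x * sin (D.d x) = _ at e0
    constructor <;> linarith
  -- Half the sum and half the difference of the two chord equations, with the values at the second
  -- and third vertices replaced by those at x + π/2 and x.
  refine ⟨(b1.sub ((b3.sub b4).const_mul (1 / 2))).congr' fun D x => ?_,
    (((b3.sub b4).const_mul (1 / 2)).sub b2).congr' fun D x => ?_⟩
  · linear_combination (1 / 2) * (e D x).2 - (1 / 2) * (e D x).1
  · linear_combination -(1 / 2) * (e D x).2 - (1 / 2) * (e D x).1

/-- With q = h(· + π/2), take q times the second relation of `uniformO_chords` plus h' times the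
first. The terms with sin d cancel, leaving cos d · (h h' + q q'), and cos d is bounded below. -/
theorem uniformO_h_mul_deriv (hr : 0 < r) (hn : n ≤ 4) :
    UniformO (small r B) n ε fun D x =>
      D.h x * deriv D.h x + D.h (x + π / 2) * deriv D.h (x + π / 2) := by
  have he := ε_nonneg' (r := r) (B := B)
  obtain ⟨h1, h2⟩ := uniformO_chords (B := B) hr hn
  have hc := uniformPos_cos_d (B := B) hr
  refine (((h2.mul_one' he (uniformO_h_quarter (by omega))).add
    (h1.mul_one' he (uniformO_deriv_h (by omega)))).div he (uniformO_cos_d hr (by omega))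
    hc).congr ?_
  obtain ⟨c, hc, hcs⟩ := hc
  filter_upwards [hcs] with D hD x
  rw [div_eq_iff (hc.trans_le (hD x)).ne']
  ring

theorem hasDerivAt_sq_add (D : BilliardDatum r B) (x : ℝ) :
    HasDerivAt (fun x => D.h x ^ 2 + D.h (x + π / 2) ^ 2 - D.R ^ 2)
      (2 * (D.h x * deriv D.h x + D.h (x + π / 2) * deriv D.h (x + π / 2))) x := by
  refine ((((D.smooth.hasDerivAt x).pow 2).add
    (((D.smooth.hasDerivAt (x + π / 2)).comp_add_const x (π / 2)).pow 2)).sub_const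
    _).congr_deriv ?_
  norm_num
  ring

/-- The diagonal of the rectangle formed by the tangent lines is almost constant. -/
theorem uniformO_sq_add (hr : 0 < r) (hn : n ≤ 4) :
    UniformO (small r B) n ε fun D x => D.h x ^ 2 + D.h (x + π / 2) ^ 2 - D.R ^ 2 := by
  have h1 := (uniformO_h_mul_deriv (B := B) hr (show 4 ≤ 4 by norm_num)).const_mul 2
  refine (UniformO.succ_of_hasDerivAt ε_nonneg' ?_
    (Eventually.of_forall fun D x => D.hasDerivAt_sq_add x) h1).of_le (by omega)
  obtain ⟨C, hC, hb⟩ := h1.bound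
  -- The first term bounds the value at 0 through `R_sq`, the second the growth over one period.
  refine UniformO.zero_of (C := 6 * |B| + C * (2 * π)) (Eventually.of_forall fun D =>
    continuous_iff_continuousAt.2 fun x => (D.hasDerivAt_sq_add x).continuousAt)
    (by positivity) ?_
  filter_upwards [hb] with D hD x
  have hper : Function.Periodic (fun x => D.h x ^ 2 + D.h (x + π / 2) ^ 2 - D.R ^ 2) (2 * π) := by
    intro x
    simp only [show x + 2 * π + π / 2 = x + π / 2 + 2 * π by ring, D.smooth.periodic _]
  obtain ⟨y, hy, e⟩ := hper.exists_mem_Ico₀ (by positivity) x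
  have h2 := Convex.norm_image_sub_le_of_norm_deriv_le (s := univ) (C := C * D.ε)
    (fun z _ => (D.hasDerivAt_sq_add z).differentiableAt)
    (fun z _ => by rw [(D.hasDerivAt_sq_add z).deriv]; exact hD z) convex_univ (mem_univ 0)
    (mem_univ y)
  rw [Real.norm_eq_abs, Real.norm_eq_abs, sub_zero, abs_of_nonneg hy.1, zero_add] at h2
  have h3 := D.R_sq
  have h4 : C * D.ε * y ≤ C * D.ε * (2 * π) :=
    mul_le_mul_of_nonneg_left hy.2.le (mul_nonneg hC D.ε_nonneg)
  have h5 : 6 * B * D.ε ≤ 6 * |B| * D.ε := by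
    have := mul_le_mul_of_nonneg_right (le_abs_self B) D.ε_nonneg
    linarith
  rw [e]
  have h6 := abs_add_le (D.h y ^ 2 + D.h (y + π / 2) ^ 2 - D.R ^ 2 -
    (D.h 0 ^ 2 + D.h (π / 2) ^ 2 - D.R ^ 2)) (D.h 0 ^ 2 + D.h (π / 2) ^ 2 - D.R ^ 2)
  rw [sub_add_cancel] at h6
  linarith

/-- The width h(x) + h(x + π) is at least 2r by comparison with the circle, and its two terms are
almost equal. -/
theorem uniformPos_h (hr : 0 < r) : UniformPos (small r B) fun D => D.h := by
  have h1 : UniformPos (small r B) fun D x => (1 / 2) * (D.h x + D.h (x + π)) := by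
    refine ⟨r, hr, Eventually.of_forall fun D x => ?_⟩
    have := D.le_support_sub (φ := x + π) (x := x) (by linarith) (by linarith [pi_pos])
    rw [supportAt_add_pi, supportAt_self, show x + π - x = π by ring, cos_pi] at this
    linarith
  exact h1.of_sub (n := 0) tendsto_ε (((uniformO_near.of_le (Nat.zero_le 5)).const_mul
    (1 / 2)).congr' fun D x => by ring)

theorem uniformPos_h_quarter (hr : 0 < r) :
    UniformPos (small r B) fun D x => D.h (x + π / 2) :=
  (uniformPos_h hr).comp fun _ x => x + π / 2

theorem uniformPos_R (hr : 0 < r) : UniformPos (small r B) fun D _ => D.R := by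
  have h1 : UniformPos (small r B) fun D x => D.h x * D.h x + D.h (x + π / 2) * D.h (x + π / 2) :=
    ((uniformPos_h hr).mul (uniformPos_h hr)).add
      ((uniformPos_h_quarter hr).mul (uniformPos_h_quarter hr))
  obtain ⟨c, hc, h2⟩ := h1.of_sub (n := 0) (G := fun D _ => D.R ^ 2) tendsto_ε
    ((uniformO_sq_add hr (Nat.zero_le 4)).congr' fun D x => by ring)
  refine ⟨√c, sqrt_pos.2 hc, h2.mono fun D hD x => ?_⟩
  exact sqrt_le_iff.2 ⟨D.R_nonneg, hD x⟩

theorem uniformO_R (hr : 0 < r) : UniformO (small r B) n 1 fun D _ => D.R := by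
  obtain ⟨C, hC, h1⟩ := ((((uniformO_h (B := B) (Nat.zero_le 12)).mul11
    (uniformO_h (Nat.zero_le 12))).add ((uniformO_h_quarter (Nat.zero_le 12)).mul11
    (uniformO_h_quarter (Nat.zero_le 12))))).bound
  obtain ⟨C', hC', h2⟩ := (uniformO_sq_add (B := B) hr (Nat.zero_le 4)).bound
  have h3 : Tendsto (fun D : BilliardDatum r B => C' * D.ε) (small r B) (𝓝 0) := by
    simpa using tendsto_ε.const_mul C'
  refine UniformO.const (C := C + 2) zero_le_one ?_
  filter_upwards [h1, h2, h3.eventually_lt_const one_pos] with D h1 h2 h3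
  have h4 := (abs_le.1 (h1 0)).2
  have h5 := (abs_le.1 (h2 0)).1
  rw [abs_of_nonneg D.R_nonneg]
  simp only [Pi.one_apply] at h4 ⊢
  nlinarith [sq_nonneg (D.R - 1)]

/-- Combining h cos d ≈ q sin d with h² + q² ≈ R² gives h² ≈ R² sin² d; divide by h + R sin d, which
is bounded below. -/
theorem uniformO_h_sub (hr : 0 < r) (hn : n ≤ 4) :
    UniformO (small r B) n ε fun D x => D.h x - D.R * sin (D.d x) := by
  have he := ε_nonneg' (r := r) (B := B)
  have hR := uniformO_R (B := B) (n := n) hr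
  have hs := uniformO_sin_d (B := B) hr (show n ≤ 11 by omega)
  have hc := uniformO_cos_d (B := B) hr (show n ≤ 11 by omega)
  have h0 := uniformO_h (l := small r B) (show n ≤ 12 by omega)
  have h1 := uniformO_h_quarter (r := r) (B := B) (show n ≤ 12 by omega)
  have hp : UniformPos (small r B) fun D x => D.h x + D.R * sin (D.d x) :=
    (uniformPos_h hr).add ((uniformPos_R hr).mul (uniformPos_sin_δ hr 0))
  refine ((((uniformO_chords hr hn).1.mul_one' he ((h0.mul11 hc).add (h1.mul11 hs))).add
    ((uniformO_sq_add hr hn).mul_one' he (hs.mul11 hs))).div he (h0.add (hR.mul11 hs))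
    hp).congr ?_
  obtain ⟨c, hc, hcs⟩ := hp
  filter_upwards [hcs] with D hD x
  rw [div_eq_iff (hc.trans_le (hD x)).ne']
  linear_combination (D.h x) ^ 2 * sin_sq_add_cos_sq (D.d x)

theorem uniformO_h_quarter_sub (hr : 0 < r) (hn : n ≤ 4) :
    UniformO (small r B) n ε fun D x => D.h (x + π / 2) - D.R * cos (D.d x) := by
  have he := ε_nonneg' (r := r) (B := B)
  have hR := uniformO_R (B := B) (n := n) hr
  have hs := uniformO_sin_d (B := B) hr (show n ≤ 11 by omega)
  have hc := uniformO_cos_d (B := B) hr (show n ≤ 11 by omega)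
  have h0 := uniformO_h (l := small r B) (show n ≤ 12 by omega)
  have h1 := uniformO_h_quarter (r := r) (B := B) (show n ≤ 12 by omega)
  have hp : UniformPos (small r B) fun D x => D.h (x + π / 2) + D.R * cos (D.d x) :=
    (uniformPos_h_quarter hr).add ((uniformPos_R hr).mul (uniformPos_cos_d hr))
  refine (((uniformO_sq_add hr hn).mul_one' he (hc.mul11 hc)).sub
    ((uniformO_chords hr hn).1.mul_one' he ((h0.mul11 hc).add (h1.mul11 hs))) |>.div he
    (h1.add (hR.mul11 hc)) hp).congr ?_
  obtain ⟨c, hc, hcs⟩ := hp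
  filter_upwards [hcs] with D hD x
  rw [div_eq_iff (hc.trans_le (hD x)).ne']
  linear_combination (D.h (x + π / 2)) ^ 2 * sin_sq_add_cos_sq (D.d x)

theorem hasDerivAt_d (hr : 0 < r) (D : BilliardDatum r B) (x : ℝ) :
    HasDerivAt D.d (D.U 0 x - 1) x := by
  have := (D.hasDerivAt_Y 0 x hr).sub (hasDerivAt_id x)
  rwa [show D.Y 0 - id = D.d from funext fun x => by simp [Y, δ]] at this

/-- The first chord stays away from the origin. -/
theorem uniformPos_support_chord (hr : 0 < r) :
    UniformPos (small r B) fun D x => supportAt D.h x (D.Y 0 x) := by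
  have he := ε_nonneg' (r := r) (B := B)
  -- By h ≈ R sin d in C^1, the support number h cos d + h' sin d of the chord is close to R sin d
  -- cos d (1 + d'), and 1 + d' = `U 0`.
  have hp : UniformPos (small r B) fun D x =>
      D.R * (sin (D.d x) * (cos (D.d x) * D.U 0 x)) :=
    (uniformPos_R hr).mul ((uniformPos_sin_δ hr 0).mul
      ((uniformPos_cos_d hr).mul (uniformPos_U_zero hr)))
  have h1 := uniformO_h_sub (B := B) hr (show 1 ≤ 4 by norm_num)
  refine hp.of_sub (n := 0) tendsto_ε ((((h1.of_le zero_le_one).mul_one' he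
    (uniformO_cos_d hr (Nat.zero_le _))).add (h1.deriv.mul_one' he
    (uniformO_sin_d hr (Nat.zero_le _)))).neg.congr' fun D x => ?_)
  have h2 := ((D.smooth.hasDerivAt x).sub (((D.hasDerivAt_d hr x).sin).const_mul D.R)).deriv
  change deriv (fun x => D.h x - D.R * sin (D.d x)) x = _ at h2
  have h3 : D.Y 0 x - x = D.d x := by simp [Y, δ]
  rw [h2, supportAt, h3]
  ring

end BilliardDatum

/-! ### The parallelogram and the rectangle. -/

/-- The point with outer normal angle `x` of the convex curve with support function `h`. -/
noncomputable def curvePoint (h : ℝ → ℝ) (x : ℝ) : Plane :=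
  !₂[h x * cos x - deriv h x * sin x, h x * sin x + deriv h x * cos x]

/-- The intersection point of the lines with normal angles `a`, `b` and support numbers
`p`, `q`. -/
noncomputable def lineMeet (a b p q : ℝ) : Plane :=
  !₂[(p * sin b - q * sin a) / sin (b - a), (q * cos a - p * cos b) / sin (b - a)]

/-- The parallelogram with center `0` and consecutive vertices `v`, `w`. -/
def centralParallelogram (v w : Plane) : Fin 4 → Plane := ![v, w, -v, -w]

theorem mem_tangentLine_iff {Ω : Set Plane} {a : ℝ} {v : Plane} :
    v ∈ tangentLine Ω a ↔ normalForm v a = supportFn Ω a := by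
  rw [← supportAt_self (supportFn Ω) a, ← normalForm_bdryPoint, ← sub_eq_zero, ← normalForm_sub]
  constructor
  · rintro ⟨s, rfl⟩
    rw [add_sub_cancel_left, normalForm_smul_unitTangent, sub_self, sin_zero, mul_zero]
  · intro h
    obtain ⟨s, hs⟩ := exists_smul_unitTangent h
    exact ⟨s, by rw [← hs, add_sub_cancel]⟩

theorem tangentLine_inter {Ω : Set Plane} {a b : ℝ} (h : sin (b - a) ≠ 0) :
    tangentLine Ω a ∩ tangentLine Ω b = {lineMeet a b (supportFn Ω a) (supportFn Ω b)} := by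
  ext v
  rw [mem_inter_iff, mem_tangentLine_iff, mem_tangentLine_iff, mem_singleton_iff]
  have hd := sin_sub b a
  constructor
  · rintro ⟨h1, h2⟩
    unfold normalForm at h1 h2
    ext i
    fin_cases i
    · simp only [lineMeet, Fin.zero_eta, PiLp.toLp_apply, Matrix.cons_val_zero]
      rw [eq_div_iff h, hd]
      linear_combination sin b * h1 - sin a * h2
    · simp only [lineMeet, Fin.mk_one, PiLp.toLp_apply, Matrix.cons_val_one,
        Matrix.cons_val_fin_one]
      rw [eq_div_iff h, hd]
      linear_combination cos a * h2 - cos b * h1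
  · rintro rfl
    simp only [normalForm, lineMeet, PiLp.toLp_apply, Matrix.cons_val_zero, Matrix.cons_val_one,
      Matrix.cons_val_fin_one]
    constructor
    · rw [div_mul_eq_mul_div, div_mul_eq_mul_div, ← add_div, div_eq_iff h, hd]
      ring
    · rw [div_mul_eq_mul_div, div_mul_eq_mul_div, ← add_div, div_eq_iff h, hd]
      ring

theorem isParallelogram_centralParallelogram {v w : Plane} (h : v 0 * w 1 - v 1 * w 0 ≠ 0) :
    IsParallelogram (centralParallelogram v w) := by
  refine ⟨by simp [centralParallelogram], ?_⟩
  rw [affineIndependent_iff_linearIndependent_vsub ℝ _ (0 : Fin 3)]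
  have e : (fun i : {x : Fin 3 // x ≠ 0} => (![centralParallelogram v w 0,
      centralParallelogram v w 1, centralParallelogram v w 2] i -ᵥ
      ![centralParallelogram v w 0, centralParallelogram v w 1,
      centralParallelogram v w 2] 0 : Plane)) =
      ![w - v, -v - v] ∘ (finSuccAboveEquiv (0 : Fin 3)).symm := by
    rw [← Equiv.comp_symm_eq, Equiv.symm_symm]
    funext i
    fin_cases i <;> simp [centralParallelogram, finSuccAboveEquiv]
  rw [e, linearIndependent_equiv, LinearIndependent.pair_iff]
  intro s t hst
  have h0 := congrArg (fun u : Plane => u 0) hst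
  have h1 := congrArg (fun u : Plane => u 1) hst
  simp at h0 h1
  have hs : s = 0 := by
    refine (mul_eq_zero.1 (?_ : s * (v 0 * w 1 - v 1 * w 0) = 0)).resolve_right h
    linear_combination v 0 * h1 - v 1 * h0
  subst hs
  refine ⟨rfl, ?_⟩
  by_contra ht
  apply h
  simp [ht] at h0 h1
  have e0 : v 0 = 0 := by linarith
  have e1 : v 1 = 0 := by linarith
  rw [e0, e1]
  ring

theorem CBound.of_coords {n : ℕ} {b : ℝ} {f : ℝ → Plane} (h0 : CBound n b fun x => f x 0)
    (h1 : CBound n b fun x => f x 1) : CBound n (2 * b) f := by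
  have e : f = fun x => f x 0 • (!₂[1, 0] : Plane) + f x 1 • (!₂[0, 1] : Plane) := by
    funext x
    ext i
    fin_cases i <;> simp
  have d0 : ∀ v : Plane, ContDiff ℝ n fun x => f x 0 • v := fun v => h0.1.smul contDiff_const
  have d1 : ∀ v : Plane, ContDiff ℝ n fun x => f x 1 • v := fun v => h1.1.smul contDiff_const
  refine ⟨by rw [e]; exact (d0 _).add (d1 _), fun k hk x => ?_⟩
  have hk' : (k : WithTop ℕ∞) ≤ n := by exact_mod_cast hk
  rw [e]
  rw [iteratedDeriv_fun_add ((d0 _).of_le hk').contDiffAt ((d1 _).of_le hk').contDiffAt]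
  have s0 := iteratedDeriv_smul_const (h0.1.of_le hk').contDiffAt (!₂[1, 0] : Plane) (x := x)
  have s1 := iteratedDeriv_smul_const (h1.1.of_le hk').contDiffAt (!₂[0, 1] : Plane) (x := x)
  rw [s0, s1, two_mul]
  refine (norm_add_le _ _).trans (add_le_add ?_ ?_)
  · rw [norm_smul, show ‖(!₂[1, 0] : Plane)‖ = 1 by simp [EuclideanSpace.norm_eq], mul_one]
    exact h0.2 k hk x
  · rw [norm_smul, show ‖(!₂[0, 1] : Plane)‖ = 1 by simp [EuclideanSpace.norm_eq], mul_one]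
    exact h1.2 k hk x

/-- A finite set of uniform estimates for plane curves holds with one constant. -/
theorem UniformO.exists_plane_bound {ι κ : Type*} [Fintype κ] {l : Filter ι} {n : ℕ} {e : ι → ℝ}
    (he : 0 ≤ e) {F : ι → κ → ℝ → Plane}
    (h : ∀ (k : κ) (j : Fin 2), UniformO l n e fun i x => F i k x j) :
    ∃ C, 0 ≤ C ∧ ∀ᶠ i in l, ∀ k, CBound n (C * e i) (F i k) := by
  choose C hC hb using h
  refine ⟨∑ k, 2 * (C k 0 + C k 1), Finset.sum_nonneg fun k _ => by linarith [hC k 0, hC k 1], ?_⟩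
  filter_upwards [eventually_all.2 fun k => (hb k 0).and (hb k 1)] with i hi k
  have h0 := mul_nonneg (hC k 0) (he i)
  have h1 := mul_nonneg (hC k 1) (he i)
  refine (CBound.of_coords ((hi k).1.mono (B' := (C k 0 + C k 1) * e i) le_rfl ?_)
    ((hi k).2.mono le_rfl ?_)).mono le_rfl ?_
  · rw [add_mul]
    linarith
  · rw [add_mul]
    linarith
  · rw [← mul_assoc]
    refine mul_le_mul_of_nonneg_right ?_ (he i)
    exact Finset.single_le_sum (f := fun k => 2 * (C k 0 + C k 1))
      (fun k _ => by linarith [hC k 0, hC k 1]) (Finset.mem_univ k)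

/-- The rectangle with diagonals of equal length, center `0` and sides in the directions with
angles `x` and `x + π / 2`. -/
noncomputable def centralRectangle (p q x : ℝ) : Fin 4 → Plane :=
  centralParallelogram !₂[p * cos x - q * sin x, q * cos x + p * sin x]
    !₂[-(q * sin x) - p * cos x, q * cos x - p * sin x]

theorem isRectangle_centralRectangle {p q : ℝ} (hp : 0 < p) (hq : 0 < q) (x : ℝ) :
    IsRectangle (centralRectangle p q x) := by
  have hx := sin_sq_add_cos_sq x
  refine ⟨isParallelogram_centralParallelogram ?_, ?_⟩
  · simp only [Matrix.cons_val_zero, Matrix.cons_val_one, Matrix.cons_val_fin_one]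
    have : 0 < p * q := mul_pos hp hq
    refine (lt_of_lt_of_eq (mul_pos two_pos this) ?_).ne'
    linear_combination -2 * p * q * hx
  · simp [centralRectangle, centralParallelogram, PiLp.inner_apply, Fin.sum_univ_two]
    ring

namespace BilliardDatum

variable {r B : ℝ} {n : ℕ}

theorem uniformO_zero : UniformO (small r B) n ε fun _ _ => 0 :=
  UniformO.const (C := 0) ε_nonneg' (by simp)

theorem uniformO_X_quarter (hr : 0 < r) (hn : n ≤ 4) (k : ℕ) :
    UniformO (small r B) n ε fun D x => X k D x - (x + k * (π / 2)) := by
  induction k using Nat.twoStepInduction with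
  | zero => exact uniformO_zero.congr' fun D x => by simp
  | one => exact (uniformO_X_one hr hn).congr' fun D x => by simp
  | more k ih _ =>
    refine (ih.add (uniformO_X_symm hr hn k)).congr' fun D x => ?_
    push_cast
    ring

/-- Vertices are a quarter turn apart and `h` is almost π-periodic, so the support numbers alternate
between two functions, according to the parity of `k`. -/
theorem uniformO_h_X (hr : 0 < r) (hn : n ≤ 4) (k : ℕ) :
    UniformO (small r B) n ε fun D x => D.h (D.X k x) - D.h (x + (k % 2 : ℕ) * (π / 2)) := by
  induction k using Nat.twoStepInduction with
  | zero => exact uniformO_zero.congr' fun D x => by simp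
  | one => exact (UniformO.comp_sub ε_nonneg' (uniformO_h (by omega)) (uniformO_X hr (by omega) 1)
      (uniformO_id_add _) (uniformO_X_one hr hn)).congr' fun D x => by simp
  | more k ih _ =>
    refine (ih.add (UniformO.symm_comp hr (by omega) (uniformO_h (by omega))
      (uniformO_near.of_le (by omega)) (uniformO_X_symm hr hn k))).congr' fun D x => ?_
    rw [Nat.add_mod_right]
    ring

theorem uniformO_sin_X (hr : 0 < r) (hn : n ≤ 4) (k : ℕ) :
    UniformO (small r B) n ε fun D x => sin (D.X k x) - sin (x + k * (π / 2)) :=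
  UniformO.comp_sub ε_nonneg' UniformO.sin_const (uniformO_X hr (by omega) k)
    (uniformO_id_add _) (uniformO_X_quarter hr hn k)

theorem uniformO_cos_X (hr : 0 < r) (hn : n ≤ 4) (k : ℕ) :
    UniformO (small r B) n ε fun D x => cos (D.X k x) - cos (x + k * (π / 2)) :=
  UniformO.comp_sub ε_nonneg' UniformO.cos_const (uniformO_X hr (by omega) k)
    (uniformO_id_add _) (uniformO_X_quarter hr hn k)

theorem uniformO_X_succ_sub (hr : 0 < r) (hn : n ≤ 11) (k : ℕ) :
    UniformO (small r B) n 1 fun D x => D.X (k + 1) x - D.X k x :=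
  ((uniformO_X hr hn (k + 1)).sub (uniformO_X hr hn k)).congr' fun D x => by ring

theorem uniformO_sin_X_sub (hr : 0 < r) (hn : n ≤ 4) (k : ℕ) :
    UniformO (small r B) n ε fun D x => 1 - sin (D.X (k + 1) x - D.X k x) :=
  (UniformO.comp_bdd_sub ε_nonneg' UniformO.sin_const (uniformO_X_succ_sub hr (by omega) k)
    (UniformO.const_one (π / 2)) (((uniformO_X_quarter hr hn (k + 1)).sub
    (uniformO_X_quarter hr hn k)).congr' fun D x => by push_cast; ring)).neg.congr'
    fun D x => by
      rw [sin_pi_div_two]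
      ring

theorem uniformPos_sin_X_sub (hr : 0 < r) (k : ℕ) :
    UniformPos (small r B) fun D x => sin (D.X (k + 1) x - D.X k x) :=
  UniformPos.of_sub (n := 0) (F := fun _ _ => 1)
    ⟨1, one_pos, Eventually.of_forall fun _ _ => le_rfl⟩ tendsto_ε
    (uniformO_sin_X_sub hr (Nat.zero_le 4) k)

/-- If `N` is close to `N'`, so is `N / sin (X (k + 1) - X k)`. -/
theorem uniformO_div_sin_sub (hr : 0 < r) (hn : n ≤ 4) (k : ℕ)
    {N N' : BilliardDatum r B → ℝ → ℝ} (hN' : UniformO (small r B) n 1 N')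
    (hN : UniformO (small r B) n ε fun D x => N D x - N' D x) :
    UniformO (small r B) n ε fun D x => N D x / sin (D.X (k + 1) x - D.X k x) - N' D x := by
  have hp := uniformPos_sin_X_sub (B := B) hr k
  refine ((hN.add (hN'.one_mul' ε_nonneg' (uniformO_sin_X_sub hr hn k))).div ε_nonneg'
    (UniformO.sin_const.comp_bdd (uniformO_X_succ_sub hr (by omega) k)) hp).congr ?_
  obtain ⟨c, hc, hcs⟩ := hp
  filter_upwards [hcs] with D hD x
  have := (hc.trans_le (hD x)).ne'
  field_simp
  ring

/-- The intersections of consecutive tangent lines are close to the vertices of a rectangle. -/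
theorem uniformO_lineMeet (hr : 0 < r) (hn : n ≤ 4) (i : Fin 4) (j : Fin 2) :
    UniformO (small r B) n ε fun D x =>
      (lineMeet (D.X i x) (D.X (i + 1) x) (D.h (D.X i x)) (D.h (D.X (i + 1) x)) -
        centralRectangle (D.h x) (D.h (x + π / 2)) x i) j := by
  have he := ε_nonneg' (r := r) (B := B)
  have hh := fun k => uniformO_h_X (B := B) hr hn k
  have hs := fun k => uniformO_sin_X (B := B) hr hn k
  have hc := fun k => uniformO_cos_X (B := B) hr hn k
  have hh1 : ∀ a, UniformO (small r B) n 1 fun D x => D.h (x + a) :=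
    fun a => (uniformO_h (by omega)).comp zero_le_one (uniformO_id_add a)
  have hhX : ∀ k, UniformO (small r B) n 1 fun D x => D.h (D.X k x) :=
    fun k => (uniformO_h (by omega)).comp zero_le_one (uniformO_X hr (by omega) k)
  have hs1 : ∀ a, UniformO (small r B) n 1 fun _ x => sin (x + a) :=
    fun a => UniformO.sin_const.comp zero_le_one (uniformO_id_add a)
  have hc1 : ∀ a, UniformO (small r B) n 1 fun _ x => cos (x + a) :=
    fun a => UniformO.cos_const.comp zero_le_one (uniformO_id_add a)
  have e3 : ∀ x : ℝ, x + 3 * (π / 2) = x + π + π / 2 := fun x => by ring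
  have e4 : ∀ x : ℝ, x + 4 * (π / 2) = x + 2 * π := fun x => by ring
  have e2 : ∀ x : ℝ, x + 2 * (π / 2) = x + π := fun x => by ring
  have hsin : ∀ k l, UniformO (small r B) n ε fun D x =>
      D.h (D.X k x) * sin (D.X l x) -
        D.h (x + (k % 2 : ℕ) * (π / 2)) * sin (x + l * (π / 2)) := fun k l =>
    UniformO.mul_sub_mul he (hhX k) (hs1 _) (hh k) (hs l)
  have hcos : ∀ k l, UniformO (small r B) n ε fun D x =>
      D.h (D.X k x) * cos (D.X l x) -
        D.h (x + (k % 2 : ℕ) * (π / 2)) * cos (x + l * (π / 2)) := fun k l =>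
    UniformO.mul_sub_mul he (hhX k) (hc1 _) (hh k) (hc l)
  have h0 := uniformO_div_sin_sub hr hn i
    (((hh1 _).mul11 (hs1 _)).sub ((hh1 _).mul11 (hs1 _)))
    (((hsin i (i + 1)).sub (hsin (i + 1) i)).congr' fun D x => sub_sub_sub_comm _ _ _ _)
  have h1 := uniformO_div_sin_sub hr hn i
    (((hh1 _).mul11 (hc1 _)).sub ((hh1 _).mul11 (hc1 _)))
    (((hcos (i + 1) i).sub (hcos i (i + 1))).congr' fun D x => sub_sub_sub_comm _ _ _ _)
  fin_cases j
  · refine h0.congr' fun D x => ?_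
    fin_cases i <;> simp [lineMeet, centralRectangle, centralParallelogram, e2, e3, e4,
      sin_add_pi_div_two] <;> ring
  · refine h1.congr' fun D x => ?_
    fin_cases i <;> simp [lineMeet, centralRectangle, centralParallelogram, e2, e3, e4,
      cos_add_pi_div_two] <;> ring

theorem UniformO.antisymm_comp (hr : 0 < r) {k : ℕ} (hn : n ≤ 4) {G : BilliardDatum r B → ℝ → ℝ}
    (hG : UniformO (small r B) (n + 1) 1 G)
    (hG' : UniformO (small r B) n ε fun D x => G D (x + π) + G D x) :
    UniformO (small r B) n ε fun D x => G D (D.X (k + 2) x) + G D (D.X k x) := by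
  have h2 := uniformO_X (B := B) (l := small r B) hr (show n ≤ 11 by omega) k
  have h3 : UniformO (small r B) n 1 fun D x => X k D x + π - x :=
    (h2.add (UniformO.const_one π)).congr' fun D x => by ring
  have h4 : UniformO (small r B) n ε fun D x => X (k + 2) D x - (X k D x + π) :=
    (uniformO_X_symm hr hn k).congr' fun D x => by ring
  exact ((UniformO.comp_sub ε_nonneg' hG (uniformO_X hr (by omega) _) h3 h4).add
    (hG'.comp ε_nonneg' h2)).congr' fun D x => by ring

theorem uniformO_curvePoint_symm (hr : 0 < r) (hn : n ≤ 4) (k : ℕ) (j : Fin 2) :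
    UniformO (small r B) n ε fun D x =>
      curvePoint D.h (D.X (k + 2) x) j + curvePoint D.h (D.X k x) j := by
  have he := ε_nonneg' (r := r) (B := B)
  have h0 := uniformO_h (l := small r B) (show n + 1 ≤ 12 by omega)
  have h1 := uniformO_deriv_h (l := small r B) (show n + 1 ≤ 11 by omega)
  have d0 := uniformO_near (r := r) (B := B).of_le (show n ≤ 5 by omega)
  have d1 := uniformO_deriv_near (r := r) (B := B).of_le hn
  refine UniformO.antisymm_comp hr hn (G := fun D x => curvePoint D.h x j) ?_ ?_
  · fin_cases j
    · exact (h0.mul11 UniformO.cos_const).sub (h1.mul11 UniformO.sin_const)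
    · exact (h0.mul11 UniformO.sin_const).add (h1.mul11 UniformO.cos_const)
  · fin_cases j
    · refine ((d1.mul_one' he UniformO.sin_const).sub (d0.mul_one' he UniformO.cos_const)).congr'
        fun D x => ?_
      simp [curvePoint]
      ring
    · refine ((d0.mul_one' he UniformO.sin_const).add (d1.mul_one' he UniformO.cos_const)).neg.congr'
        fun D x => ?_
      simp [curvePoint]
      ring

/-- The vertices of the orbits are close to the vertices of a parallelogram. -/
theorem uniformO_curvePoint (hr : 0 < r) (hn : n ≤ 4) (i : Fin 4) (j : Fin 2) :
    UniformO (small r B) n ε fun D x => (curvePoint D.h (D.X i x) -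
      centralParallelogram (curvePoint D.h x) (curvePoint D.h (D.X 1 x)) i) j := by
  fin_cases i
  · exact uniformO_zero.congr' fun D x => by simp [centralParallelogram]
  · exact uniformO_zero.congr' fun D x => by simp [centralParallelogram]
  · exact (uniformO_curvePoint_symm hr hn 0 j).congr' fun D x => by simp [centralParallelogram]
  · exact (uniformO_curvePoint_symm hr hn 1 j).congr' fun D x => by simp [centralParallelogram]

end BilliardDatum

/-! ### From uniform estimates back to tables. -/

namespace BilliardDatum

variable {r B : ℝ}

/-- The conclusions for a datum `D`, with the constant `C`. -/
structure Estimates (C : ℝ) (D : BilliardDatum r B) : Prop where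
  angle_pi : CBound 3 (C * D.ε) fun x => D.d (x + π) - D.d x
  angle_quarter : CBound 2 (C * D.ε) fun x => D.d (x + π / 2) - (π / 2 - D.d x)
  vertex : ∀ i : Fin 4, CBound 2 (C * D.ε) fun x => curvePoint D.h (D.X i x) -
    centralParallelogram (curvePoint D.h x) (curvePoint D.h (D.X 1 x)) i
  tangent : ∀ i : Fin 4, CBound 2 (C * D.ε) fun x =>
    lineMeet (D.X i x) (D.X (i + 1) x) (D.h (D.X i x)) (D.h (D.X (i + 1) x)) -
      centralRectangle (D.h x) (D.h (x + π / 2)) x i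
  sq_add : CBound 3 (C * D.ε) fun x => D.h x ^ 2 + D.h (x + π / 2) ^ 2 - D.R ^ 2
  sin_angle : CBound 2 (C * D.ε) fun x => D.h x - D.R * sin (D.d x)
  cos_angle : CBound 2 (C * D.ε) fun x => D.h (x + π / 2) - D.R * cos (D.d x)
  support_pos : ∀ x, 0 < D.h x
  support_chord_pos : ∀ x, 0 < supportAt D.h x (D.Y 0 x)
  sin_pos : ∀ (i : Fin 4) x, 0 < sin (D.X (i + 1) x - D.X i x)

/-- An eventual property along `small r B` holds for all data with `ε` below some threshold. This is
where constants depending only on `r` and `B` come out. -/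
theorem exists_estimates (hr : 0 < r) : ∃ C e : ℝ, 0 < C ∧ 0 < e ∧
    ∀ D : BilliardDatum r B, D.ε < e → D.Estimates C := by
  obtain ⟨C₁, hC₁, h₁⟩ := uniformO_d_add_pi (B := B) hr (show 3 ≤ 4 by norm_num)
  obtain ⟨C₂, hC₂, h₂⟩ := uniformO_d_add_pi_div_two (B := B) hr (show 2 ≤ 4 by norm_num)
  obtain ⟨C₃, hC₃, h₃⟩ := UniformO.exists_plane_bound ε_nonneg'
    (uniformO_curvePoint (B := B) hr (show 2 ≤ 4 by norm_num))
  obtain ⟨C₄, hC₄, h₄⟩ := UniformO.exists_plane_bound ε_nonneg'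
    (uniformO_lineMeet (B := B) hr (show 2 ≤ 4 by norm_num))
  obtain ⟨C₅, hC₅, h₅⟩ := uniformO_sq_add (B := B) hr (show 3 ≤ 4 by norm_num)
  obtain ⟨C₆, hC₆, h₆⟩ := uniformO_h_sub (B := B) hr (show 2 ≤ 4 by norm_num)
  obtain ⟨C₇, hC₇, h₇⟩ := uniformO_h_quarter_sub (B := B) hr (show 2 ≤ 4 by norm_num)
  have pos : ∀ {F : BilliardDatum r B → ℝ → ℝ}, UniformPos (small r B) F →
      ∀ᶠ D in small r B, ∀ x, 0 < F D x := fun ⟨c, hc, h⟩ =>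
    h.mono fun D hD x => hc.trans_le (hD x)
  set C := C₁ + C₂ + C₃ + C₄ + C₅ + C₆ + C₇ + 1 with hC
  have key : ∀ᶠ D in small r B, D.Estimates C := by
    filter_upwards [h₁, h₂, h₃, h₄, h₅, h₆, h₇, pos (uniformPos_h hr),
      pos (uniformPos_support_chord hr),
      eventually_all.2 fun i : Fin 4 => pos (uniformPos_sin_X_sub hr i)]
      with D h₁ h₂ h₃ h₄ h₅ h₆ h₇ h₈ h₉ h₁₀
    have hle : ∀ {a : ℝ}, a ≤ C → a * D.ε ≤ C * D.ε := fun h =>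
      mul_le_mul_of_nonneg_right h D.ε_nonneg
    exact ⟨h₁.mono le_rfl (hle (by linarith)), h₂.mono le_rfl (hle (by linarith)),
      fun i => (h₃ i).mono le_rfl (hle (by linarith)),
      fun i => (h₄ i).mono le_rfl (hle (by linarith)), h₅.mono le_rfl (hle (by linarith)),
      h₆.mono le_rfl (hle (by linarith)), h₇.mono le_rfl (hle (by linarith)), h₈, h₉, h₁₀⟩
  obtain ⟨e, he, h⟩ := (Metric.nhds_basis_ball.comap ε).eventually_iff.1 key
  refine ⟨C, e, by positivity, he, fun D hD => h ?_⟩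
  rw [mem_preimage, mem_ball_zero_iff, Real.norm_eq_abs, abs_of_nonneg D.ε_nonneg]
  exact hD

end BilliardDatum

theorem supportFn_periodic (Ω : Set Plane) : Function.Periodic (supportFn Ω) (2 * π) := fun x => by
  simp [supportFn]

theorem supportFn_add_pi {Ω : Set Plane} (h : ∀ x ∈ Ω, -x ∈ Ω) (ψ : ℝ) :
    supportFn Ω (ψ + π) = supportFn Ω ψ := by
  unfold supportFn
  congr 1
  ext t
  constructor
  · rintro ⟨x, hx, rfl⟩
    refine ⟨-x, h x hx, ?_⟩
    simp
  · rintro ⟨x, hx, rfl⟩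
    refine ⟨-x, h x hx, ?_⟩
    simp

theorem Function.Periodic.iteratedDeriv {f : ℝ → ℝ} {c : ℝ} (hf : Function.Periodic f c) (k : ℕ) :
    Function.Periodic (iteratedDeriv k f) c := by
  induction k with
  | zero => simpa using hf
  | succ k ih =>
    rw [iteratedDeriv_succ]
    exact deriv_periodic ih

/-- Periodicity and continuity make the suprema genuine; for an unbounded set the real supremum
would default to 0. -/
theorem CBound.cNorm {f : ℝ → ℝ} {n : ℕ} (hf : ContDiff ℝ n f)
    (hp : Function.Periodic f (2 * π)) : CBound n (cNorm n f) f := by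
  refine ⟨hf, fun k hk x => ?_⟩
  have hb : ∀ k : Fin (n + 1), BddAbove (range fun x => |iteratedDeriv (k : ℕ) f x|) := by
    intro k
    have hc : Continuous fun x => |iteratedDeriv (k : ℕ) f x| :=
      (hf.continuous_iteratedDeriv k (by exact_mod_cast Nat.lt_succ_iff.1 k.2)).abs
    have hper : Function.Periodic (fun x => |iteratedDeriv (k : ℕ) f x|) (2 * π) := fun x => by
      simp only [hp.iteratedDeriv (k : ℕ) x]
    exact (hper.compact_of_continuous (by positivity) hc).bddAbove
  exact (le_ciSup (hb ⟨k, Nat.lt_succ_of_le hk⟩) x).trans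
    (le_ciSup (f := fun k : Fin (n + 1) => ⨆ x : ℝ, |iteratedDeriv (k : ℕ) f x|)
      (finite_range _).bddAbove ⟨k, Nat.lt_succ_of_le hk⟩)

/-- The determinant of the two endpoints is the length of the chord times its support number. -/
theorem isParallelogram_chord {Ω : Set Plane} (hh : IsSmoothSupport (supportFn Ω)) {a φ b : ℝ}
    (hc : IsChord (supportFn Ω) a φ b) (hp : 0 < supportAt (supportFn Ω) a φ) :
    IsParallelogram (centralParallelogram (bdryPoint Ω a) (bdryPoint Ω b)) := by
  obtain ⟨s, hs, e⟩ := hc.sub_eq hh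
  apply isParallelogram_centralParallelogram
  rw [← normalForm_bdryPoint] at hp
  rw [sub_eq_iff_eq_add.1 e]
  refine (lt_of_lt_of_eq (mul_pos hs hp) ?_).ne'
  simp [normalForm, unitTangent]
  ring

theorem exists_billiardDatum {r M ε : ℝ} {Ω₀ Ω K : Set Plane} {m : ℕ} (hm : 12 ≤ m) (hr : 0 < r)
    (hsymm : ∀ x ∈ Ω₀, -x ∈ Ω₀)
    (hd₀ : ContDiff ℝ m (supportFn Ω₀)) (hM₀ : cNorm m (supportFn Ω₀) < M)
    (hk : ∀ ψ, 2 * r ≤ supportFn Ω₀ ψ + deriv (deriv (supportFn Ω₀)) ψ)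
    (hΩ : IsTable Ω) (hd : ContDiff ℝ m (supportFn Ω)) (hM : cNorm m (supportFn Ω) < 2 * M)
    (hε : ε = cNorm 5 (fun ψ => supportFn Ω ψ - supportFn Ω₀ ψ)) (hεr : 2 * ε ≤ r)
    (hK : IsRationalCaustic 4 Ω K) :
    ∃ D : BilliardDatum r (2 * M), D.h = supportFn Ω ∧ D.ε = ε ∧
      D.R = √(supportFn Ω₀ 0 ^ 2 + supportFn Ω₀ (π / 2) ^ 2) := by
  have hp₀ := supportFn_periodic Ω₀
  have hp := supportFn_periodic Ω
  have b₀ := CBound.cNorm hd₀ hp₀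
  have b := CBound.cNorm hd hp
  have hdg : ContDiff ℝ m fun ψ => supportFn Ω ψ - supportFn Ω₀ ψ := hd.sub hd₀
  have hg : CBound 5 ε fun ψ => supportFn Ω ψ - supportFn Ω₀ ψ := by
    rw [hε]
    refine CBound.cNorm (hdg.of_le (by exact_mod_cast (by omega : 5 ≤ m))) fun x => ?_
    simp only [hp x, hp₀ x]
  have hε0 : 0 ≤ ε := (abs_nonneg _).trans (hg.abs_le 0)
  have hM0 : 0 ≤ M := ((abs_nonneg _).trans (b₀.abs_le 0)).trans hM₀.le
  have hdiff : ∀ {h : ℝ → ℝ}, ContDiff ℝ m h → ContDiff ℝ (1 + 1) h := fun h =>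
    h.of_le (by exact_mod_cast (by omega : 1 + 1 ≤ m))
  have hdd : ∀ {h : ℝ → ℝ}, ContDiff ℝ m h → ∀ x, DifferentiableAt ℝ h x ∧
      DifferentiableAt ℝ (deriv h) x := fun h x =>
    ⟨(h.differentiable (by exact_mod_cast (by omega : m ≠ 0))) x,
      ((contDiff_succ_iff_deriv.1 (hdiff h)).2.2.differentiable one_ne_zero) x⟩
  have hcurv : ∀ x, r ≤ supportFn Ω x + deriv (deriv (supportFn Ω)) x := by
    intro x
    have h0 := hg.abs_le x
    have h2 := (CBound.succ_iff.1 (CBound.succ_iff.1 hg).2.2).2.2.abs_le x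
    have e1 : deriv (fun ψ => supportFn Ω ψ - supportFn Ω₀ ψ) =
        fun ψ => deriv (supportFn Ω) ψ - deriv (supportFn Ω₀) ψ :=
      funext fun y => ((hdd hd y).1.hasDerivAt.sub (hdd hd₀ y).1.hasDerivAt).deriv
    have e2 := ((hdd hd x).2.hasDerivAt.sub (hdd hd₀ x).2.hasDerivAt).deriv
    change deriv (fun ψ => deriv (supportFn Ω) ψ - deriv (supportFn Ω₀) ψ) x = _ at e2
    rw [e1, e2] at h2
    linarith [(abs_le.1 h0).1, (abs_le.1 h2).1, hk x]
  have hsm : IsSmoothSupport (supportFn Ω) :=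
    ⟨by simpa [one_add_one_eq_two] using hdiff hd, hp, fun x => hr.trans_le (hcurv x)⟩
  obtain ⟨d, f, hc⟩ := hK.exists_invariantCurve hΩ.isCompact hsm
  have hsq : ∀ x, |supportFn Ω x ^ 2 - supportFn Ω₀ x ^ 2| ≤ 3 * M * ε := by
    intro x
    rw [sq_sub_sq, abs_mul]
    refine mul_le_mul ?_ (hg.abs_le x) (abs_nonneg _) (by positivity)
    refine (abs_add_le _ _).trans ?_
    linarith [b.abs_le x, b₀.abs_le x]
  -- The symmetric support function cancels: this is the increment over π of the difference of the
  -- two support functions, whence the factor 2.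
  have hnear : CBound 5 (2 * ε) fun x => supportFn Ω (x + π) - supportFn Ω x := by
    have e : (fun x => supportFn Ω (x + π) - supportFn Ω x) = fun x =>
        (fun x => (supportFn Ω (x + π) - supportFn Ω₀ (x + π))) x -
          (fun x => (supportFn Ω x - supportFn Ω₀ x)) x := funext fun x => by
      simp only [supportFn_add_pi hsymm x]
      ring
    have hs : ContDiff ℝ 5 fun x => supportFn Ω (x + π) - supportFn Ω₀ (x + π) :=
      hg.1.comp (contDiff_id.add contDiff_const)
    rw [e]
    refine ⟨hs.sub hg.1, fun k hk x => ?_⟩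
    have hk' : (k : WithTop ℕ∞) ≤ 5 := by exact_mod_cast hk
    rw [iteratedDeriv_fun_sub (hs.of_le hk').contDiffAt (hg.1.of_le hk').contDiffAt]
    have e2 := congrFun (iteratedDeriv_comp_add_const k
      (fun x => supportFn Ω x - supportFn Ω₀ x) π) x
    rw [e2, two_mul]
    exact (norm_sub_le _ _).trans (add_le_add (hg.2 k hk _) (hg.2 k hk _))
  refine ⟨⟨supportFn Ω, d, f, ε, √(supportFn Ω₀ 0 ^ 2 + supportFn Ω₀ (π / 2) ^ 2),
    b.mono hm hM.le, hsm, hcurv, hc, hε0, hnear, sqrt_nonneg _, ?_⟩, rfl, rfl, rfl⟩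
  rw [sq_sqrt (by positivity)]
  have h3 := abs_add_le (supportFn Ω 0 ^ 2 - supportFn Ω₀ 0 ^ 2)
    (supportFn Ω (π / 2) ^ 2 - supportFn Ω₀ (π / 2) ^ 2)
  have h4 : 0 ≤ M * ε := mul_nonneg hM0 hε0
  calc _ = _ := by
        congr 1
        ring
    _ ≤ _ := h3
    _ ≤ 3 * M * ε + 3 * M * ε := add_le_add (hsq 0) (hsq _)
    _ ≤ _ := by linarith

theorem theorem3 :
    ∀ κ₀ κ₁ M : ℝ, 0 < κ₀ →
    -- the constants depend on the curvature bounds and on `M` only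
    ∃ ε₁ C : ℝ, 0 < ε₁ ∧ 0 < C ∧
    ∀ m : ℕ, 40 ≤ m →
    -- the centrally symmetric table
    ∀ Ω₀ : Set Plane, IsTable Ω₀ → (∀ x ∈ Ω₀, -x ∈ Ω₀) →
      ContDiff ℝ m (supportFn Ω₀) → cNorm m (supportFn Ω₀) < M →
      (∀ ψ, κ₀ < curvature Ω₀ ψ ∧ curvature Ω₀ ψ < κ₁) →
    ∃ R₀ : ℝ, 0 < R₀ ∧
    -- the nearby table and its caustic
    ∀ Ω : Set Plane, IsTable Ω →
      ContDiff ℝ m (supportFn Ω) → cNorm m (supportFn Ω) < 2 * M →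
    ∀ ε : ℝ, ε = cNorm 5 (fun ψ => supportFn Ω ψ - supportFn Ω₀ ψ) → ε < ε₁ →
      (∃ K : Set Plane, IsRationalCaustic 4 Ω K) →
    ∃ d : ℝ → ℝ, IsLoopAngle Ω 4 d ∧
      CBound 3 (C * ε) (fun ψ => d (ψ + π) - d ψ) ∧
      CBound 2 (C * ε) (fun ψ => d (ψ + π / 2) - (π / 2 - d ψ)) ∧
      -- `z ψ` is the one periodic orbit that starts at the point with parameter `ψ`
      (∃ z : ℝ → ℤ → ℝ × ℝ,
        (∀ ψ, IsOrbit Ω (z ψ) ∧ IsPeriodicOrbit 1 4 (z ψ) ∧ z ψ 0 = (ψ, d ψ)) ∧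
        (∀ w, IsOrbit Ω w → IsPeriodicOrbit 1 4 w → w = z (w 0).1) ∧
        -- its vertices are close to those of a parallelogram
        (∃ P : ℝ → Fin 4 → Plane, (∀ ψ, IsParallelogram (P ψ)) ∧
          ∀ i : Fin 4, CBound 2 (C * ε)
            (fun ψ => bdryPoint Ω (z ψ ((i : ℕ) : ℤ)).1 - P ψ i)) ∧
        -- the tangent lines at its vertices meet in points `X ψ i` close to those of a rectangle
        (∃ X Q : ℝ → Fin 4 → Plane,
          (∀ ψ, ∀ i : Fin 4,
            tangentLine Ω (z ψ ((i : ℕ) : ℤ)).1 ∩ tangentLine Ω (z ψ (((i : ℕ) : ℤ) + 1)).1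
              = {X ψ i}) ∧
          (∀ ψ, IsRectangle (Q ψ)) ∧
          ∀ i : Fin 4, CBound 2 (C * ε) (fun ψ => X ψ i - Q ψ i))) ∧
      CBound 3 (C * ε)
        (fun ψ => supportFn Ω ψ ^ 2 + supportFn Ω (ψ + π / 2) ^ 2 - R₀ ^ 2) ∧
      CBound 2 (C * ε) (fun ψ => supportFn Ω ψ - R₀ * sin (d ψ)) ∧
      CBound 2 (C * ε) (fun ψ => supportFn Ω (ψ + π / 2) - R₀ * cos (d ψ)) := by
  intro κ₀ κ₁ M hκ₀
  -- The symmetric table has radius of curvature at least 1/κ₁ ≥ 2r, and half of this survives the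
  -- perturbation once ε < r/2. The maximum with 1 keeps `r` positive for every real `κ₁`.
  set r : ℝ := (2 * max κ₁ 1)⁻¹ with hr
  have hmax : 0 < max κ₁ 1 := lt_max_of_lt_right one_pos
  have hr0 : 0 < r := by positivity
  obtain ⟨C, e, hC, he, hest⟩ := BilliardDatum.exists_estimates (B := 2 * M) hr0
  refine ⟨min e (r / 2), C, lt_min he (by positivity), hC, ?_⟩
  intro m hm Ω₀ hΩ₀ hsymm hd₀ hM₀ hcurv
  have hpos : 0 < supportFn Ω₀ 0 := by
    have := normalForm_lt_supportFn hΩ₀.isCompact hΩ₀.origin_mem 0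
    simpa [normalForm] using this
  -- The radius is read off the symmetric table at ψ = 0, so it does not depend on the perturbed
  -- table.
  refine ⟨√(supportFn Ω₀ 0 ^ 2 + supportFn Ω₀ (π / 2) ^ 2), sqrt_pos.2 (by positivity), ?_⟩
  intro Ω hΩ hd hM ε hε hε₁ ⟨K, hK⟩
  have hk : ∀ ψ, 2 * r ≤ supportFn Ω₀ ψ + deriv (deriv (supportFn Ω₀)) ψ := by
    intro ψ
    obtain ⟨h1, h2⟩ := hcurv ψ
    rw [curvature, iteratedDeriv_succ, iteratedDeriv_one] at h1 h2
    have h3 := inv_pos.1 (hκ₀.trans h1)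
    have h4 := (inv_lt_comm₀ h3 ((hκ₀.trans h1).trans h2)).1 h2
    refine le_trans ?_ h4.le
    rw [hr, mul_inv, mul_inv_cancel_left₀ two_ne_zero]
    exact inv_anti₀ ((hκ₀.trans h1).trans h2) (le_max_left _ _)
  obtain ⟨D, hDh, hDε, hDR⟩ := exists_billiardDatum (by omega) hr0 hsymm hd₀ hM₀ hk hΩ hd hM hε
    (by linarith [hε₁.trans_le (min_le_right _ _)]) hK
  have hD := hest D (by rw [hDε]; exact hε₁.trans_le (min_le_left _ _))
  have hsm : IsSmoothSupport (supportFn Ω) := hDh ▸ D.smooth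
  have hcv : IsInvariantCurve (supportFn Ω) D.d D.f := hDh ▸ D.curve
  obtain ⟨z, hz, huniq, hzX⟩ := hcv.exists_orbits hsm
  have hzX' : ∀ ψ (k : ℕ), (z ψ k).1 = D.X k ψ := hzX
  rw [← hDε, ← hDR, ← hDh]
  refine ⟨D.d, hcv.isLoopAngle hsm, hD.angle_pi, hD.angle_quarter, ⟨z, hz, huniq,
    ⟨fun ψ => centralParallelogram (bdryPoint Ω ψ) (bdryPoint Ω (D.X 1 ψ)), fun ψ => ?_,
      fun i => ?_⟩,
    ⟨fun ψ i => lineMeet (D.X i ψ) (D.X (i + 1) ψ) (D.h (D.X i ψ)) (D.h (D.X (i + 1) ψ)),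
      fun ψ => centralRectangle (D.h ψ) (D.h (ψ + π / 2)) ψ, fun ψ i => ?_, fun ψ => ?_,
      hD.tangent⟩⟩, hD.sq_add, hD.sin_angle, hD.cos_angle⟩
  · have h1 := D.chord 0 ψ
    have h2 := hD.support_chord_pos ψ
    rw [hDh] at h1 h2
    exact isParallelogram_chord hsm h1 h2
  · have h1 := hD.vertex i
    rw [hDh] at h1
    simp only [hzX']
    exact h1
  · have h1 := hzX' ψ (i + 1)
    push_cast at h1
    rw [hzX', h1, hDh]
    exact tangentLine_inter (hD.sin_pos i ψ).ne'
  · exact isRectangle_centralRectangle (hD.support_pos ψ) (hD.support_pos _) ψ
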